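/- Let $\mathcal W_2(\mathbb R)$ be the set of probability measures on $\mathbb R$ with finite second moment, with the distance $W_2(\mu,\nu)=\big(\inf_{\pi\in\Pi(\mu,\nu)}\int|x-y|^2\,d\pi(x,y)\big)^{1/2}$, $\Pi(\mu,\nu)$ being the set of couplings of $\mu$ and $\nu$. Let $p\ge 1$ and let $\Theta\subset\mathbb R^p$ be bounded and satisfy an interior cone condition: there is $\kappa>0$ such that for every $\theta\in\Theta$ there is $v\in\mathbb R^p$ such that $\Theta$ contains the open ball of centre $\theta+sv$ and radius $\kappa s$ for all $0<s\le 1$ (every bounded convex set with non-empty interior qualifies). Let $\theta_0$ lie in the interior of $\Theta$. Partial derivatives at points of $\Theta$ that are not interior are taken within $\Theta$. Suppose that, for some constants $L,A\in\mathbb R$, $\tau>1$ and $c>0$, the following conditions hold. 1. There is a triangular array of points $\mu_i=\mu_i^{(n)}\in\mathcal W_2(\mathbb R)$, $1\le i\le n$, such that $\mu_i^{(n)}$ has support in $[i,i+L]$. 2. For $\theta\in\Theta$, $K_\theta(\mu,\nu)=F_\theta(W_2(\mu,\nu))$ is a covariance function (positive semidefinite kernel) on $\mathcal W_2(\mathbb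 R)$, where $F_\theta:[0,\infty)\to\mathbb R$ and $\sup_{\theta\in\Theta}|F_\theta(t)|\le A/(1+t^{1+\tau})$ for all $t\ge0$. 3. $Y$ is a centered Gaussian process indexed by $\mathcal W_2(\mathbb R)$ with covariance function $K_{\theta_0}$, and one observes $y=(y_1,\dots,y_n)^t$ with $y_i=Y(\mu_i)$. 4. For all $n\ge1$ and $\theta\in\Theta$, the smallest eigenvalue of $R_\theta=(K_\theta(\mu_i,\mu_j))_{1\le i,j\le n}$ is at least $c$. 5. For all $\alpha>0$, $\liminf_{n\to\infty}\inf_{\theta\in\Theta,\ \|\theta-\theta_0\|\ge\alpha}\frac1n\sum_{i,j=1}^n[K_\theta(\mu_i,\mu_j)-K_{\theta_0}(\mu_i,\mu_j)]^2>0$ (with $\inf\emptyset=+\infty$). 6. For all $t\ge0$, $\theta\mapsto F_\theta(t)$ is continuously differentiable on $\Theta$ and $\sup_{\theta\in\Theta}\max_i|\partial_{\theta_i}F_\theta(t)|\le A/(1+t^{1+\tau})$. 7. For all $t\ge0$, $\theta\mapsto F_\theta(t)$ is three times continuously differentiable on $\Theta$ and $\sup_{\theta\in\Theta}|\partial_{\theta_{i_1}}\cdots\partial_{\theta_{i_q}}F_\theta(t)|\le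 A/(1+t^{1+\tau})$ for $q\in\{2,3\}$ and all $i_1,\dots,i_q\in\{1,\dots,p\}$. 8. For all $(\lambda_1,\dots,\lambda_p)\ne0$, $\liminf_{n\to\infty}\frac1n\sum_{i,j=1}^n\big(\sum_{k=1}^p\lambda_k\,\partial_{\theta_k}K_{\theta_0}(\mu_i,\mu_j)\big)^2>0$. For each $n\geq 1$, let $\hat\theta_{ML}$ be a random vector that almost surely belongs to $\Theta$ and minimizes over $\Theta$ the function $L_\theta=\frac1n\ln\det R_\theta+\frac1n y^tR_\theta^{-1}y$. Let $M_{ML}$ be the $p\times p$ matrix with entries $$(M_{ML})_{i,j}=\frac1{2n}\operatorname{Tr}\Big(R_{\theta_0}^{-1}\frac{\partial R_{\theta_0}}{\partial\theta_i}R_{\theta_0}^{-1}\frac{\partial R_{\theta_0}}{\partial\theta_j}\Big).$$ Then, as $n\to\infty$, $\sqrt n\,M_{ML}^{1/2}(\hat\theta_{ML}-\theta_0)$ converges in law to $\mathcal N(0,I_p)$, and $$0<\liminf_{n\to\infty}\lambda_{\min}(M_{ML})\le\limsup_{n\to\infty}\lambda_{\max}(M_{ML})<+\infty.$$ -/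

import Mathlib

open MeasureTheory ProbabilityTheory Filter Topology
open scoped ENNReal MatrixOrder

namespace WassersteinGP

/-- The Wasserstein space: probability measures on `ℝ` with a finite moment of order two. -/
abbrev WSpace : Type :=
  {μ : ProbabilityMeasure ℝ // MemLp (fun x : ℝ => x) 2 (μ : Measure ℝ)}

/-- The measure underlying a point of the Wasserstein space. -/
noncomputable abbrev WSpace.toMeasure (μ : WSpace) : Measure ℝ := (μ.1 : Measure ℝ)

/-- Quadratic transportation cost: infimum over all couplings of the mean squared distance. -/
noncomputable def transportCost (μ ν : WSpace) : ℝ≥0∞ :=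
  ⨅ π ∈ {π : Measure (ℝ × ℝ) | π.fst = μ.toMeasure ∧ π.snd = ν.toMeasure},
    ∫⁻ z, ENNReal.ofReal (|z.1 - z.2| ^ 2) ∂π

/-- The quadratic Wasserstein distance. -/
noncomputable def W₂ (μ ν : WSpace) : ℝ := Real.sqrt (transportCost μ ν).toReal

/-- The parameter space `ℝ^p` with its Euclidean norm. -/
abbrev Param (p : ℕ) : Type := EuclideanSpace ℝ (Fin p)

/-- The distance-based kernel `K_θ(μ, ν) = F_θ(W₂(μ, ν))`. Only the values `F θ t` with
`θ ∈ Θ` and `t ≥ 0` matter. -/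
noncomputable def kernel {p : ℕ} (F : Param p → ℝ → ℝ) (θ : Param p) (μ ν : WSpace) : ℝ :=
  F θ (W₂ μ ν)

/-- A covariance (positive definite) kernel: all its finite Gram matrices are symmetric positive
semidefinite. -/
def IsCovarianceKernel (K : WSpace → WSpace → ℝ) : Prop :=
  ∀ (m : ℕ) (x : Fin m → WSpace), (Matrix.of fun i j => K (x i) (x j)).PosSemidef

/-- A triangular array of observation points; the point `μ_i^{(n)}`, `1 ≤ i ≤ n`, is stored at
index `i - 1` of `Fin n`. -/
abbrev PointArray : Type := (n : ℕ) → Fin n → WSpace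

/-- The covariance matrix `R_θ` of the first `n` observations. -/
noncomputable def covMatrix {p : ℕ} (F : Param p → ℝ → ℝ) (μ : PointArray) (n : ℕ)
    (θ : Param p) : Matrix (Fin n) (Fin n) ℝ :=
  Matrix.of fun i j => kernel F θ (μ n i) (μ n j)

/-- The partial derivative in the `k`-th coordinate of a function on `Θ ⊆ ℝ^p`. At interior
points of `Θ` it is the ordinary one; at other points it is the derivative within `Θ`. -/
noncomputable def partialD {p : ℕ} (Θ : Set (Param p)) (k : Fin p) (g : Param p → ℝ)
    (θ : Param p) : ℝ :=
  fderivWithin ℝ g Θ θ (EuclideanSpace.single k 1)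

/-- The matrix `∂R_θ/∂θ_k`. -/
noncomputable def covMatrixD {p : ℕ} (Θ : Set (Param p)) (F : Param p → ℝ → ℝ) (μ : PointArray)
    (n : ℕ) (k : Fin p) (θ : Param p) : Matrix (Fin n) (Fin n) ℝ :=
  Matrix.of fun i j => partialD Θ k (fun η => kernel F η (μ n i) (μ n j)) θ

/-- The (rescaled, negative) Gaussian log-likelihood
`L_θ = (1/n) log det R_θ + (1/n) yᵀ R_θ⁻¹ y`. -/
noncomputable def likelihood {p : ℕ} (F : Param p → ℝ → ℝ) (μ : PointArray) (n : ℕ)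
    (y : Fin n → ℝ) (θ : Param p) : ℝ :=
  (1 / (n : ℝ)) * Real.log (covMatrix F μ n θ).det
    + (1 / (n : ℝ)) * (y ⬝ᵥ ((covMatrix F μ n θ)⁻¹.mulVec y))

/-- `θhat n` is a maximum likelihood estimator for each `n ≥ 1`: a random vector which almost
surely lies in `Θ` and minimizes `L_θ` over `Θ`, for the data `y_i = Y(μ_i)`. -/
def IsMLE {p : ℕ} {Ω : Type*} [MeasurableSpace Ω] (P : Measure Ω) (Θ : Set (Param p))
    (F : Param p → ℝ → ℝ) (μ : PointArray) (Y : WSpace → Ω → ℝ) (θhat : ℕ → Ω → Param p) : Prop :=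
  (∀ n, AEMeasurable (θhat n) P) ∧
  ∀ n, 1 ≤ n → ∀ᵐ ω ∂P, θhat n ω ∈ Θ ∧
    ∀ θ ∈ Θ, likelihood F μ n (fun i => Y (μ n i) ω) (θhat n ω)
      ≤ likelihood F μ n (fun i => Y (μ n i) ω) θ

/-- The `p × p` matrix with entries `(1/2n) Tr(R⁻¹ ∂_iR R⁻¹ ∂_jR)` at the parameter `θ`. -/
noncomputable def fisherMatrix {p : ℕ} (Θ : Set (Param p)) (F : Param p → ℝ → ℝ)
    (μ : PointArray) (n : ℕ) (θ : Param p) : Matrix (Fin p) (Fin p) ℝ :=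
  Matrix.of fun i j => (1 / (2 * (n : ℝ))) *
    ((covMatrix F μ n θ)⁻¹ * covMatrixD Θ F μ n i θ *
      (covMatrix F μ n θ)⁻¹ * covMatrixD Θ F μ n j θ).trace

/-- The smallest (real) eigenvalue of a matrix. -/
noncomputable def lambdaMin {ι : Type*} [Fintype ι] [DecidableEq ι] (A : Matrix ι ι ℝ) : EReal :=
  ⨅ x ∈ spectrum ℝ A, (x : EReal)

/-- The largest (real) eigenvalue of a matrix. -/
noncomputable def lambdaMax {ι : Type*} [Fintype ι] [DecidableEq ι] (A : Matrix ι ι ℝ) : EReal :=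
  ⨆ x ∈ spectrum ℝ A, (x : EReal)

/-- The interior cone condition. For a bounded set `Θ` the vectors `v` below are bounded, so that
`Θ` contains, at each of its points `θ`, a finite cone of vertex `θ`, namely
`{θ + s • (v + κ • u) | ‖u‖ < 1, 0 < s ≤ 1}`, of height and opening bounded below. -/
def ConeCondition {p : ℕ} (Θ : Set (Param p)) : Prop :=
  ∃ κ > (0 : ℝ), ∀ θ ∈ Θ, ∃ v : Param p, ∀ s : ℝ, 0 < s → s ≤ 1 →
    Metric.ball (θ + s • v) (κ * s) ⊆ Θ

/-- The point `μ_i^{(n)}` is supported in `[i, i + L]`. -/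
def Condition1 (μ : PointArray) (L : ℝ) : Prop :=
  ∀ (n : ℕ) (i : Fin n),
    (μ n i).toMeasure.support ⊆ Set.Icc ((i : ℝ) + 1) ((i : ℝ) + 1 + L)

/-- The kernels `F_θ(W₂(μ, ν))` are covariance kernels and `F_θ` decays uniformly in `θ ∈ Θ`. -/
def Condition2 {p : ℕ} (Θ : Set (Param p)) (F : Param p → ℝ → ℝ) (A τ : ℝ) : Prop :=
  (∀ θ ∈ Θ, IsCovarianceKernel (kernel F θ)) ∧
  ∀ t : ℝ, 0 ≤ t → ∀ θ ∈ Θ, |F θ t| ≤ A / (1 + |t| ^ (1 + τ))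

/-- `Y` is a centered Gaussian process on the Wasserstein space with covariance function
`K_{θ₀}`, where `θ₀ ∈ Θ`. -/
def Condition3 {p : ℕ} {Ω : Type*} [MeasurableSpace Ω] (P : Measure Ω) (Θ : Set (Param p))
    (F : Param p → ℝ → ℝ) (θ₀ : Param p) (Y : WSpace → Ω → ℝ) : Prop :=
  θ₀ ∈ Θ ∧ IsGaussianProcess Y P ∧ (∀ μ, ∫ ω, Y μ ω ∂P = 0) ∧
  ∀ μ ν, covariance (Y μ) (Y ν) P = kernel F θ₀ μ ν

/-- The eigenvalues of all the matrices `R_θ` are at least `c`. -/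
def Condition4 {p : ℕ} (Θ : Set (Param p)) (F : Param p → ℝ → ℝ) (μ : PointArray) (c : ℝ) : Prop :=
  ∀ n, 1 ≤ n → ∀ θ ∈ Θ, (c : EReal) ≤ lambdaMin (covMatrix F μ n θ)

/-- Asymptotic global identifiability of `θ₀`. -/
def Condition5 {p : ℕ} (Θ : Set (Param p)) (F : Param p → ℝ → ℝ) (μ : PointArray)
    (θ₀ : Param p) : Prop :=
  ∀ α : ℝ, 0 < α →
    0 < liminf (fun n : ℕ => ⨅ θ ∈ {θ : Param p | θ ∈ Θ ∧ α ≤ ‖θ - θ₀‖},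
      (((1 / (n : ℝ)) * ∑ i, ∑ j,
        (kernel F θ (μ n i) (μ n j) - kernel F θ₀ (μ n i) (μ n j)) ^ 2 : ℝ) : EReal)) atTop

/-- `F_θ(t)` is `C¹` in `θ ∈ Θ`, with first partial derivatives decaying uniformly. -/
def Condition6 {p : ℕ} (Θ : Set (Param p)) (F : Param p → ℝ → ℝ) (A τ : ℝ) : Prop :=
  ∀ t : ℝ, 0 ≤ t → ContDiffOn ℝ 1 (fun θ => F θ t) Θ ∧
    ∀ θ ∈ Θ, ∀ i, |partialD Θ i (fun η => F η t) θ| ≤ A / (1 + t ^ (1 + τ))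

/-- `F_θ(t)` is `C³` in `θ ∈ Θ`, with second and third partial derivatives decaying uniformly. -/
def Condition7 {p : ℕ} (Θ : Set (Param p)) (F : Param p → ℝ → ℝ) (A τ : ℝ) : Prop :=
  ∀ t : ℝ, 0 ≤ t → ContDiffOn ℝ 3 (fun θ => F θ t) Θ ∧
    (∀ θ ∈ Θ, ∀ i j,
      |partialD Θ i (partialD Θ j (fun η => F η t)) θ| ≤ A / (1 + t ^ (1 + τ))) ∧
    (∀ θ ∈ Θ, ∀ i j k,
      |partialD Θ i (partialD Θ j (partialD Θ k (fun η => F η t))) θ| ≤ A / (1 + t ^ (1 + τ)))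

/-- Asymptotic linear independence of the partial derivatives of the kernel at `θ₀`. -/
def Condition8 {p : ℕ} (Θ : Set (Param p)) (F : Param p → ℝ → ℝ) (μ : PointArray)
    (θ₀ : Param p) : Prop :=
  ∀ l : Fin p → ℝ, l ≠ 0 →
    0 < liminf (fun n : ℕ => (((1 / (n : ℝ)) * ∑ i, ∑ j,
      (∑ k, l k * partialD Θ k (fun η => kernel F η (μ n i) (μ n j)) θ₀) ^ 2 : ℝ) : EReal)) atTop

end WassersteinGP

/-! Since the supports of the `i`-th and `j`-th points are separated by about `|i - j|`, so are the
points in `W₂` (`le_W₂_of_support`). The kernel and its parameter derivatives decay faster than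
quadratically, so Schur's test (`exists_opNorm_le_of_decay`) bounds the operator norms of `R_θ`, of
its derivatives and of their Taylor remainders uniformly in `n` and `θ`; the eigenvalue condition
bounds `R_θ⁻¹`. These facts are gathered in `RegularModel`. What remains is the study of Gaussian
quadratic forms `yᵀBy` with bounded `B`: their fluctuations have order `√n`, and after
diagonalization they are weighted sums of independent chi-square variables, asymptotically normal
when no weight dominates.

Consistency. The mean of the likelihood gap is a Kullback-Leibler divergence, which dominates the
squared Frobenius distance `‖R_θ - R_θ₀‖²` (`frobSq_le_logDet`). At a minimizer this distance is
therefore at most a multiple of the fluctuation of a quadratic form. The fluctuation is uniformly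
`o(n)` in `θ`: Chebyshev handles the points of a finite net and a Lipschitz bound the rest, the cone
condition providing segments inside `Θ` to net points (`exists_finite_net`). Identifiability forbids
so small a distance away from `θ₀`.

Normality. Near `θ₀` the estimator solves the likelihood equations (`score_eq_zero`). Expanding them
gives `2n M (θhat - θ₀)` equal to the vector of centered score forms, up to errors negligible
against `n‖θhat - θ₀‖` (`exists_score_expansion`). The normalized scores satisfy a central limit
theorem (`tendsto_charFun_score`). `M` need not converge: its eigenvalues stay between positive
constants, and the test direction `M^{-1/2} t` is allowed to vary with `n`. Slutsky's lemma
concludes. The lower eigenvalue bound writes the quadratic form of `M` as a Frobenius norm and makes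
the linear independence condition uniform by compactness of the sphere. -/

namespace WassersteinGP

/-! ### Operator and Frobenius norms, and the divergence between Gaussian vectors -/

section MatrixNorm

open scoped Matrix.Norms.L2Operator
open Matrix

set_option linter.unusedSectionVars false

variable {ι : Type*} [Fintype ι] [DecidableEq ι]

lemma norm_toLp_sq (v : ι → ℝ) : ‖WithLp.toLp 2 v‖ ^ 2 = v ⬝ᵥ v := by
  rw [EuclideanSpace.norm_sq_eq]
  simp [dotProduct, sq]

lemma dotProduct_mulVec_mulVec_le (B : Matrix ι ι ℝ) (v : ι → ℝ) :
    (B *ᵥ v) ⬝ᵥ (B *ᵥ v) ≤ ‖B‖ ^ 2 * (v ⬝ᵥ v) := by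
  have h := l2_opNorm_mulVec B (WithLp.toLp 2 v)
  rw [← norm_toLp_sq, ← norm_toLp_sq, ← mul_pow]
  exact pow_le_pow_left₀ (norm_nonneg _) h 2

lemma dotProduct_self_nonneg' (v : ι → ℝ) : 0 ≤ v ⬝ᵥ v :=
  Finset.sum_nonneg fun i _ => mul_self_nonneg (v i)

lemma abs_dotProduct_mulVec_le (B : Matrix ι ι ℝ) (v w : ι → ℝ) :
    |v ⬝ᵥ B *ᵥ w| ≤ ‖B‖ * ‖WithLp.toLp 2 v‖ * ‖WithLp.toLp 2 w‖ := by
  have h := l2_opNorm_mulVec B (WithLp.toLp 2 w)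
  have h2 := abs_real_inner_le_norm (WithLp.toLp 2 (B *ᵥ w)) (WithLp.toLp 2 v)
  rw [EuclideanSpace.inner_toLp_toLp] at h2
  simp only [star_trivial] at h2
  refine h2.trans ?_
  calc _ ≤ ‖B‖ * ‖WithLp.toLp 2 w‖ * ‖WithLp.toLp 2 v‖ :=
        mul_le_mul_of_nonneg_right h (norm_nonneg (WithLp.toLp 2 v))
    _ = _ := by ring

lemma abs_quadForm_le (B : Matrix ι ι ℝ) (v : ι → ℝ) :
    |v ⬝ᵥ B *ᵥ v| ≤ ‖B‖ * (v ⬝ᵥ v) := by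
  rw [← norm_toLp_sq, sq, ← mul_assoc]
  exact abs_dotProduct_mulVec_le B v v

lemma opNorm_le_of_mulVec {B : Matrix ι ι ℝ} {K : ℝ} (hK : 0 ≤ K)
    (h : ∀ v, (B *ᵥ v) ⬝ᵥ (B *ᵥ v) ≤ K ^ 2 * (v ⬝ᵥ v)) : ‖B‖ ≤ K := by
  rw [l2_opNorm_def]
  refine ContinuousLinearMap.opNorm_le_bound _ hK fun x => ?_
  have := h x.ofLp
  refine le_of_sq_le_sq ?_ (by positivity)
  rw [mul_pow]
  have e1 : ‖x‖ ^ 2 = x.ofLp ⬝ᵥ x.ofLp := norm_toLp_sq x.ofLp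
  rw [e1]
  exact (norm_toLp_sq (B *ᵥ x.ofLp)).le.trans this

/-- Schur's test. -/
lemma opNorm_le_of_sum_le {B : Matrix ι ι ℝ} {K : ℝ} (hK : 0 ≤ K)
    (hr : ∀ i, ∑ j, |B i j| ≤ K) (hc : ∀ j, ∑ i, |B i j| ≤ K) : ‖B‖ ≤ K := by
  refine opNorm_le_of_mulVec hK fun v => ?_
  have h1 : ∀ i, (B *ᵥ v) i * (B *ᵥ v) i ≤ K * ∑ j, |B i j| * (v j * v j) := by
    intro i
    -- Cauchy-Schwarz with the weight `|B i j|` shared equally between the two factors.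
    have hcs := Finset.sum_sq_le_sum_mul_sum_of_sq_le_mul Finset.univ
      (r := fun j => |B i j| * |v j|) (f := fun j => |B i j|)
      (g := fun j => |B i j| * (v j * v j)) (fun j _ => abs_nonneg _)
      (fun j _ => mul_nonneg (abs_nonneg _) (mul_self_nonneg _))
      (fun j _ => le_of_eq (by rw [← abs_mul_abs_self (v j)]; ring))
    have h2 : |(B *ᵥ v) i| ≤ ∑ j, |B i j| * |v j| := by
      refine (Finset.abs_sum_le_sum_abs _ _).trans (le_of_eq ?_)
      simp [abs_mul]
    calc (B *ᵥ v) i * (B *ᵥ v) i = |(B *ᵥ v) i| ^ 2 := by rw [sq_abs, sq]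
      _ ≤ (∑ j, |B i j| * |v j|) ^ 2 := pow_le_pow_left₀ (abs_nonneg _) h2 2
      _ ≤ _ := hcs
      _ ≤ _ := mul_le_mul_of_nonneg_right (hr i)
        (Finset.sum_nonneg fun j _ => mul_nonneg (abs_nonneg _) (mul_self_nonneg _))
  calc (B *ᵥ v) ⬝ᵥ (B *ᵥ v) ≤ ∑ i, K * ∑ j, |B i j| * (v j * v j) :=
        Finset.sum_le_sum fun i _ => h1 i
    _ = K * ∑ j, (∑ i, |B i j|) * (v j * v j) := by
        rw [← Finset.mul_sum, Finset.sum_comm]; simp_rw [Finset.sum_mul]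
    _ ≤ K * ∑ j, K * (v j * v j) := by
        gcongr with j
        · exact mul_self_nonneg _
        · exact hc j
    _ = K ^ 2 * (v ⬝ᵥ v) := by rw [← Finset.mul_sum, dotProduct]; ring

lemma mulVec_single_dotProduct (B : Matrix ι ι ℝ) (j : ι) :
    (B *ᵥ Pi.single j 1) ⬝ᵥ (B *ᵥ Pi.single j 1) = ∑ i, B i j ^ 2 := by
  simp [dotProduct, sq]

/-- The squared Frobenius norm. -/
noncomputable def frobSq (B : Matrix ι ι ℝ) : ℝ := ∑ i, ∑ j, B i j ^ 2

lemma frobSq_nonneg (B : Matrix ι ι ℝ) : 0 ≤ frobSq B :=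
  Finset.sum_nonneg fun _ _ => Finset.sum_nonneg fun _ _ => sq_nonneg _

lemma frobSq_eq_columns (B : Matrix ι ι ℝ) :
    frobSq B = ∑ j, (B *ᵥ Pi.single j 1) ⬝ᵥ (B *ᵥ Pi.single j 1) := by
  simp_rw [mulVec_single_dotProduct]
  exact Finset.sum_comm

lemma frobSq_transpose (B : Matrix ι ι ℝ) : frobSq Bᵀ = frobSq B := by
  unfold frobSq
  rw [Finset.sum_comm]
  rfl

lemma frobSq_eq_trace (B : Matrix ι ι ℝ) : frobSq B = (Bᵀ * B).trace := by
  simp [frobSq, trace, mul_apply, sq]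
  exact Finset.sum_comm

/-- `A` acts on each column of `X` separately, and the squared Frobenius norm is the sum of the
squared norms of the columns. -/
lemma frobSq_mul_le (A X : Matrix ι ι ℝ) : frobSq (A * X) ≤ ‖A‖ ^ 2 * frobSq X := by
  rw [frobSq_eq_columns, frobSq_eq_columns X, Finset.mul_sum]
  refine Finset.sum_le_sum fun j _ => ?_
  rw [← mulVec_mulVec]
  exact dotProduct_mulVec_mulVec_le _ _

lemma norm_transpose (B : Matrix ι ι ℝ) : ‖Bᵀ‖ = ‖B‖ := by
  rw [← conjTranspose_eq_transpose_of_trivial, l2_opNorm_conjTranspose]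

lemma frobSq_mul_le' (X A : Matrix ι ι ℝ) : frobSq (X * A) ≤ ‖A‖ ^ 2 * frobSq X := by
  rw [← frobSq_transpose, transpose_mul, ← frobSq_transpose X, ← norm_transpose A]
  exact frobSq_mul_le _ _

lemma frobSq_le_card_mul (B : Matrix ι ι ℝ) : frobSq B ≤ Fintype.card ι * ‖B‖ ^ 2 := by
  rw [frobSq_eq_columns]
  refine (Finset.sum_le_card_nsmul _ _ (‖B‖ ^ 2) fun j _ => ?_).trans ?_
  · refine (dotProduct_mulVec_mulVec_le _ _).trans ?_
    simp
  · simp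

lemma abs_trace_le (B : Matrix ι ι ℝ) : |B.trace| ≤ Fintype.card ι * ‖B‖ := by
  refine (Finset.abs_sum_le_sum_abs _ _).trans ?_
  refine (Finset.sum_le_card_nsmul _ _ ‖B‖ fun j _ => ?_).trans (by simp)
  have := abs_quadForm_le B (Pi.single j 1)
  simpa using this

lemma frobSq_smul (a : ℝ) (B : Matrix ι ι ℝ) : frobSq (a • B) = a ^ 2 * frobSq B := by
  simp [frobSq, mul_pow, Finset.mul_sum]

/-- A symmetric matrix all of whose eigenvalues are at least `c`, as a quadratic form. -/
def Coercive (c : ℝ) (R : Matrix ι ι ℝ) : Prop :=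
  R.IsHermitian ∧ ∀ v, c * (v ⬝ᵥ v) ≤ v ⬝ᵥ R *ᵥ v

lemma Coercive.posDef {c : ℝ} (hc : 0 < c) {R : Matrix ι ι ℝ} (h : Coercive c R) : R.PosDef := by
  refine PosDef.of_dotProduct_mulVec_pos h.1 fun {x} hx => ?_
  have : 0 < x ⬝ᵥ x := lt_of_le_of_ne (dotProduct_self_nonneg' x)
    (fun h => hx (dotProduct_self_eq_zero.1 h.symm))
  simpa using lt_of_lt_of_le (mul_pos hc this) (h.2 x)

lemma Coercive.isUnit_det {c : ℝ} (hc : 0 < c) {R : Matrix ι ι ℝ} (h : Coercive c R) :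
    IsUnit R.det := (h.posDef hc).det_pos.ne'.isUnit

/-- For `u = R⁻¹ v`, coercivity and Cauchy-Schwarz give `c ‖u‖² ≤ u ⬝ᵥ v ≤ ‖u‖ ‖v‖`. -/
lemma Coercive.norm_inv_le {c : ℝ} (hc : 0 < c) {R : Matrix ι ι ℝ} (h : Coercive c R) :
    ‖R⁻¹‖ ≤ c⁻¹ := by
  refine opNorm_le_of_mulVec (inv_nonneg.2 hc.le) fun v => ?_
  set u := R⁻¹ *ᵥ v with hu
  have hv : R *ᵥ u = v := by
    rw [hu, mulVec_mulVec, mul_nonsing_inv _ (h.isUnit_det hc), one_mulVec]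
  have h1 := h.2 u
  rw [hv] at h1
  have h2 := abs_dotProduct_mulVec_le (1 : Matrix ι ι ℝ) u v
  rw [one_mulVec] at h2
  have h3 : ‖(1 : Matrix ι ι ℝ)‖ ≤ 1 := opNorm_le_of_mulVec zero_le_one fun v => by simp
  rw [← norm_toLp_sq] at h1 ⊢
  rw [← norm_toLp_sq]
  set a := ‖WithLp.toLp 2 u‖
  set b := ‖WithLp.toLp 2 v‖
  have ha : 0 ≤ a := norm_nonneg _
  have hb : 0 ≤ b := norm_nonneg _
  have h4 : c * a ^ 2 ≤ a * b := by
    calc c * a ^ 2 ≤ _ := h1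
      _ ≤ |u ⬝ᵥ v| := le_abs_self _
      _ ≤ ‖(1 : Matrix ι ι ℝ)‖ * a * b := h2
      _ ≤ 1 * a * b := by gcongr
      _ = a * b := by ring
  have h5 : c * a ≤ b := by
    rcases ha.eq_or_lt with h0 | h0
    · rw [← h0]; simpa using hb
    · nlinarith
  rw [← mul_pow]
  refine pow_le_pow_left₀ ha ?_ 2
  rwa [inv_mul_eq_div, le_div_iff₀ hc, mul_comm]

lemma norm_one_le : ‖(1 : Matrix ι ι ℝ)‖ ≤ 1 :=
  opNorm_le_of_mulVec zero_le_one fun v => by simp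

/-- Orthogonal diagonalization. -/
lemma exists_orthogonal_diagonal {R : Matrix ι ι ℝ} (hR : R.IsHermitian) :
    ∃ (U : Matrix ι ι ℝ) (d : ι → ℝ), U * Uᵀ = 1 ∧ Uᵀ * U = 1 ∧ R = U * diagonal d * Uᵀ ∧
      ∀ i, d i ∈ spectrum ℝ R := by
  refine ⟨hR.eigenvectorUnitary.1, hR.eigenvalues, ?_, ?_, ?_,
    fun i => hR.eigenvalues_mem_spectrum_real i⟩
  · exact Unitary.coe_mul_star_self hR.eigenvectorUnitary
  · exact Unitary.coe_star_mul_self hR.eigenvectorUnitary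
  · conv_lhs => rw [hR.spectral_theorem]
    simp [Unitary.conjStarAlgAut_apply, star_eq_conjTranspose]

lemma quadForm_orthogonal_diagonal (U : Matrix ι ι ℝ) (d v : ι → ℝ) :
    v ⬝ᵥ (U * diagonal d * Uᵀ) *ᵥ v = ∑ i, d i * ((Uᵀ *ᵥ v) i) ^ 2 := by
  rw [← mulVec_mulVec, ← mulVec_mulVec, dotProduct_mulVec, ← mulVec_transpose]
  simp only [dotProduct, mulVec_diagonal, sq]
  exact Finset.sum_congr rfl fun i _ => by ring

lemma sum_sq_orthogonal_mulVec {U : Matrix ι ι ℝ} (h : U * Uᵀ = 1) (v : ι → ℝ) :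
    ∑ i, ((Uᵀ *ᵥ v) i) ^ 2 = v ⬝ᵥ v := by
  have : (Uᵀ *ᵥ v) ⬝ᵥ (Uᵀ *ᵥ v) = v ⬝ᵥ v := by
    rw [dotProduct_mulVec, ← mulVec_transpose, transpose_transpose, mulVec_mulVec, h, one_mulVec]
  rw [← this]
  simp [dotProduct, sq]

lemma coercive_of_le_lambdaMin {c : ℝ} {R : Matrix ι ι ℝ} (hR : R.IsHermitian)
    (h : (c : EReal) ≤ lambdaMin R) : Coercive c R := by
  refine ⟨hR, fun v => ?_⟩
  obtain ⟨U, d, h1, -, h3, h4⟩ := exists_orthogonal_diagonal hR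
  have e : v ⬝ᵥ R *ᵥ v = ∑ i, d i * ((Uᵀ *ᵥ v) i) ^ 2 := by
    rw [h3]
    exact quadForm_orthogonal_diagonal U d v
  rw [e, ← sum_sq_orthogonal_mulVec h1, Finset.mul_sum]
  refine Finset.sum_le_sum fun i _ => mul_le_mul_of_nonneg_right ?_ (sq_nonneg _)
  exact_mod_cast h.trans (iInf₂_le _ (h4 i))

lemma dotProduct_eq_of_mulVec_eigen {R : Matrix ι ι ℝ} (hR : R.IsHermitian) {x : ℝ}
    (hx : x ∈ spectrum ℝ R) : ∃ v : ι → ℝ, v ⬝ᵥ v = 1 ∧ v ⬝ᵥ R *ᵥ v = x := by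
  rw [hR.spectrum_real_eq_range_eigenvalues] at hx
  obtain ⟨i, rfl⟩ := hx
  have h1 : (hR.eigenvectorBasis i).ofLp ⬝ᵥ (hR.eigenvectorBasis i).ofLp = 1 := by
    rw [← norm_toLp_sq]
    have := hR.eigenvectorBasis.orthonormal.1 i
    simp [this]
  refine ⟨(hR.eigenvectorBasis i).ofLp, h1, ?_⟩
  rw [hR.mulVec_eigenvectorBasis i, dotProduct_smul, h1]
  simp

/-- A lower bound for the Gaussian relative entropy integrand. -/
lemma sub_one_sub_log_ge {x M : ℝ} (hx : 0 < x) (hM : x ≤ M) :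
    (x - 1) ^ 2 / (2 * (M + 1)) ≤ x - 1 - Real.log x := by
  -- With `x = r²`, the right side minus `(r - 1)²` is `2 (r - 1 - log r) ≥ 0`, while `(x - 1)² = (r
  -- - 1)² (r + 1)²` and `(r + 1)² ≤ 2 (x + 1)`.
  set r := Real.sqrt x with hr
  have hr0 : 0 < r := Real.sqrt_pos.2 hx
  have hrx : r ^ 2 = x := Real.sq_sqrt hx.le
  have hl : Real.log x = 2 * Real.log r := by rw [← hrx, Real.log_pow]; norm_num
  have h1 := Real.log_le_sub_one_of_pos hr0
  rw [div_le_iff₀ (by linarith)]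
  have h2 : (r - 1) ^ 2 ≤ x - 1 - Real.log x := by rw [hl]; nlinarith
  have h3 : (x - 1) ^ 2 = (r - 1) ^ 2 * (r + 1) ^ 2 := by rw [← hrx]; ring
  have h4 : (r + 1) ^ 2 ≤ 2 * (M + 1) := by nlinarith [sq_nonneg (r - 1)]
  rw [h3]
  exact mul_le_mul h2 h4 (sq_nonneg _) ((sq_nonneg _).trans h2)

/-- Any factor will do: it serves to turn `A` into the identity by congruence with `S⁻¹`, and `‖S‖²
= ‖A‖` keeps the norms under control. -/
lemma exists_factorization {A : Matrix ι ι ℝ} (hA : A.PosDef) :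
    ∃ S : Matrix ι ι ℝ, A = Sᵀ * S ∧ IsUnit S.det := by
  obtain ⟨S, hS⟩ := CStarAlgebra.nonneg_iff_eq_star_mul_self.1 hA.posSemidef.nonneg
  rw [star_eq_conjTranspose, conjTranspose_eq_transpose_of_trivial] at hS
  refine ⟨S, hS, ?_⟩
  have h := hA.det_pos
  rw [hS, det_mul, det_transpose] at h
  exact isUnit_iff_ne_zero.2 fun h0 => by simp [h0] at h

lemma trace_orthogonal_conj {U : Matrix ι ι ℝ} (h : Uᵀ * U = 1) (D : Matrix ι ι ℝ) :
    (U * D * Uᵀ).trace = D.trace := by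
  rw [trace_mul_comm, ← mul_assoc, h, one_mul]

lemma norm_transpose_mul_self (S : Matrix ι ι ℝ) : ‖Sᵀ * S‖ = ‖S‖ ^ 2 := by
  rw [← conjTranspose_eq_transpose_of_trivial, l2_opNorm_conjTranspose_mul_self, sq]

/-- Quantitative positivity of the Kullback--Leibler divergence of centered Gaussian vectors. -/
lemma frobSq_le_logDet {A B : Matrix ι ι ℝ} (hA : A.PosDef) (hB : B.PosDef) {a b M : ℝ}
    (ha : ‖A‖ ≤ a) (hb : ‖A⁻¹‖ ≤ b) (hM : ‖B‖ ≤ M) :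
    frobSq (A - B) ≤ a ^ 2 * (2 * (b * M + 1)) *
      (Real.log A.det - Real.log B.det + (A⁻¹ * B).trace - Fintype.card ι) := by
  obtain ⟨S, hS, hSu⟩ := exists_factorization hA
  have hb0 : 0 ≤ b := (norm_nonneg _).trans hb
  have hM0 : 0 ≤ M := (norm_nonneg _).trans hM
  set T := S⁻¹ with hT
  have hTS : T * S = 1 := nonsing_inv_mul _ hSu
  have hST : S * T = 1 := mul_nonsing_inv _ hSu
  have hTS' : Sᵀ * Tᵀ = 1 := by rw [← transpose_mul, hTS, transpose_one]
  have hST' : Tᵀ * Sᵀ = 1 := by rw [← transpose_mul, hST, transpose_one]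
  have hAinv : A⁻¹ = T * Tᵀ := by
    rw [hS, Matrix.mul_inv_rev, ← transpose_nonsing_inv]
  have hTn : ‖T‖ ^ 2 ≤ b := by
    rw [← norm_transpose, ← norm_transpose_mul_self, transpose_transpose, ← hAinv]
    exact hb
  -- Congruence reduces the pair `(A, B)` to `(1, X)`. The divergence then becomes the sum of `d - 1
  -- - log d` over the eigenvalues `d` of `X`, to which the scalar inequality applies because `0 < d
  -- ≤ b M`.
  set X := Tᵀ * B * T with hX
  have hXn : ‖X‖ ≤ b * M := by
    calc ‖X‖ ≤ ‖Tᵀ‖ * ‖B‖ * ‖T‖ := by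
          refine (l2_opNorm_mul _ _).trans ?_
          gcongr
          exact l2_opNorm_mul _ _
      _ = ‖T‖ ^ 2 * ‖B‖ := by rw [norm_transpose]; ring
      _ ≤ b * M := by gcongr
  have hXp : X.PosDef := by
    have := hB.conjTranspose_mul_mul_same (B := T) (by
      intro v w hvw
      have := congrArg (fun z => S *ᵥ z) hvw
      simpa [mulVec_mulVec, hST] using this)
    rwa [conjTranspose_eq_transpose_of_trivial] at this
  obtain ⟨U, d, hU1, hU2, hXd, hd⟩ := exists_orthogonal_diagonal hXp.1
  have hdX : ∀ i, ∃ v : ι → ℝ, v ⬝ᵥ v = 1 ∧ v ⬝ᵥ X *ᵥ v = d i :=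
    fun i => dotProduct_eq_of_mulVec_eigen hXp.1 (hd i)
  have hd0 : ∀ i, 0 < d i := fun i => by
    obtain ⟨v, hv, hv2⟩ := hdX i
    rw [← hv2]
    have hv0 : v ≠ 0 := fun h => by simp [h] at hv
    simpa using hXp.dotProduct_mulVec_pos hv0
  have hdM : ∀ i, d i ≤ b * M := fun i => by
    obtain ⟨v, hv, hv2⟩ := hdX i
    rw [← hv2]
    have := abs_quadForm_le X v
    rw [hv, mul_one] at this
    exact (le_abs_self _).trans (this.trans hXn)
  have htr : (A⁻¹ * B).trace = ∑ i, d i := by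
    rw [hAinv, mul_assoc, trace_mul_comm, ← hX, hXd, trace_orthogonal_conj hU2, trace_diagonal]
  have hdetU : U.det * Uᵀ.det = 1 := by rw [← det_mul, hU1, det_one]
  have hdet : X.det = ∏ i, d i := by
    rw [hXd, det_mul, det_mul, det_diagonal, mul_right_comm, hdetU, one_mul]
  have hdet2 : B.det = A.det * X.det := by
    have e1 : T.det * S.det = 1 := by rw [← det_mul, hTS, det_one]
    rw [hX, hS, det_mul, det_mul, det_mul, det_transpose, det_transpose]
    calc B.det = (T.det * S.det) ^ 2 * B.det := by rw [e1]; ring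
      _ = _ := by ring
  have hlog : Real.log B.det = Real.log A.det + ∑ i, Real.log (d i) := by
    rw [hdet2, Real.log_mul hA.det_pos.ne' hXp.det_pos.ne', hdet,
      Real.log_prod fun i _ => (hd0 i).ne']
  have hfX : frobSq (1 - X) = ∑ i, (d i - 1) ^ 2 := by
    have e1 : 1 - X = U * diagonal (fun i => 1 - d i) * Uᵀ := by
      rw [hXd, ← diagonal_sub (fun _ => (1 : ℝ)) d]
      simp [mul_sub, sub_mul, hU1]
    rw [frobSq_eq_trace]
    have e2 : (1 - X)ᵀ = 1 - X := by
      have := hXp.1.eq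
      rw [conjTranspose_eq_transpose_of_trivial] at this
      rw [transpose_sub, this, transpose_one]
    rw [e2, e1]
    have e3 : U * diagonal (fun i => 1 - d i) * Uᵀ * (U * diagonal (fun i => 1 - d i) * Uᵀ)
        = U * (diagonal (fun i => 1 - d i) * diagonal (fun i => 1 - d i)) * Uᵀ := by
      calc _ = U * diagonal (fun i => 1 - d i) * (Uᵀ * U) * diagonal (fun i => 1 - d i) * Uᵀ := by
            simp only [mul_assoc]
        _ = _ := by rw [hU2]; simp only [mul_assoc, mul_one]
    rw [e3, trace_orthogonal_conj hU2, diagonal_mul_diagonal, trace_diagonal]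
    exact Finset.sum_congr rfl fun i _ => by ring
  have hAB : A - B = Sᵀ * (1 - X) * S := by
    rw [hX, mul_sub, sub_mul, mul_one, ← hS]
    congr 1
    calc B = (Sᵀ * Tᵀ) * B * (T * S) := by rw [hTS, hTS', one_mul, mul_one]
      _ = _ := by simp only [mul_assoc]
  have hSn : ‖S‖ ^ 2 ≤ a := by rw [← norm_transpose_mul_self, ← hS]; exact ha
  -- Undoing the congruence costs `‖S‖⁴ ≤ a²`.
  have h1 : frobSq (A - B) ≤ a ^ 2 * ∑ i, (d i - 1) ^ 2 := by
    rw [hAB, ← hfX]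
    calc _ ≤ ‖S‖ ^ 2 * (‖Sᵀ‖ ^ 2 * frobSq (1 - X)) :=
          (frobSq_mul_le' _ _).trans (by gcongr; exact frobSq_mul_le _ _)
      _ = (‖S‖ ^ 2) ^ 2 * frobSq (1 - X) := by rw [norm_transpose]; ring
      _ ≤ _ := by
        have := frobSq_nonneg (1 - X)
        gcongr
  refine h1.trans ?_
  rw [mul_assoc]
  refine mul_le_mul_of_nonneg_left ?_ (sq_nonneg a)
  have h2 : ∑ i, (d i - 1) ^ 2 ≤ ∑ i, 2 * (b * M + 1) * (d i - 1 - Real.log (d i)) := by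
    refine Finset.sum_le_sum fun i _ => ?_
    have := sub_one_sub_log_ge (hd0 i) (hdM i)
    rw [div_le_iff₀ (by positivity)] at this
    linarith
  refine h2.trans (le_of_eq ?_)
  rw [← Finset.mul_sum, hlog, htr]
  simp only [Finset.sum_sub_distrib, Finset.sum_const, Finset.card_univ, nsmul_eq_mul, mul_one]
  ring

end MatrixNorm

/-! ### Quadratic forms of Gaussian vectors: Chebyshev bound and central limit theorem -/

section GaussianQuadraticForm

open scoped Matrix.Norms.L2Operator
open Matrix

set_option linter.unusedSectionVars false

variable {Ω : Type*} [MeasurableSpace Ω] {P : Measure Ω} [IsProbabilityMeasure P]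

/-- Differentiating the Gaussian moment generating function amounts to `p ↦ p' + t p` on the
polynomial factor; four steps from `p = 1`, evaluated at `0`, yield the fourth moment. -/
lemma hasDerivAt_mul_exp_sq {p p' : ℝ → ℝ} (hp : ∀ t, HasDerivAt p (p' t) t) (t : ℝ) :
    HasDerivAt (fun t => p t * Real.exp (t ^ 2 / 2))
      ((p' t + t * p t) * Real.exp (t ^ 2 / 2)) t := by
  have h1 : HasDerivAt (fun t : ℝ => t ^ 2 / 2) t t := by
    convert! (hasDerivAt_pow 2 t).div_const 2 using 1
    norm_num
  convert! (hp t).mul h1.exp using 1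
  ring

lemma integral_pow_four_gaussianReal : ∫ x, x ^ 4 ∂(gaussianReal 0 1) = 3 := by
  have h := iteratedDeriv_mgf_zero (X := id) (μ := gaussianReal 0 1)
    (by rw [integrableExpSet_id_gaussianReal]; simp) 4
  rw [mgf_id_gaussianReal] at h
  have e : ∫ x, x ^ 4 ∂(gaussianReal 0 1) = ∫ x, (id ^ 4 : ℝ → ℝ) x ∂(gaussianReal 0 1) := rfl
  rw [e, ← h]
  have h0 : (fun t : ℝ => Real.exp (0 * t + ((1 : NNReal) : ℝ) * t ^ 2 / 2)) =
      fun t => 1 * Real.exp (t ^ 2 / 2) := by ext t; simp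
  have d1 : deriv (fun t : ℝ => 1 * Real.exp (t ^ 2 / 2)) = fun t => t * Real.exp (t ^ 2 / 2) := by
    ext t
    rw [(hasDerivAt_mul_exp_sq (p := fun _ => 1) (p' := fun _ => 0)
      (fun t => hasDerivAt_const t 1) t).deriv]
    ring
  have d2 : deriv (fun t : ℝ => t * Real.exp (t ^ 2 / 2)) =
      fun t => (1 + t ^ 2) * Real.exp (t ^ 2 / 2) := by
    ext t
    rw [(hasDerivAt_mul_exp_sq (p := fun t => t) (p' := fun _ => 1)
      (fun t => hasDerivAt_id t) t).deriv]
    ring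
  have d3 : deriv (fun t : ℝ => (1 + t ^ 2) * Real.exp (t ^ 2 / 2)) =
      fun t => (3 * t + t ^ 3) * Real.exp (t ^ 2 / 2) := by
    ext t
    rw [(hasDerivAt_mul_exp_sq (p := fun t => 1 + t ^ 2) (p' := fun t => 2 * t)
      (fun t => by simpa using (hasDerivAt_pow 2 t).const_add 1) t).deriv]
    ring
  have d4 : deriv (fun t : ℝ => (3 * t + t ^ 3) * Real.exp (t ^ 2 / 2)) =
      fun t => (3 + 3 * t ^ 2 + t * (3 * t + t ^ 3)) * Real.exp (t ^ 2 / 2) := by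
    ext t
    rw [(hasDerivAt_mul_exp_sq (p := fun t => 3 * t + t ^ 3) (p' := fun t => 3 + 3 * t ^ 2)
      (fun t => by
        convert! ((hasDerivAt_id t).const_mul 3).add (hasDerivAt_pow 3 t) using 1
        norm_num) t).deriv]
  rw [h0, iteratedDeriv_succ', d1, iteratedDeriv_succ', d2, iteratedDeriv_succ', d3,
    iteratedDeriv_succ', d4]
  simp

lemma integral_sq_gaussianReal : ∫ x, x ^ 2 ∂(gaussianReal 0 1) = 1 := by
  have h := variance_of_integral_eq_zero (X := fun x : ℝ => x) (μ := gaussianReal 0 1)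
    (by fun_prop) (by simp)
  rw [variance_fun_id_gaussianReal] at h
  simpa using h.symm

lemma integrable_pow_gaussianReal (k : ℕ) : Integrable (fun x : ℝ => x ^ k) (gaussianReal 0 1) := by
  have := (memLp_id_gaussianReal' (μ := 0) (v := 1) k (by simp)).integrable_norm_pow'
  refine this.mono' (by fun_prop) (Eventually.of_forall fun x => by simp)

/-- The normalized centered chi-square variable, as a function of a Gaussian one. -/
noncomputable def chiStd (x : ℝ) : ℝ := (x ^ 2 - 1) / Real.sqrt 2

lemma measurable_chiStd : Measurable chiStd := by unfold chiStd; fun_prop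

lemma integral_chiStd : ∫ x, chiStd x ∂(gaussianReal 0 1) = 0 := by
  unfold chiStd
  rw [integral_div, integral_sub (integrable_pow_gaussianReal 2) (integrable_const _),
    integral_sq_gaussianReal]
  simp

lemma integrable_chiStd_sq : Integrable (fun x => chiStd x ^ 2) (gaussianReal 0 1) := by
  have : (fun x => chiStd x ^ 2) = fun x : ℝ => (x ^ 4 - 2 * x ^ 2 + 1) / 2 := by
    ext x
    rw [chiStd, div_pow, Real.sq_sqrt (by norm_num)]
    ring
  rw [this]
  exact (((integrable_pow_gaussianReal 4).sub ((integrable_pow_gaussianReal 2).const_mul 2)).add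
    (integrable_const _)).div_const 2

lemma integral_chiStd_sq : ∫ x, chiStd x ^ 2 ∂(gaussianReal 0 1) = 1 := by
  have : (fun x => chiStd x ^ 2) = fun x : ℝ => (x ^ 4 - 2 * x ^ 2 + 1) / 2 := by
    ext x
    rw [chiStd, div_pow, Real.sq_sqrt (by norm_num)]
    ring
  have h4 : Integrable (fun x : ℝ => x ^ 4 - 2 * x ^ 2) (gaussianReal 0 1) :=
    (integrable_pow_gaussianReal 4).sub ((integrable_pow_gaussianReal 2).const_mul 2)
  rw [this, integral_div, integral_add h4 (integrable_const _),
    integral_sub (integrable_pow_gaussianReal 4) ((integrable_pow_gaussianReal 2).const_mul 2),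
    integral_const_mul, integral_sq_gaussianReal, integral_pow_four_gaussianReal]
  norm_num

lemma memLp_chiStd : MemLp chiStd 2 (gaussianReal 0 1) :=
  (memLp_two_iff_integrable_sq measurable_chiStd.aestronglyMeasurable).2 integrable_chiStd_sq

lemma variance_chiStd : Var[chiStd; gaussianReal 0 1] = 1 := by
  rw [variance_of_integral_eq_zero measurable_chiStd.aemeasurable integral_chiStd,
    integral_chiStd_sq]

/-- The factors are exchanged one at a time; the untouched ones have norm at most one. -/
lemma norm_prod_sub_prod_le {ι : Type*} (s : Finset ι) (a b : ι → ℂ) (ha : ∀ i, ‖a i‖ ≤ 1)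
    (hb : ∀ i, ‖b i‖ ≤ 1) : ‖∏ i ∈ s, a i - ∏ i ∈ s, b i‖ ≤ ∑ i ∈ s, ‖a i - b i‖ := by
  classical
  induction s using Finset.induction_on with
  | empty => simp
  | insert i s hi ih =>
    rw [Finset.prod_insert hi, Finset.prod_insert hi, Finset.sum_insert hi]
    have hs : ‖∏ i ∈ s, a i‖ ≤ 1 := by
      rw [norm_prod]
      exact Finset.prod_le_one (fun _ _ => norm_nonneg _) fun i _ => ha i
    calc _ = ‖(a i - b i) * ∏ i ∈ s, a i + b i * (∏ i ∈ s, a i - ∏ i ∈ s, b i)‖ := by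
          congr 1; ring
      _ ≤ ‖a i - b i‖ * ‖∏ i ∈ s, a i‖ + ‖b i‖ * ‖∏ i ∈ s, a i - ∏ i ∈ s, b i‖ := by
          refine (norm_add_le _ _).trans ?_
          rw [norm_mul, norm_mul]
      _ ≤ ‖a i - b i‖ * 1 + 1 * ∑ i ∈ s, ‖a i - b i‖ := by
          gcongr
          exact hb i
      _ = _ := by ring

/-- Mean zero and variance one make both functions `1 - u²/2 + o(u²)` at the origin. An error
proportional to `u²` is what sums to `ε` times the total variance. -/
lemma charFun_chiStd_sub_exp_le {ε : ℝ} (hε : 0 < ε) : ∃ η > 0, ∀ u : ℝ, |u| ≤ η →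
    ‖charFun ((gaussianReal 0 1).map chiStd) u - Complex.exp (-(u : ℂ) ^ 2 / 2)‖ ≤ ε * u ^ 2 := by
  have h1 := taylor_charFun_two (X := chiStd) (P := gaussianReal 0 1)
    measurable_chiStd.aemeasurable integral_chiStd integral_chiStd_sq
  have h2 := h1.bound (half_pos hε)
  have h3 : (fun u : ℝ => Complex.exp (-(u : ℂ) ^ 2 / 2) - (1 - (u : ℂ) ^ 2 / 2))
      =o[𝓝 0] fun u : ℝ => (u : ℝ) ^ 2 := by
    have h4 : (fun z : ℂ => Complex.exp z - 1 - z) =o[𝓝 0] fun z : ℂ => z := by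
      have := (Complex.hasDerivAt_exp 0).isLittleO
      simpa using this
    have h5 : Tendsto (fun u : ℝ => -(u : ℂ) ^ 2 / 2) (𝓝 0) (𝓝 0) := by
      have : Continuous (fun u : ℝ => -(u : ℂ) ^ 2 / 2) := by fun_prop
      simpa using this.tendsto 0
    have h6 := h4.comp_tendsto h5
    refine (h6.trans_isBigO (g := fun u : ℝ => (-(u : ℂ) ^ 2 / 2)) (Asymptotics.isBigO_refl _ _)).congr_left ?_ |>.trans_isBigO ?_
    · intro u; simp only [Function.comp]; ring
    · refine Asymptotics.IsBigO.of_bound 1 (Eventually.of_forall fun u => ?_)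
      simp
      nlinarith [sq_nonneg u]
  have h7 := h3.bound (half_pos hε)
  obtain ⟨η, hη, h8⟩ := Metric.eventually_nhds_iff.1 (h2.and h7)
  refine ⟨η / 2, half_pos hη, fun u hu => ?_⟩
  obtain ⟨h9, h10⟩ := h8 (y := u) (by rw [dist_zero_right, Real.norm_eq_abs]; linarith)
  have e1 : ‖u ^ 2‖ = u ^ 2 := by simp
  have e2 : ‖(u : ℂ) ^ 2‖ = u ^ 2 := by simp
  calc _ ≤ ‖charFun ((gaussianReal 0 1).map chiStd) u - (1 - (u : ℂ) ^ 2 / 2)‖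
        + ‖Complex.exp (-(u : ℂ) ^ 2 / 2) - (1 - (u : ℂ) ^ 2 / 2)‖ := by
        refine (norm_sub_le _ _).trans_eq' ?_
        congr 1; ring
    _ ≤ ε / 2 * u ^ 2 + ε / 2 * u ^ 2 := by
        refine add_le_add (h9.trans_eq ?_) (h10.trans_eq ?_)
        · simp
        · simp
    _ = _ := by ring

variable {n : ℕ}

lemma hasLaw_chiStd {w : Ω → ℝ} (hw : AEMeasurable w P) (hl : P.map w = gaussianReal 0 1) :
    P.map (fun ω => chiStd (w ω)) = (gaussianReal 0 1).map chiStd := by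
  rw [← hl, AEMeasurable.map_map_of_aemeasurable measurable_chiStd.aemeasurable hw]
  rfl

/-- The characteristic function of a weighted sum of independent centered chi-square variables
is close to that of the Gaussian law when all weights are small. -/
lemma charFun_weighted_chi {ε : ℝ} (hε : 0 < ε) : ∃ η > 0, ∀ {n : ℕ} (w : Fin n → Ω → ℝ)
    (_ : iIndepFun w P) (_ : ∀ i, AEMeasurable (w i) P)
    (_ : ∀ i, P.map (w i) = gaussianReal 0 1) (a : Fin n → ℝ) (_ : ∀ i, |a i| ≤ η),
    ‖charFun (P.map fun ω => ∑ i, a i * chiStd (w i ω)) 1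
      - Complex.exp (-((∑ i, a i ^ 2 : ℝ) : ℂ) / 2)‖ ≤ ε * ∑ i, a i ^ 2 := by
  obtain ⟨η, hη, h⟩ := charFun_chiStd_sub_exp_le hε
  refine ⟨η, hη, fun {n} w hi hm hl a ha => ?_⟩
  have hm' : ∀ i, AEMeasurable (fun ω => a i * chiStd (w i ω)) P := fun i =>
    (measurable_chiStd.comp_aemeasurable (hm i)).const_mul _
  have hi' : iIndepFun (fun i ω => a i * chiStd (w i ω)) P :=
    hi.comp (fun i x => a i * chiStd x) fun i => measurable_chiStd.const_mul _
  rw [hi'.charFun_map_fun_sum_eq_prod hm', Finset.prod_apply]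
  have e1 : ∀ i, charFun (P.map (fun ω => a i * chiStd (w i ω))) 1
      = charFun ((gaussianReal 0 1).map chiStd) (a i) := fun i => by
    have hmi : AEMeasurable (fun ω => chiStd (w i ω)) P :=
      measurable_chiStd.comp_aemeasurable (hm i)
    rw [charFun_map_mul_comp hmi, mul_one, hasLaw_chiStd (hm i) (hl i)]
  have e2 : Complex.exp (-((∑ i, a i ^ 2 : ℝ) : ℂ) / 2) =
      ∏ i, Complex.exp (-(a i : ℂ) ^ 2 / 2) := by
    rw [← Complex.exp_sum]
    congr 1
    push_cast
    rw [← Finset.sum_div, Finset.sum_neg_distrib]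
  simp_rw [e1]
  rw [e2, Finset.mul_sum]
  have : IsProbabilityMeasure ((gaussianReal 0 1).map chiStd) :=
    Measure.isProbabilityMeasure_map measurable_chiStd.aemeasurable
  refine (norm_prod_sub_prod_le _ _ _ (fun i => norm_charFun_le_one _) fun i => ?_).trans
    (Finset.sum_le_sum fun i _ => h _ (ha i))
  have : (-(a i : ℂ) ^ 2 / 2) = ((-(a i) ^ 2 / 2 : ℝ) : ℂ) := by push_cast; ring
  rw [this, ← Complex.ofReal_exp, Complex.norm_real, Real.norm_eq_abs, Real.abs_exp,
    Real.exp_le_one_iff]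
  nlinarith [sq_nonneg (a i)]

/-- Chebyshev's inequality for a weighted sum of independent centered chi-square variables. -/
lemma chebyshev_weighted_chi (w : Fin n → Ω → ℝ) (hi : iIndepFun w P)
    (hm : ∀ i, AEMeasurable (w i) P) (hl : ∀ i, P.map (w i) = gaussianReal 0 1)
    (a : Fin n → ℝ) {δ : ℝ} (hδ : 0 < δ) :
    P {ω | δ ≤ |∑ i, a i * chiStd (w i ω)|} ≤ ENNReal.ofReal ((∑ i, a i ^ 2) / δ ^ 2) := by
  have hLp0 : ∀ i, MemLp (fun ω => chiStd (w i ω)) 2 P := fun i => by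
    have := memLp_chiStd
    rw [← hl i] at this
    exact (memLp_map_measure_iff measurable_chiStd.aestronglyMeasurable (hm i)).1 this
  have hLp : ∀ i, MemLp (fun ω => a i * chiStd (w i ω)) 2 P := fun i => (hLp0 i).const_mul _
  have hmean : ∀ i, ∫ ω, chiStd (w i ω) ∂P = 0 := fun i => by
    rw [← integral_map (f := chiStd) (hm i) measurable_chiStd.aestronglyMeasurable, hl i,
      integral_chiStd]
  have hvar0 : ∀ i, Var[fun ω => chiStd (w i ω); P] = 1 := fun i => by
    have := variance_map (X := chiStd) (μ := P) (Y := w i)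
      measurable_chiStd.aemeasurable (hm i)
    rw [hl i, variance_chiStd] at this
    exact this.symm
  have hi' : iIndepFun (fun i ω => a i * chiStd (w i ω)) P :=
    hi.comp (fun i x => a i * chiStd x) fun i => measurable_chiStd.const_mul _
  have hvar : Var[∑ i, fun ω => a i * chiStd (w i ω); P] = ∑ i, a i ^ 2 := by
    rw [IndepFun.variance_sum (fun i _ => hLp i) fun i _ j _ hij => hi'.indepFun hij]
    exact Finset.sum_congr rfl fun i _ => by rw [variance_const_mul, hvar0, mul_one]
  have hsum : MemLp (∑ i, fun ω => a i * chiStd (w i ω)) 2 P := memLp_finsetSum' _ fun i _ => hLp i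
  have hmean2 : ∫ ω, (∑ i, fun ω => a i * chiStd (w i ω)) ω ∂P = 0 := by
    simp only [Finset.sum_apply]
    rw [integral_finsetSum _ fun i _ => (hLp i).integrable (by norm_num)]
    exact Finset.sum_eq_zero fun i _ => by rw [integral_const_mul, hmean, mul_zero]
  have := meas_ge_le_variance_div_sq hsum hδ
  rw [hvar, hmean2] at this
  simpa using this

/-- A quadratic form of a centered Gaussian vector is a weighted sum of independent squared
standard Gaussian variables. -/
lemma exists_diagonal_quadForm {y : Fin n → Ω → ℝ} (hy : HasGaussianLaw (fun ω i => y i ω) P)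
    (h0 : ∀ i, ∫ ω, y i ω ∂P = 0) {R : Matrix (Fin n) (Fin n) ℝ} (hR : R.PosDef)
    (hcov : ∀ i j, cov[y i, y j; P] = R i j) {B : Matrix (Fin n) (Fin n) ℝ} (hB : Bᵀ = B) :
    ∃ (d : Fin n → ℝ) (w : Fin n → Ω → ℝ), iIndepFun w P ∧ (∀ i, AEMeasurable (w i) P) ∧
      (∀ i, P.map (w i) = gaussianReal 0 1) ∧
      (∀ ω, (fun i => y i ω) ⬝ᵥ B *ᵥ (fun i => y i ω) - (B * R).trace
        = ∑ i, (Real.sqrt 2 * d i) * chiStd (w i ω)) ∧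
      ∑ i, d i ^ 2 = (B * R * (B * R)).trace ∧ ∀ i, |d i| ≤ ‖B‖ * ‖R‖ := by
  obtain ⟨S, hS, hSu⟩ := exists_factorization hR
  set T := S⁻¹ with hT
  have hTS : T * S = 1 := nonsing_inv_mul _ hSu
  have hST : S * T = 1 := mul_nonsing_inv _ hSu
  have hTS' : Sᵀ * Tᵀ = 1 := by rw [← transpose_mul, hTS, transpose_one]
  have hST' : Tᵀ * Sᵀ = 1 := by rw [← transpose_mul, hST, transpose_one]
  have hsym : (S * B * Sᵀ).IsHermitian := by
    rw [IsHermitian, conjTranspose_eq_transpose_of_trivial]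
    simp [transpose_mul, hB, mul_assoc]
  obtain ⟨U, d, hU1, hU2, hUd, hd⟩ := exists_orthogonal_diagonal hsym
  -- `C` diagonalizes two forms at once: `C R Cᵀ = 1` and `B = Cᵀ diag(d) C`. The coordinates of `w
  -- = C y` are jointly Gaussian and uncorrelated, hence independent and standard.
  set C := Uᵀ * Tᵀ with hC
  have hCt : Cᵀ = T * U := by rw [hC, transpose_mul, transpose_transpose, transpose_transpose]
  have hCR : C * R * Cᵀ = 1 := by
    rw [hCt, hC, hS]
    calc _ = Uᵀ * (Tᵀ * Sᵀ) * (S * T) * U := by simp only [mul_assoc]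
      _ = 1 := by rw [hST', hST, mul_one, mul_one, hU2]
  have hBC : B = Cᵀ * diagonal d * C := by
    rw [hCt, hC]
    calc B = (T * S) * B * (Sᵀ * Tᵀ) := by rw [hTS, hTS', one_mul, mul_one]
      _ = T * (S * B * Sᵀ) * Tᵀ := by simp only [mul_assoc]
      _ = _ := by rw [hUd]; simp only [mul_assoc]
  set w : Fin n → Ω → ℝ := fun i ω => ∑ j, C i j * y j ω with hw
  have hwm : ∀ ω, (fun i => w i ω) = C *ᵥ fun i => y i ω := fun ω => rfl
  have hG : HasGaussianLaw (fun ω i => w i ω) P :=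
    hy.map_fun (LinearMap.toContinuousLinearMap (Matrix.toLin' C))
  have hLp : ∀ j, MemLp (y j) 2 P := fun j => (hy.eval j).memLp_two
  have hwcov : ∀ i j, cov[w i, w j; P] = (1 : Matrix (Fin n) (Fin n) ℝ) i j := by
    intro i j
    rw [hw, covariance_fun_sum_fun_sum (fun k => (hLp k).const_mul _)
      (fun k => (hLp k).const_mul _), ← hCR]
    simp_rw [covariance_const_mul_left, covariance_const_mul_right, hcov, mul_apply,
      Finset.sum_mul, transpose_apply]
    rw [Finset.sum_comm]
    exact Finset.sum_congr rfl fun _ _ => Finset.sum_congr rfl fun _ _ => by ring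
  have hw0 : ∀ i, ∫ ω, w i ω ∂P = 0 := fun i => by
    rw [hw, integral_finsetSum _ fun k _ => ((hLp k).integrable (by norm_num)).const_mul _]
    exact Finset.sum_eq_zero fun k _ => by rw [integral_const_mul, h0, mul_zero]
  have hmeas : ∀ i, AEMeasurable (w i) P := fun i => (hG.eval i).aemeasurable
  have htr : (B * R).trace = ∑ i, d i := by
    rw [hBC, mul_assoc, mul_assoc, trace_mul_comm, mul_assoc, hCR, mul_one, trace_diagonal]
  refine ⟨d, w, hG.iIndepFun_of_covariance_eq_zero fun i j hij => ?_, hmeas, fun i => ?_,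
    fun ω => ?_, ?_, fun i => ?_⟩
  · rw [hwcov, one_apply_ne hij]
  · rw [(hG.eval i).map_eq_gaussianReal, hw0, ← covariance_self (hmeas i), hwcov, one_apply_eq]
    simp
  · have e1 : (fun i => y i ω) ⬝ᵥ B *ᵥ (fun i => y i ω) = ∑ i, d i * (w i ω) ^ 2 := by
      have := quadForm_orthogonal_diagonal Cᵀ d (fun i => y i ω)
      rw [transpose_transpose, ← hBC] at this
      rw [this]
      rfl
    rw [e1, htr, ← Finset.sum_sub_distrib]
    refine Finset.sum_congr rfl fun i _ => ?_
    have h2 : Real.sqrt 2 ≠ 0 := by positivity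
    rw [chiStd]
    field_simp
  · have e2 : B * R * (B * R) = Cᵀ * (diagonal d * (C * R * Cᵀ) * diagonal d * (C * R)) := by
      conv_lhs => rw [hBC]
      simp only [mul_assoc]
    rw [e2, hCR, mul_one, trace_mul_comm, diagonal_mul_diagonal, mul_assoc, hCR, mul_one,
      trace_diagonal]
    exact Finset.sum_congr rfl fun i _ => sq _
  -- `d i` is an eigenvalue of `S B Sᵀ`, whose norm is at most `‖S‖² ‖B‖`, and `‖S‖² = ‖R‖`.
  · obtain ⟨v, hv, hv2⟩ := dotProduct_eq_of_mulVec_eigen hsym (hd i)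
    rw [← hv2]
    have := abs_quadForm_le (S * B * Sᵀ) v
    rw [hv, mul_one] at this
    refine this.trans ?_
    calc _ ≤ ‖S‖ * ‖B‖ * ‖Sᵀ‖ := by
          refine (l2_opNorm_mul _ _).trans ?_
          gcongr
          exact l2_opNorm_mul _ _
      _ = ‖B‖ * ‖R‖ := by rw [hS, norm_transpose_mul_self, norm_transpose]; ring

lemma norm_half_add_transpose_le (B : Matrix (Fin n) (Fin n) ℝ) :
    ‖(1 / 2 : ℝ) • (B + Bᵀ)‖ ≤ ‖B‖ := by
  rw [norm_smul]
  have := norm_add_le B Bᵀ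
  rw [norm_transpose] at this
  norm_num
  linarith

/-- Chebyshev's inequality for a quadratic form of a centered Gaussian vector. -/
lemma chebyshev_quadForm {y : Fin n → Ω → ℝ} (hy : HasGaussianLaw (fun ω i => y i ω) P)
    (h0 : ∀ i, ∫ ω, y i ω ∂P = 0) {R : Matrix (Fin n) (Fin n) ℝ} (hR : R.PosDef)
    (hcov : ∀ i j, cov[y i, y j; P] = R i j) (B : Matrix (Fin n) (Fin n) ℝ) {K δ : ℝ}
    (hK : ‖B‖ * ‖R‖ ≤ K) (hδ : 0 < δ) :
    P {ω | δ ≤ |(fun i => y i ω) ⬝ᵥ B *ᵥ (fun i => y i ω) - (B * R).trace|}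
      ≤ ENNReal.ofReal (2 * n * K ^ 2 / δ ^ 2) := by
  -- Only the symmetric part of `B` contributes to `yᵀBy` and, `R` being symmetric, to `tr(BR)`.
  set B' := (1 / 2 : ℝ) • (B + Bᵀ) with hB'
  have hBt : B'ᵀ = B' := by
    rw [hB', transpose_smul, transpose_add, transpose_transpose, add_comm]
  obtain ⟨d, w, hi, hm, hl, he, -, hdb⟩ := exists_diagonal_quadForm hy h0 hR hcov hBt
  have hq : ∀ v : Fin n → ℝ, v ⬝ᵥ B' *ᵥ v = v ⬝ᵥ B *ᵥ v := fun v => by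
    have : v ⬝ᵥ Bᵀ *ᵥ v = v ⬝ᵥ B *ᵥ v := by
      rw [mulVec_transpose, dotProduct_comm, ← dotProduct_mulVec]
    rw [hB', smul_mulVec, add_mulVec, dotProduct_smul, dotProduct_add, this, smul_eq_mul]
    ring
  have ht : (B' * R).trace = (B * R).trace := by
    have : (Bᵀ * R).trace = (B * R).trace := by
      have hRt : Rᵀ = R := by
        have := hR.1.eq
        rwa [conjTranspose_eq_transpose_of_trivial] at this
      rw [← trace_transpose, transpose_mul, transpose_transpose, hRt, trace_mul_comm]
    rw [hB', smul_mul_assoc, trace_smul, add_mul, trace_add, this, smul_eq_mul]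
    ring
  have e : ∀ ω, (fun i => y i ω) ⬝ᵥ B *ᵥ (fun i => y i ω) - (B * R).trace
        = ∑ i, (Real.sqrt 2 * d i) * chiStd (w i ω) := fun ω => by rw [← he, hq, ht]
  simp_rw [e]
  refine (chebyshev_weighted_chi w hi hm hl _ hδ).trans (ENNReal.ofReal_le_ofReal ?_)
  gcongr
  calc ∑ i, (Real.sqrt 2 * d i) ^ 2 ≤ ∑ _i : Fin n, 2 * K ^ 2 := by
        refine Finset.sum_le_sum fun i _ => ?_
        rw [mul_pow, Real.sq_sqrt (by norm_num), ← sq_abs]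
        have : |d i| ≤ K := (hdb i).trans (le_trans (mul_le_mul_of_nonneg_right
          (norm_half_add_transpose_le B) (norm_nonneg R)) hK)
        gcongr
    _ = 2 * n * K ^ 2 := by simp; ring

/-- Gaussian approximation of the characteristic function of a centered quadratic form. -/
lemma charFun_quadForm {ε : ℝ} (hε : 0 < ε) : ∃ η > 0, ∀ {n : ℕ} {y : Fin n → Ω → ℝ}
    (_ : HasGaussianLaw (fun ω i => y i ω) P) (_ : ∀ i, ∫ ω, y i ω ∂P = 0)
    {R : Matrix (Fin n) (Fin n) ℝ} (_ : R.PosDef) (_ : ∀ i j, cov[y i, y j; P] = R i j)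
    {B : Matrix (Fin n) (Fin n) ℝ} (_ : Bᵀ = B) (_ : ‖B‖ * ‖R‖ ≤ η),
    ‖charFun (P.map fun ω =>
        (fun i => y i ω) ⬝ᵥ B *ᵥ (fun i => y i ω) - (B * R).trace) 1
      - Complex.exp (-((B * R * (B * R)).trace : ℂ))‖ ≤ ε * (B * R * (B * R)).trace := by
  obtain ⟨η, hη, h⟩ := charFun_weighted_chi (P := P) (half_pos hε)
  -- The weights are `√2 d i` with `|d i| ≤ ‖B‖ ‖R‖`.
  refine ⟨η / Real.sqrt 2, by positivity, fun {n y} hy h0 {R} hR hcov {B} hB hn => ?_⟩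
  obtain ⟨d, w, hi, hm, hl, he, hd2, hdb⟩ := exists_diagonal_quadForm hy h0 hR hcov hB
  simp_rw [he]
  have hs : ∑ i, (Real.sqrt 2 * d i) ^ 2 = 2 * (B * R * (B * R)).trace := by
    rw [← hd2, Finset.mul_sum]
    exact Finset.sum_congr rfl fun i _ => by rw [mul_pow, Real.sq_sqrt (by norm_num)]
  have := h w hi hm hl (fun i => Real.sqrt 2 * d i) fun i => by
    rw [abs_mul, abs_of_pos (by positivity : (0 : ℝ) < Real.sqrt 2), mul_comm,
      ← le_div_iff₀ (by positivity)]
    exact (hdb i).trans hn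
  have e1 : -((2 * (B * R * (B * R)).trace : ℝ) : ℂ) / 2 = -((B * R * (B * R)).trace : ℂ) := by
    push_cast
    ring
  have e2 : ε / 2 * (2 * (B * R * (B * R)).trace) = ε * (B * R * (B * R)).trace := by ring
  rwa [hs, e1, e2] at this

end GaussianQuadraticForm

/-! ### Parameter domain: finite nets and Taylor inequalities -/

section ParameterCalculus

variable {p : ℕ}

/-- `Θ` need not be convex, so a nearby net point might not be visible from `θ`. The net is
therefore used near `θ + s v`: a net point within `κ s` of it lies in the cone of vertex `θ`, and so
does the segment joining it to `θ`. The segment is what a mean value inequality needs. -/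
lemma exists_finite_net {Θ : Set (Param p)} (hb : Bornology.IsBounded Θ) (hc : ConeCondition Θ)
    {ε : ℝ} (hε : 0 < ε) : ∃ G : Set (Param p), G.Finite ∧ G ⊆ Θ ∧
      ∀ θ ∈ Θ, ∃ g ∈ G, segment ℝ θ g ⊆ Θ ∧ ‖g - θ‖ ≤ ε := by
  obtain ⟨κ, hκ, h⟩ := hc
  obtain ⟨r, hr⟩ := hb.subset_closedBall 0
  have hr' : ∀ θ ∈ Θ, ‖θ‖ ≤ r := fun θ hθ => by simpa using hr hθ
  -- `‖v‖ ≤ 2 |r|`, as both `θ` and `θ + v` lie in the ball of radius `r`; hence `‖g - θ‖ ≤ κ s + s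
  -- ‖v‖ ≤ s D`.
  set D := 2 * |r| + κ with hD
  have hD0 : 0 < D := by positivity
  set s := min 1 (ε / D) with hs
  have hs0 : 0 < s := lt_min one_pos (by positivity)
  have hs1 : s ≤ 1 := min_le_left _ _
  have hsD : s * D ≤ ε := by
    calc s * D ≤ ε / D * D := by gcongr; exact min_le_right _ _
      _ = ε := by field_simp
  obtain ⟨N, hN, hcov⟩ := Metric.totallyBounded_iff.1
    (isCompact_closedBall (0 : Param p) r).totallyBounded (κ * s) (by positivity)
  refine ⟨N ∩ Θ, hN.subset Set.inter_subset_left, Set.inter_subset_right, fun θ hθ => ?_⟩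
  obtain ⟨v, hv⟩ := h θ hθ
  have hmem : ∀ t : ℝ, 0 < t → t ≤ 1 → θ + t • v ∈ Θ := fun t h0 h1 =>
    hv t h0 h1 (Metric.mem_ball_self (by positivity))
  have hvn : ‖v‖ ≤ 2 * |r| := by
    have h1 := hr' _ (hmem 1 one_pos le_rfl)
    have h2 := hr' _ hθ
    calc ‖v‖ = ‖(θ + (1 : ℝ) • v) - θ‖ := by simp
      _ ≤ _ := norm_sub_le _ _
      _ ≤ r + r := add_le_add h1 h2
      _ ≤ 2 * |r| := by linarith [le_abs_self r]
  obtain ⟨g, hgN, hg⟩ := Set.mem_iUnion₂.1 (hcov (hr (hmem s hs0 hs1)))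
  rw [Metric.mem_ball, dist_comm, dist_eq_norm] at hg
  have hgΘ : g ∈ Θ := hv s hs0 hs1 (by rwa [Metric.mem_ball, dist_eq_norm])
  refine ⟨g, ⟨hgN, hgΘ⟩, ?_, ?_⟩
  · rw [segment_eq_image']
    rintro _ ⟨t, ⟨ht0, ht1⟩, rfl⟩
    rcases ht0.eq_or_lt with rfl | ht0
    · simpa using hθ
    -- The cone is homogeneous: the point at time `t` of the segment lies in the ball of the cone at
    -- height `t s`.
    · refine hv (t * s) (by positivity) (by nlinarith) ?_
      rw [Metric.mem_ball, dist_eq_norm]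
      have : θ + t • (g - θ) - (θ + (t * s) • v) = t • (g - (θ + s • v)) := by module
      rw [this, norm_smul, Real.norm_of_nonneg ht0.le]
      calc t * ‖g - (θ + s • v)‖ < t * (κ * s) := by gcongr
        _ = _ := by ring
  · calc ‖g - θ‖ = ‖(g - (θ + s • v)) + s • v‖ := by congr 1; abel
      _ ≤ κ * s + s * (2 * |r|) := by
        refine (norm_add_le _ _).trans ?_
        rw [norm_smul, Real.norm_of_nonneg hs0.le]
        gcongr
      _ = s * D := by rw [hD]; ring
      _ ≤ ε := hsD

lemma clm_eq_sum (L : Param p →L[ℝ] ℝ) (v : Param p) :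
    L v = ∑ k, v k * L (EuclideanSpace.single k 1) := by
  conv_lhs => rw [← (EuclideanSpace.basisFun (Fin p) ℝ).sum_repr v]
  simp

lemma norm_clm_le {L : Param p →L[ℝ] ℝ} {a : ℝ}
    (h : ∀ k, |L (EuclideanSpace.single k 1)| ≤ a) (ha : 0 ≤ a) : ‖L‖ ≤ p * a := by
  refine L.opNorm_le_bound (by positivity) fun v => ?_
  rw [clm_eq_sum, Real.norm_eq_abs]
  calc _ ≤ ∑ k, |v k * L (EuclideanSpace.single k 1)| := Finset.abs_sum_le_sum_abs _ _
    _ ≤ ∑ _k : Fin p, ‖v‖ * a := Finset.sum_le_sum fun k _ => by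
        rw [abs_mul]
        gcongr
        · exact PiLp.norm_apply_le v k
        · exact h k
    _ = p * a * ‖v‖ := by simp; ring

/-- Mean value inequality along a segment, from bounds on the partial derivatives. -/
lemma abs_sub_le_of_partialD {Θ : Set (Param p)} {g : Param p → ℝ} {θ θ' : Param p} {a : ℝ}
    (hs : segment ℝ θ θ' ⊆ Θ) (hd : ∀ x ∈ segment ℝ θ θ', DifferentiableWithinAt ℝ g Θ x)
    (ha : 0 ≤ a) (h : ∀ x ∈ segment ℝ θ θ', ∀ k, |partialD Θ k g x| ≤ a) :
    |g θ' - g θ| ≤ p * a * ‖θ' - θ‖ := by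
  refine (convex_segment θ θ').norm_image_sub_le_of_norm_hasFDerivWithin_le
    (f := g) (f' := fun x => fderivWithin ℝ g Θ x) (fun x hx => ?_) (fun x hx => ?_)
    (left_mem_segment ℝ θ θ') (right_mem_segment ℝ θ θ')
  · exact (hd x hx).hasFDerivWithinAt.mono hs
  · exact norm_clm_le (h x hx) ha

/-- Second order Taylor inequality along a segment. -/
lemma abs_sub_sub_le_of_partialD {Θ : Set (Param p)} {g : Param p → ℝ} {θ θ' : Param p} {b : ℝ}
    (hs : segment ℝ θ θ' ⊆ Θ) (hd : ∀ x ∈ segment ℝ θ θ', DifferentiableWithinAt ℝ g Θ x)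
    (hb : 0 ≤ b)
    (h : ∀ x ∈ segment ℝ θ θ', ∀ k, |partialD Θ k g x - partialD Θ k g θ| ≤ b * ‖x - θ‖) :
    |g θ' - g θ - ∑ k, (θ' - θ) k * partialD Θ k g θ| ≤ p * b * ‖θ' - θ‖ ^ 2 := by
  have hle : ∀ x ∈ segment ℝ θ θ', ‖x - θ‖ ≤ ‖θ' - θ‖ := fun x hx => by
    rw [segment_eq_image'] at hx
    obtain ⟨t, ⟨ht0, ht1⟩, rfl⟩ := hx
    rw [add_sub_cancel_left, norm_smul, Real.norm_of_nonneg ht0]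
    exact mul_le_of_le_one_left (norm_nonneg _) ht1
  have := (convex_segment θ θ').norm_image_sub_le_of_norm_hasFDerivWithin_le'
    (f := g) (f' := fun x => fderivWithin ℝ g Θ x) (φ := fderivWithin ℝ g Θ θ)
    (C := p * (b * ‖θ' - θ‖)) (fun x hx => (hd x hx).hasFDerivWithinAt.mono hs) (fun x hx => ?_)
    (left_mem_segment ℝ θ θ') (right_mem_segment ℝ θ θ')
  · rw [clm_eq_sum, Real.norm_eq_abs] at this
    refine this.trans (le_of_eq ?_)
    ring
  · refine norm_clm_le (fun k => ?_) (by positivity)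
    refine (h x hx k).trans ?_
    gcongr
    exact hle x hx

/-- Around an interior point the derivative within `Θ` is the ordinary derivative, so it loses just
one order of smoothness. -/
lemma contDiffAt_partialD {Θ : Set (Param p)} {g : Param p → ℝ} {x : Param p} {m : ℕ}
    (hg : ContDiffAt ℝ (m + 1 : ℕ) g x) (hx : x ∈ interior Θ) (k : Fin p) :
    ContDiffAt ℝ m (partialD Θ k g) x := by
  have h1 : ContDiffAt ℝ m (fun y => fderiv ℝ g y (EuclideanSpace.single k 1)) x := by
    have := hg.fderiv_right (m := m) (by norm_cast)
    exact this.clm_apply contDiffAt_const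
  refine h1.congr_of_eventuallyEq ?_
  filter_upwards [isOpen_interior.mem_nhds hx] with y hy
  rw [partialD, fderivWithin_of_mem_nhds (mem_interior_iff_mem_nhds.1 hy)]

/-- First and second order expansions, around an interior point, of a function with bounded
partial derivatives of orders up to three. -/
lemma expansion_of_partialD {Θ : Set (Param p)} {g : Param p → ℝ} {θ₀ θ : Param p} {a r : ℝ}
    (hr : Metric.ball θ₀ r ⊆ Θ) (hθ : θ ∈ Metric.ball θ₀ r) (ha : 0 ≤ a)
    (hg : ContDiffOn ℝ 3 g Θ)
    (h1 : ∀ x ∈ Θ, ∀ i, |partialD Θ i g x| ≤ a)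
    (h2 : ∀ x ∈ Θ, ∀ i j, |partialD Θ i (partialD Θ j g) x| ≤ a)
    (h3 : ∀ x ∈ Θ, ∀ i j k, |partialD Θ i (partialD Θ j (partialD Θ k g)) x| ≤ a) :
    |g θ - g θ₀| ≤ p * a * ‖θ - θ₀‖ ∧
    (∀ k, |partialD Θ k g θ - partialD Θ k g θ₀| ≤ p * a * ‖θ - θ₀‖) ∧
    |g θ - g θ₀ - ∑ k, (θ - θ₀) k * partialD Θ k g θ₀| ≤ p * (p * a) * ‖θ - θ₀‖ ^ 2 ∧
    ∀ k, |partialD Θ k g θ - partialD Θ k g θ₀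
      - ∑ j, (θ - θ₀) j * partialD Θ j (partialD Θ k g) θ₀| ≤ p * (p * a) * ‖θ - θ₀‖ ^ 2 := by
  have hr0 : 0 < r := (dist_nonneg).trans_lt hθ
  have hB : ∀ x ∈ Metric.ball θ₀ r, x ∈ interior Θ := fun x hx =>
    (Metric.isOpen_ball.subset_interior_iff.2 hr) hx
  have hseg : ∀ y ∈ Metric.ball θ₀ r, segment ℝ θ₀ y ⊆ Metric.ball θ₀ r := fun y hy =>
    (convex_ball θ₀ r).segment_subset (Metric.mem_ball_self hr0) hy
  have c3 : ∀ x ∈ Metric.ball θ₀ r, ContDiffAt ℝ (2 + 1 : ℕ) g x := fun x hx =>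
    hg.contDiffAt (mem_interior_iff_mem_nhds.1 (hB x hx))
  have c2 : ∀ k, ∀ x ∈ Metric.ball θ₀ r, ContDiffAt ℝ (1 + 1 : ℕ) (partialD Θ k g) x :=
    fun k x hx => contDiffAt_partialD (c3 x hx) (hB x hx) k
  have c1 : ∀ j k, ∀ x ∈ Metric.ball θ₀ r, ContDiffAt ℝ (1 : ℕ) (partialD Θ j (partialD Θ k g)) x :=
    fun j k x hx => contDiffAt_partialD (c2 k x hx) (hB x hx) j
  have d0 : ∀ y ∈ Metric.ball θ₀ r, ∀ x ∈ segment ℝ θ₀ y, DifferentiableWithinAt ℝ g Θ x :=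
    fun y hy x hx => ((c3 x (hseg y hy hx)).differentiableAt (by simp)).differentiableWithinAt
  have d1 : ∀ k, ∀ y ∈ Metric.ball θ₀ r, ∀ x ∈ segment ℝ θ₀ y,
      DifferentiableWithinAt ℝ (partialD Θ k g) Θ x :=
    fun k y hy x hx => ((c2 k x (hseg y hy hx)).differentiableAt (by simp)).differentiableWithinAt
  have d2 : ∀ j k, ∀ y ∈ Metric.ball θ₀ r, ∀ x ∈ segment ℝ θ₀ y,
      DifferentiableWithinAt ℝ (partialD Θ j (partialD Θ k g)) Θ x :=
    fun j k y hy x hx =>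
      ((c1 j k x (hseg y hy hx)).differentiableAt (by simp)).differentiableWithinAt
  have l1 : ∀ k, ∀ y ∈ Metric.ball θ₀ r,
      |partialD Θ k g y - partialD Θ k g θ₀| ≤ p * a * ‖y - θ₀‖ := fun k y hy =>
    abs_sub_le_of_partialD ((hseg y hy).trans hr) (d1 k y hy) ha
      fun x hx j => h2 x (hr (hseg y hy hx)) j k
  have l2 : ∀ j k, ∀ y ∈ Metric.ball θ₀ r,
      |partialD Θ j (partialD Θ k g) y - partialD Θ j (partialD Θ k g) θ₀| ≤ p * a * ‖y - θ₀‖ :=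
    fun j k y hy => abs_sub_le_of_partialD ((hseg y hy).trans hr) (d2 j k y hy) ha
      fun x hx i => h3 x (hr (hseg y hy hx)) i j k
  refine ⟨abs_sub_le_of_partialD ((hseg θ hθ).trans hr) (d0 θ hθ) ha
    fun x hx j => h1 x (hr (hseg θ hθ hx)) j, fun k => l1 k θ hθ, ?_, fun k => ?_⟩
  · exact abs_sub_sub_le_of_partialD ((hseg θ hθ).trans hr) (d0 θ hθ) (by positivity)
      fun x hx k => l1 k x (hseg θ hθ hx)
  · exact abs_sub_sub_le_of_partialD ((hseg θ hθ).trans hr) (d1 k θ hθ) (by positivity)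
      fun x hx j => l2 j k x (hseg θ hθ hx)

end ParameterCalculus

/-! ### From separated supports to uniform operator norm bounds -/

section Decay

lemma ae_mem_of_support_subset {m : WSpace} {s : Set ℝ} (h : m.toMeasure.support ⊆ s) :
    ∀ᵐ x ∂m.toMeasure, x ∈ s :=
  mem_of_superset (Measure.support_mem_ae) h

/-- The product coupling has finite cost. Finiteness matters because `toReal` would turn an infinite
cost into `0` and ruin lower bounds on `W₂`. -/
lemma transportCost_lt_top (m m' : WSpace) : transportCost m m' < ⊤ := by
  refine lt_of_le_of_lt (iInf₂_le (m.toMeasure.prod m'.toMeasure) ⟨by simp, by simp⟩) ?_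
  · have h1 : MemLp (fun z : ℝ × ℝ => z.1 - z.2) 2 (m.toMeasure.prod m'.toMeasure) :=
      (m.2.comp_fst m'.toMeasure).sub (m'.2.comp_snd m.toMeasure)
    have h2 := h1.integrable_sq
    have h3 := h2.lintegral_lt_top
    simpa only [sq_abs] using h3

/-- Measures supported in separated intervals are at least as far apart as the intervals. -/
lemma le_W₂_of_support {m m' : WSpace} {a b ℓ : ℝ} (h : m.toMeasure.support ⊆ Set.Icc a (a + ℓ))
    (h' : m'.toMeasure.support ⊆ Set.Icc b (b + ℓ)) : |a - b| - ℓ ≤ W₂ m m' := by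
  rcases le_or_gt (|a - b| - ℓ) 0 with h0 | h0
  · exact h0.trans (Real.sqrt_nonneg _)
  refine Real.le_sqrt_of_sq_le ?_
  rw [← ENNReal.ofReal_le_iff_le_toReal (transportCost_lt_top m m').ne]
  refine le_iInf₂ fun π hπ => ?_
  have hp : IsProbabilityMeasure π := by
    have : IsProbabilityMeasure π.fst := by rw [hπ.1]; infer_instance
    exact ⟨by rw [← Measure.fst_univ]; exact measure_univ⟩
  have h1 : ∀ᵐ z ∂π, z.1 ∈ Set.Icc a (a + ℓ) := by
    have := ae_mem_of_support_subset h
    rw [← hπ.1] at this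
    exact ae_of_ae_map measurable_fst.aemeasurable this
  have h2 : ∀ᵐ z ∂π, z.2 ∈ Set.Icc b (b + ℓ) := by
    have := ae_mem_of_support_subset h'
    rw [← hπ.2] at this
    exact ae_of_ae_map measurable_snd.aemeasurable this
  calc ENNReal.ofReal ((|a - b| - ℓ) ^ 2)
      = ∫⁻ _z, ENNReal.ofReal ((|a - b| - ℓ) ^ 2) ∂π := by simp
    _ ≤ _ := by
      refine lintegral_mono_ae ?_
      filter_upwards [h1, h2] with z hz1 hz2
      refine ENNReal.ofReal_le_ofReal (pow_le_pow_left₀ h0.le ?_ 2)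
      obtain ⟨a1, a2⟩ := hz1
      obtain ⟨b1, b2⟩ := hz2
      have c1 := le_abs_self (z.1 - z.2)
      have c2 := neg_abs_le (z.1 - z.2)
      rcases abs_cases (a - b) with ⟨e, _⟩ | ⟨e, _⟩ <;> rw [e] <;> linarith

lemma W₂_nonneg (m m' : WSpace) : 0 ≤ W₂ m m' := Real.sqrt_nonneg _

/-- As `1 + τ > 2`, one has `1 + t² ≤ 2 (1 + t^(1+τ))`, and `|x| ≤ t + ℓ` gives `1 + x² ≤ (2 +
2ℓ²)(1 + t²)`. Quadratic decay in the index gap is summable, as Schur's test requires. -/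
lemma decay_le {τ t ℓ x : ℝ} (hτ : 1 < τ) (ht : 0 ≤ t) (h : |x| - ℓ ≤ t) :
    1 / (1 + t ^ (1 + τ)) ≤ (4 + 4 * ℓ ^ 2) * (1 / (1 + x ^ 2)) := by
  have h1 : 1 + t ^ 2 ≤ 2 * (1 + t ^ (1 + τ)) := by
    have hp : 0 ≤ t ^ (1 + τ) := Real.rpow_nonneg ht _
    rcases le_or_gt t 1 with h1 | h1
    · nlinarith
    · have : t ^ (2 : ℝ) ≤ t ^ (1 + τ) := Real.rpow_le_rpow_of_exponent_le h1.le (by linarith)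
      rw [Real.rpow_two] at this
      nlinarith
  have h2 : 1 + x ^ 2 ≤ (2 + 2 * ℓ ^ 2) * (1 + t ^ 2) := by
    have h3 : |x| ^ 2 ≤ (t + ℓ) ^ 2 := pow_le_pow_left₀ (abs_nonneg x) (by linarith) 2
    rw [sq_abs] at h3
    nlinarith [sq_nonneg (t - ℓ), mul_nonneg (sq_nonneg t) (sq_nonneg ℓ)]
  have hp : 0 ≤ t ^ (1 + τ) := Real.rpow_nonneg ht _
  rw [mul_one_div, div_le_div_iff₀ (by positivity) (by positivity), one_mul]
  nlinarith [sq_nonneg ℓ, sq_nonneg t]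

lemma summable_int_inv : Summable fun k : ℤ => 1 / (1 + (k : ℝ) ^ 2) := by
  have h := (Real.summable_one_div_int_pow (p := 2)).2 one_lt_two
  refine Summable.of_norm_bounded_eventually h ?_
  rw [Filter.eventually_cofinite]
  refine (Set.finite_singleton (0 : ℤ)).subset fun k hk => ?_
  by_contra hk0
  apply hk
  have : (0 : ℝ) < (k : ℝ) ^ 2 := by
    have : (k : ℝ) ≠ 0 := by exact_mod_cast hk0
    positivity
  rw [Real.norm_of_nonneg (by positivity)]
  gcongr
  linarith

lemma sum_fin_inv_le (n : ℕ) (i : Fin n) :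
    ∑ j : Fin n, 1 / (1 + ((i : ℝ) - j) ^ 2) ≤ ∑' k : ℤ, 1 / (1 + (k : ℝ) ^ 2) := by
  have hinj : Function.Injective fun j : Fin n => ((i : ℤ) - (j : ℤ)) := fun j k h => by
    simp only [sub_right_inj, Nat.cast_inj] at h
    exact Fin.ext h
  have := summable_int_inv.sum_le_tsum (Finset.univ.map ⟨_, hinj⟩) fun k _ => by positivity
  rw [Finset.sum_map] at this
  simpa using this

open scoped Matrix.Norms.L2Operator

/-- Matrices whose entries decay with the transport distance of well separated points have a
bounded operator norm. -/
lemma exists_opNorm_le_of_decay {μ : PointArray} {L A τ : ℝ} (hτ : 1 < τ) (h1 : Condition1 μ L)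
    (hA : 0 ≤ A) : ∃ C > 0, ∀ (n : ℕ) (B : Matrix (Fin n) (Fin n) ℝ) (s : ℝ), 0 ≤ s →
      (∀ i j, |B i j| ≤ s * (A / (1 + W₂ (μ n i) (μ n j) ^ (1 + τ)))) → ‖B‖ ≤ s * C := by
  set S := ∑' k : ℤ, 1 / (1 + (k : ℝ) ^ 2) with hS
  have hS0 : 0 ≤ S := tsum_nonneg fun k => by positivity
  set C := A * (4 + 4 * |L| ^ 2) * S with hC
  have hC0 : 0 ≤ C := by positivity
  -- The added `1` makes the constant strictly positive.
  refine ⟨C + 1, by positivity, fun n B s hs hB => ?_⟩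
  refine le_trans ?_ (mul_le_mul_of_nonneg_left (le_add_of_nonneg_right zero_le_one) hs)
  have hsup : ∀ i : Fin n, (μ n i).toMeasure.support ⊆
      Set.Icc ((i : ℝ) + 1) ((i : ℝ) + 1 + |L|) := fun i =>
    (h1 n i).trans (Set.Icc_subset_Icc_right (by linarith [le_abs_self L]))
  have hent : ∀ i j, |B i j| ≤ s * (A * (4 + 4 * |L| ^ 2)) * (1 / (1 + ((i : ℝ) - j) ^ 2)) := by
    intro i j
    have hw := le_W₂_of_support (hsup i) (hsup j)
    rw [add_sub_add_right_eq_sub] at hw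
    have := decay_le hτ (W₂_nonneg _ _) hw
    calc |B i j| ≤ s * (A * (1 / (1 + W₂ (μ n i) (μ n j) ^ (1 + τ)))) := by
          rw [mul_one_div]; exact hB i j
      _ ≤ s * (A * ((4 + 4 * |L| ^ 2) * (1 / (1 + ((i : ℝ) - j) ^ 2)))) := by gcongr
      _ = _ := by ring
  have hrow : ∀ i, ∑ j, |B i j| ≤ s * C := fun i => by
    calc _ ≤ ∑ j : Fin n, s * (A * (4 + 4 * |L| ^ 2)) * (1 / (1 + ((i : ℝ) - j) ^ 2)) :=
          Finset.sum_le_sum fun j _ => hent i j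
      _ ≤ s * (A * (4 + 4 * |L| ^ 2)) * S := by
          rw [← Finset.mul_sum]
          exact mul_le_mul_of_nonneg_left (sum_fin_inv_le n i) (by positivity)
      _ = _ := by rw [hC]; ring
  have hcol : ∀ j, ∑ i, |B i j| ≤ s * C := fun j => by
    calc _ ≤ ∑ i : Fin n, s * (A * (4 + 4 * |L| ^ 2)) * (1 / (1 + ((j : ℝ) - i) ^ 2)) :=
          Finset.sum_le_sum fun i _ => by
            have := hent i j
            rwa [← neg_sub (j : ℝ) (i : ℝ), neg_sq] at this
      _ ≤ s * (A * (4 + 4 * |L| ^ 2)) * S := by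
          rw [← Finset.mul_sum]
          exact mul_le_mul_of_nonneg_left (sum_fin_inv_le n j) (by positivity)
      _ = _ := by rw [hC]; ring
  exact opNorm_le_of_sum_le (by positivity) hrow hcol

end Decay

/-! ### Uniform bounds for the statistical model -/

section Model

open scoped Matrix.Norms.L2Operator
open Matrix

variable {p : ℕ} {Ω : Type*} [MeasurableSpace Ω]

/-- The matrix of second partial derivatives `∂²R_θ/∂θ_j∂θ_k`. -/
noncomputable def covMatrixDD (Θ : Set (Param p)) (F : Param p → ℝ → ℝ) (μ : PointArray)
    (n : ℕ) (j k : Fin p) (θ : Param p) : Matrix (Fin n) (Fin n) ℝ :=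
  Matrix.of fun a b => partialD Θ j (partialD Θ k (fun η => kernel F η (μ n a) (μ n b))) θ

/-- Uniform bounds on the covariance matrices and their derivatives, with a Gaussian sample. -/
structure RegularModel (P : Measure Ω) (Θ : Set (Param p)) (F : Param p → ℝ → ℝ) (θ₀ : Param p)
    (μ : PointArray) (Y : WSpace → Ω → ℝ) (c C r : ℝ) : Prop where
  c_pos : 0 < c
  C_pos : 0 < C
  r_pos : 0 < r
  ball_subset : Metric.ball θ₀ r ⊆ Θ
  gaussian : ∀ n, HasGaussianLaw (fun ω (i : Fin n) => Y (μ n i) ω) P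
  mean : ∀ n (i : Fin n), ∫ ω, Y (μ n i) ω ∂P = 0
  cov : ∀ n (i j : Fin n), cov[Y (μ n i), Y (μ n j); P] = covMatrix F μ n θ₀ i j
  coercive : ∀ n, 1 ≤ n → ∀ θ ∈ Θ, Coercive c (covMatrix F μ n θ)
  norm_le : ∀ n, ∀ θ ∈ Θ, ‖covMatrix F μ n θ‖ ≤ C
  lipschitz : ∀ n, ∀ θ ∈ Θ, ∀ θ' ∈ Θ, segment ℝ θ θ' ⊆ Θ →
    ‖covMatrix F μ n θ' - covMatrix F μ n θ‖ ≤ C * ‖θ' - θ‖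
  symmD : ∀ n k, ∀ θ ∈ Θ, (covMatrixD Θ F μ n k θ)ᵀ = covMatrixD Θ F μ n k θ
  normD_le : ∀ n k, ∀ θ ∈ Θ, ‖covMatrixD Θ F μ n k θ‖ ≤ C
  normDD_le : ∀ n j k, ∀ θ ∈ Θ, ‖covMatrixDD Θ F μ n j k θ‖ ≤ C
  lipD : ∀ n k, ∀ θ ∈ Metric.ball θ₀ r,
    ‖covMatrixD Θ F μ n k θ - covMatrixD Θ F μ n k θ₀‖ ≤ C * ‖θ - θ₀‖
  expansion : ∀ n, ∀ θ ∈ Metric.ball θ₀ r,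
    ‖covMatrix F μ n θ - covMatrix F μ n θ₀ - ∑ k, (θ - θ₀) k • covMatrixD Θ F μ n k θ₀‖
      ≤ C * ‖θ - θ₀‖ ^ 2
  expansionD : ∀ n k, ∀ θ ∈ Metric.ball θ₀ r,
    ‖covMatrixD Θ F μ n k θ - covMatrixD Θ F μ n k θ₀
      - ∑ j, (θ - θ₀) j • covMatrixDD Θ F μ n j k θ₀‖ ≤ C * ‖θ - θ₀‖ ^ 2
  hasDerivAt : ∀ n k, ∀ θ ∈ Metric.ball θ₀ r,
    HasDerivAt (fun s : ℝ => covMatrix F μ n (θ + s • EuclideanSpace.single k 1))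
      (covMatrixD Θ F μ n k θ) 0

lemma hasGaussianLaw_sample {P : Measure Ω} {Y : WSpace → Ω → ℝ} (h : IsGaussianProcess Y P)
    {n : ℕ} (x : Fin n → WSpace) : HasGaussianLaw (fun ω i => Y (x i) ω) P := by
  have h1 := (h.comp_right x).hasGaussianLaw Finset.univ
  let T : ((i : (Finset.univ : Finset (Fin n))) → ℝ) →L[ℝ] (Fin n → ℝ) :=
    ContinuousLinearMap.pi fun i => ContinuousLinearMap.proj ⟨i, Finset.mem_univ i⟩
  exact h1.map_fun T

lemma hasDerivAt_partialD {Θ : Set (Param p)} {g : Param p → ℝ} {θ : Param p}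
    (hg : DifferentiableWithinAt ℝ g Θ θ) (hθ : θ ∈ interior Θ) (k : Fin p) :
    HasDerivAt (fun s : ℝ => g (θ + s • EuclideanSpace.single k 1)) (partialD Θ k g θ) 0 := by
  have h1 : HasFDerivAt g (fderivWithin ℝ g Θ θ) θ :=
    hg.hasFDerivWithinAt.hasFDerivAt (mem_interior_iff_mem_nhds.1 hθ)
  have h2 : HasDerivAt (fun s : ℝ => θ + s • (EuclideanSpace.single k 1 : Param p))
      (EuclideanSpace.single k 1) 0 := by
    simpa using ((hasDerivAt_id (0 : ℝ)).smul_const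
      (EuclideanSpace.single k 1 : Param p)).const_add θ
  have h3 : HasFDerivAt g (fderivWithin ℝ g Θ θ)
      (θ + (0 : ℝ) • (EuclideanSpace.single k 1 : Param p)) := by simpa using h1
  exact h3.comp_hasDerivAt (0 : ℝ) h2

/-- Matrices carry the operator norm here, not a product norm, so the entries are recombined through
the matrix units. -/
lemma hasDerivAt_matrix {ι : Type*} [Fintype ι] [DecidableEq ι] {f : ℝ → Matrix ι ι ℝ}
    {f' : Matrix ι ι ℝ} {s : ℝ} (h : ∀ i j, HasDerivAt (fun s => f s i j) (f' i j) s) :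
    HasDerivAt f f' s := by
  have e : ∀ M : Matrix ι ι ℝ, M = ∑ i, ∑ j, M i j • Matrix.single i j (1 : ℝ) := fun M => by
    conv_lhs => rw [matrix_eq_sum_single M]
    simp
  have h1 : HasDerivAt (fun s => ∑ i, ∑ j, f s i j • Matrix.single i j (1 : ℝ))
      (∑ i, ∑ j, f' i j • Matrix.single i j (1 : ℝ)) s :=
    HasDerivAt.fun_sum fun i _ => HasDerivAt.fun_sum fun j _ => (h i j).smul_const _
  rw [← e f'] at h1
  exact h1.congr_of_eventuallyEq (Eventually.of_forall fun s => e (f s))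

/-- The Taylor inequalities are applied entry by entry with the decaying bound `A / (1 + W₂^(1+τ))`,
so the remainders inherit the decay and Schur's test bounds them too. -/
theorem exists_regularModel {P : Measure Ω} {Θ : Set (Param p)}
    {F : Param p → ℝ → ℝ} {θ₀ : Param p} {μ : PointArray} {Y : WSpace → Ω → ℝ} {L A τ c : ℝ}
    (hτ : 1 < τ) (hc : 0 < c) (hθ₀ : θ₀ ∈ interior Θ) (h1 : Condition1 μ L)
    (h2 : Condition2 Θ F A τ) (h3 : Condition3 P Θ F θ₀ Y) (h4 : Condition4 Θ F μ c)
    (h6 : Condition6 Θ F A τ) (h7 : Condition7 Θ F A τ) :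
    ∃ C r, RegularModel P Θ F θ₀ μ Y c C r := by
  -- At `t = 0` the decay condition reads `|F θ₀ 0| ≤ A`.
  have hA : 0 ≤ A := by
    have := (abs_nonneg _).trans (h2.2 0 le_rfl θ₀ (interior_subset hθ₀))
    rw [abs_zero, Real.zero_rpow (by linarith)] at this
    simpa using this
  obtain ⟨C₀, hC₀, hop⟩ := exists_opNorm_le_of_decay hτ h1 hA
  obtain ⟨r, hr, hball⟩ := Metric.isOpen_iff.1 isOpen_interior θ₀ hθ₀
  have hball' : Metric.ball θ₀ r ⊆ Θ := hball.trans interior_subset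
  have ha : ∀ n (i j : Fin n), 0 ≤ A / (1 + W₂ (μ n i) (μ n j) ^ (1 + τ)) := fun n i j => by
    have := Real.rpow_nonneg (W₂_nonneg (μ n i) (μ n j)) (1 + τ)
    positivity
  have hherm : ∀ n, ∀ θ ∈ Θ, (covMatrix F μ n θ).IsHermitian := fun n θ hθ =>
    (h2.1 θ hθ n (μ n)).1
  have hdiff : ∀ t : ℝ, 0 ≤ t → ∀ x ∈ Θ, DifferentiableWithinAt ℝ (fun θ => F θ t) Θ x :=
    fun t ht x hx => ((h6 t ht).1.differentiableOn (by simp)) x hx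
  have hexp := fun (θ : Param p) (hθ : θ ∈ Metric.ball θ₀ r) n (i j : Fin n) =>
    expansion_of_partialD (g := fun θ => F θ (W₂ (μ n i) (μ n j))) hball' hθ (ha n i j)
      (h7 _ (W₂_nonneg _ _)).1 (h6 _ (W₂_nonneg _ _)).2 (h7 _ (W₂_nonneg _ _)).2.1
      (h7 _ (W₂_nonneg _ _)).2.2
  -- `q²` dominates the three entrywise constants `1`, `p` and `p²`, so a single `C` serves every
  -- field.
  set q : ℝ := (p : ℝ) + 1 with hq
  have hp0 : (0 : ℝ) ≤ p := Nat.cast_nonneg p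
  have hq1 : 1 ≤ q ^ 2 := by nlinarith
  have hpq : (p : ℝ) ≤ q ^ 2 := by nlinarith
  have hppq : (p : ℝ) * p ≤ q ^ 2 := by nlinarith
  have key : ∀ (n : ℕ) (B : Matrix (Fin n) (Fin n) ℝ) (s s' : ℝ), 0 ≤ s' → s ≤ q ^ 2 →
      (∀ i j, |B i j| ≤ s * (A / (1 + W₂ (μ n i) (μ n j) ^ (1 + τ))) * s') →
      ‖B‖ ≤ q ^ 2 * C₀ * s' := by
    intro n B s s' hs' hs hB
    have := hop n B (q ^ 2 * s') (by positivity) fun i j => (hB i j).trans (by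
      have := ha n i j
      calc _ ≤ q ^ 2 * (A / (1 + W₂ (μ n i) (μ n j) ^ (1 + τ))) * s' := by gcongr
        _ = _ := by ring)
    linarith
  refine ⟨q ^ 2 * C₀, r, ⟨hc, by positivity, hr, hball', fun n => hasGaussianLaw_sample h3.2.1 _,
    fun n i => h3.2.2.1 _, fun n i j => h3.2.2.2 _ _,
    fun n hn θ hθ => coercive_of_le_lambdaMin (hherm n θ hθ) (h4 n hn θ hθ), ?_, ?_, ?_, ?_, ?_,
    ?_, ?_, ?_, ?_⟩⟩
  · intro n θ hθ
    have := key n (covMatrix F μ n θ) 1 1 zero_le_one hq1 fun i j => by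
      have := h2.2 _ (W₂_nonneg (μ n i) (μ n j)) θ hθ
      rw [abs_of_nonneg (W₂_nonneg (μ n i) (μ n j))] at this
      rw [one_mul, mul_one]
      exact this
    simpa using this
  · intro n θ hθ θ' hθ' hs
    exact key n _ p _ (norm_nonneg _) hpq fun i j =>
      abs_sub_le_of_partialD (g := fun θ => F θ (W₂ (μ n i) (μ n j))) hs
        (fun x hx => hdiff _ (W₂_nonneg _ _) x (hs hx)) (ha n i j)
        fun x hx k => (h6 _ (W₂_nonneg _ _)).2 x (hs hx) k
  · intro n k θ hθ
    ext i j
    have : ∀ η ∈ Θ, kernel F η (μ n j) (μ n i) = kernel F η (μ n i) (μ n j) := fun η hη => by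
      have h := (hherm n η hη).apply i j
      rw [star_trivial] at h
      exact h
    change fderivWithin ℝ _ Θ θ _ = fderivWithin ℝ _ Θ θ _
    rw [fderivWithin_congr this (this θ hθ)]
  · intro n k θ hθ
    have := key n (covMatrixD Θ F μ n k θ) 1 1 zero_le_one hq1 fun i j => by
      rw [one_mul, mul_one]
      exact (h6 _ (W₂_nonneg _ _)).2 θ hθ k
    simpa using this
  · intro n j k θ hθ
    have := key n (covMatrixDD Θ F μ n j k θ) 1 1 zero_le_one hq1 fun a b => by
      rw [one_mul, mul_one]
      exact (h7 _ (W₂_nonneg _ _)).2.1 θ hθ j k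
    simpa using this
  · intro n k θ hθ
    exact key n _ p _ (norm_nonneg _) hpq fun i j => (hexp θ hθ n i j).2.1 k
  · intro n θ hθ
    refine key n _ (p * p) _ (sq_nonneg _) hppq fun i j => ?_
    have := (hexp θ hθ n i j).2.2.1
    rw [← mul_assoc] at this
    simpa [Matrix.sum_apply, covMatrix, covMatrixD, kernel] using this
  · intro n k θ hθ
    refine key n _ (p * p) _ (sq_nonneg _) hppq fun i j => ?_
    have := (hexp θ hθ n i j).2.2.2 k
    rw [← mul_assoc] at this
    simpa [Matrix.sum_apply, covMatrixDD, covMatrixD, kernel] using this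
  · intro n k θ hθ
    exact hasDerivAt_matrix fun i j => hasDerivAt_partialD
      (hdiff _ (W₂_nonneg _ _) θ (hball' hθ)) (hball hθ) k

end Model

/-! ### Consistency of the estimator -/

section Consistency

open scoped Matrix.Norms.L2Operator
open Matrix

set_option linter.unusedSectionVars false

variable {p : ℕ} {Ω : Type*} [MeasurableSpace Ω] {P : Measure Ω} [IsProbabilityMeasure P]
  {Θ : Set (Param p)} {F : Param p → ℝ → ℝ} {θ₀ : Param p} {μ : PointArray}
  {Y : WSpace → Ω → ℝ} {c C r : ℝ}

/-- The observation vector. -/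
def sample (μ : PointArray) (Y : WSpace → Ω → ℝ) (n : ℕ) (ω : Ω) : Fin n → ℝ :=
  fun i => Y (μ n i) ω

/-- The centered quadratic form `yᵀ B y - E[yᵀ B y]` of the observations. -/
noncomputable def centeredQuad (F : Param p → ℝ → ℝ) (θ₀ : Param p) (μ : PointArray)
    (Y : WSpace → Ω → ℝ) (n : ℕ) (B : Matrix (Fin n) (Fin n) ℝ) (ω : Ω) : ℝ :=
  sample μ Y n ω ⬝ᵥ B *ᵥ sample μ Y n ω - (B * covMatrix F μ n θ₀).trace

lemma centeredQuad_sub (n : ℕ) (B B' : Matrix (Fin n) (Fin n) ℝ) (ω : Ω) :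
    centeredQuad F θ₀ μ Y n (B - B') ω
      = centeredQuad F θ₀ μ Y n B ω - centeredQuad F θ₀ μ Y n B' ω := by
  simp only [centeredQuad, sub_mulVec, dotProduct_sub, sub_mul, trace_sub]
  ring

lemma RegularModel.mem (M : RegularModel P Θ F θ₀ μ Y c C r) : θ₀ ∈ Θ :=
  M.ball_subset (Metric.mem_ball_self M.r_pos)

lemma RegularModel.norm_inv_le (M : RegularModel P Θ F θ₀ μ Y c C r) {n : ℕ} (hn : 1 ≤ n)
    {θ : Param p} (hθ : θ ∈ Θ) : ‖(covMatrix F μ n θ)⁻¹‖ ≤ c⁻¹ :=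
  (M.coercive n hn θ hθ).norm_inv_le M.c_pos

lemma abs_trace_mul_le {n : ℕ} {A B : Matrix (Fin n) (Fin n) ℝ} {a b : ℝ} (hA : ‖A‖ ≤ a)
    (hB : ‖B‖ ≤ b) : |(A * B).trace| ≤ n * (a * b) := by
  have ha : 0 ≤ a := (norm_nonneg _).trans hA
  refine (abs_trace_le _).trans ?_
  rw [Fintype.card_fin]
  gcongr
  exact (l2_opNorm_mul _ _).trans (by gcongr)

lemma RegularModel.abs_centeredQuad_le (M : RegularModel P Θ F θ₀ μ Y c C r) {n : ℕ}
    {B : Matrix (Fin n) (Fin n) ℝ} {b : ℝ} (hB : ‖B‖ ≤ b) (ω : Ω) :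
    |centeredQuad F θ₀ μ Y n B ω|
      ≤ b * (sample μ Y n ω ⬝ᵥ sample μ Y n ω + n * C) := by
  have h1 := abs_quadForm_le B (sample μ Y n ω)
  have h2 := abs_trace_mul_le hB (M.norm_le n θ₀ M.mem)
  have h3 := mul_le_mul_of_nonneg_right hB (dotProduct_self_nonneg' (sample μ Y n ω))
  refine (abs_sub _ _).trans ?_
  linarith

lemma RegularModel.chebyshev (M : RegularModel P Θ F θ₀ μ Y c C r) {n : ℕ} (hn : 1 ≤ n)
    {B : Matrix (Fin n) (Fin n) ℝ} {b δ : ℝ} (hB : ‖B‖ ≤ b) (hδ : 0 < δ) :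
    P {ω | δ ≤ |centeredQuad F θ₀ μ Y n B ω|} ≤ ENNReal.ofReal (2 * n * (b * C) ^ 2 / δ ^ 2) := by
  have hb : 0 ≤ b := (norm_nonneg _).trans hB
  exact chebyshev_quadForm (y := fun i => Y (μ n i)) (M.gaussian n) (M.mean n)
    ((M.coercive n hn θ₀ M.mem).posDef M.c_pos) (M.cov n) B
    (mul_le_mul hB (M.norm_le n θ₀ M.mem) (norm_nonneg _) hb) hδ

/-- The law of large numbers for quadratic forms of the observations. -/
lemma RegularModel.tendsto_centeredQuad (M : RegularModel P Θ F θ₀ μ Y c C r)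
    {B : (n : ℕ) → Matrix (Fin n) (Fin n) ℝ} {b : ℝ} (hB : ∀ n, 1 ≤ n → ‖B n‖ ≤ b) {δ : ℝ}
    (hδ : 0 < δ) :
    Tendsto (fun n : ℕ => P {ω | δ * n ≤ |centeredQuad F θ₀ μ Y n (B n) ω|}) atTop (𝓝 0) := by
  have h1 : Tendsto (fun n : ℕ => ENNReal.ofReal ((2 * (b * C) ^ 2 / δ ^ 2) / n)) atTop (𝓝 0) := by
    rw [← ENNReal.ofReal_zero]
    exact ENNReal.tendsto_ofReal (tendsto_const_div_atTop_nhds_zero_nat _)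
  refine tendsto_of_tendsto_of_tendsto_of_le_of_le' tendsto_const_nhds h1
    (Eventually.of_forall fun _ => zero_le) ?_
  filter_upwards [eventually_ge_atTop 1] with n hn
  have hn0 : (0 : ℝ) < n := by exact_mod_cast hn
  refine (M.chebyshev hn (hB n hn) (by positivity)).trans (ENNReal.ofReal_le_ofReal (le_of_eq ?_))
  field_simp

/-- The case `B = 1`, `δ = 1` of the law of large numbers: the mean of `|y|²` is `tr R_θ₀ ≤ n C`. -/
lemma RegularModel.tendsto_sample_norm (M : RegularModel P Θ F θ₀ μ Y c C r) :
    Tendsto (fun n : ℕ => P {ω | (C + 1) * n ≤ sample μ Y n ω ⬝ᵥ sample μ Y n ω}) atTop (𝓝 0) := by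
  refine tendsto_of_tendsto_of_tendsto_of_le_of_le tendsto_const_nhds
    (M.tendsto_centeredQuad (B := fun n => 1) (b := 1) (fun n _ => norm_one_le) one_pos)
    (fun _ => zero_le) fun n => measure_mono fun ω hω => ?_
  simp only [Set.mem_ofPred_eq, centeredQuad, one_mulVec, one_mul] at hω ⊢
  have h := (le_abs_self _).trans (abs_trace_le (covMatrix F μ n θ₀))
  rw [Fintype.card_fin] at h
  have h2 := mul_le_mul_of_nonneg_left (M.norm_le n θ₀ M.mem) (Nat.cast_nonneg (α := ℝ) n)
  refine le_trans ?_ (le_abs_self _)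
  linarith

lemma inv_sub_inv_eq {ι : Type*} [Fintype ι] [DecidableEq ι] {A B : Matrix ι ι ℝ}
    (hA : IsUnit A.det) (hB : IsUnit B.det) : A⁻¹ - B⁻¹ = -(A⁻¹ * (A - B) * B⁻¹) := by
  rw [mul_sub, sub_mul, nonsing_inv_mul _ hA, mul_assoc, mul_nonsing_inv _ hB, one_mul, mul_one]
  abel

lemma norm_mul_mul_le {ι : Type*} [Fintype ι] [DecidableEq ι] {A B D : Matrix ι ι ℝ} {a b d : ℝ}
    (hA : ‖A‖ ≤ a) (hB : ‖B‖ ≤ b) (hD : ‖D‖ ≤ d) : ‖A * B * D‖ ≤ a * b * d := by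
  have ha : 0 ≤ a := (norm_nonneg _).trans hA
  have hb : 0 ≤ b := (norm_nonneg _).trans hB
  exact (norm_mul_le _ _).trans (mul_le_mul ((norm_mul_le _ _).trans
    (mul_le_mul hA hB (norm_nonneg _) ha)) hD (norm_nonneg _) (by positivity))

lemma RegularModel.norm_inv_sub_inv_le (M : RegularModel P Θ F θ₀ μ Y c C r) {n : ℕ}
    (hn : 1 ≤ n) {θ θ' : Param p} (hθ : θ ∈ Θ) (hθ' : θ' ∈ Θ) {d : ℝ}
    (h : ‖covMatrix F μ n θ - covMatrix F μ n θ'‖ ≤ d) :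
    ‖(covMatrix F μ n θ)⁻¹ - (covMatrix F μ n θ')⁻¹‖ ≤ c⁻¹ * d * c⁻¹ := by
  rw [inv_sub_inv_eq ((M.coercive n hn θ hθ).isUnit_det M.c_pos)
    ((M.coercive n hn θ' hθ').isUnit_det M.c_pos), norm_neg]
  exact norm_mul_mul_le (M.norm_inv_le hn hθ) h (M.norm_inv_le hn hθ')

/-- The likelihood gap dominates the distance between covariance matrices, up to the centered
quadratic form. -/
lemma RegularModel.frobSq_le_of_likelihood_le (M : RegularModel P Θ F θ₀ μ Y c C r) {n : ℕ}
    (hn : 1 ≤ n) {θ : Param p} (hθ : θ ∈ Θ) {ω : Ω}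
    (h : likelihood F μ n (sample μ Y n ω) θ ≤ likelihood F μ n (sample μ Y n ω) θ₀) :
    frobSq (covMatrix F μ n θ - covMatrix F μ n θ₀) ≤ C ^ 2 * (2 * (c⁻¹ * C + 1)) *
      (centeredQuad F θ₀ μ Y n (covMatrix F μ n θ₀)⁻¹ ω
        - centeredQuad F θ₀ μ Y n (covMatrix F μ n θ)⁻¹ ω) := by
  have hn0 : (0 : ℝ) < n := by exact_mod_cast hn
  have hc := M.c_pos
  have hC := M.C_pos
  refine (frobSq_le_logDet ((M.coercive n hn θ hθ).posDef M.c_pos)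
    ((M.coercive n hn θ₀ M.mem).posDef M.c_pos) (M.norm_le n θ hθ) (M.norm_inv_le hn hθ)
    (M.norm_le n θ₀ M.mem)).trans ?_
  refine mul_le_mul_of_nonneg_left ?_ (by positivity)
  unfold likelihood at h
  rw [← mul_add, ← mul_add] at h
  have h' := le_of_mul_le_mul_left h (by positivity)
  -- The trace and the dimension in the divergence are exactly the means removed from the two
  -- quadratic forms, so only fluctuations remain on the right.
  unfold centeredQuad
  rw [nonsing_inv_mul _ ((M.coercive n hn θ₀ M.mem).isUnit_det M.c_pos), trace_one]
  linarith

/-- Consistency of the maximum likelihood estimator. -/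
theorem RegularModel.consistency (M : RegularModel P Θ F θ₀ μ Y c C r)
    (hb : Bornology.IsBounded Θ) (hcone : ConeCondition Θ) (h5 : Condition5 Θ F μ θ₀)
    {θhat : ℕ → Ω → Param p} (hθ : IsMLE P Θ F μ Y θhat) {α : ℝ} (hα : 0 < α) :
    Tendsto (fun n => P {ω | α ≤ ‖θhat n ω - θ₀‖}) atTop (𝓝 0) := by
  have hc := M.c_pos
  have hC := M.C_pos
  obtain ⟨η, hη0, hη⟩ := EReal.lt_iff_exists_real_btwn.1 (h5 α hα)
  have hη0' : 0 < η := by exact_mod_cast hη0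
  have hid := eventually_lt_of_lt_liminf hη
  set κ := C ^ 2 * (2 * (c⁻¹ * C + 1)) with hκ
  have hκ0 : 0 < κ := by positivity
  -- Three errors of size `δ n`, multiplied by `κ`, add up to `3/4 η n`, short of the `η n` forced
  -- by identifiability.
  set δ := η / (4 * κ) with hδ
  have hδ0 : 0 < δ := by positivity
  -- While `|y|² ≤ (C + 1) n`, the form with matrix `R_θ⁻¹` changes by at most `n ℓ ‖θ' - θ‖` along
  -- a segment of `Θ`.
  set ℓ := c⁻¹ * C * c⁻¹ * (2 * C + 1) with hℓ
  have hℓ0 : 0 < ℓ := by positivity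
  obtain ⟨G, hG, hGΘ, hnet⟩ := exists_finite_net hb hcone (ε := δ / ℓ) (by positivity)
  set bad : ℕ → Set Ω := fun n =>
    (⋃ g ∈ hG.toFinset, {ω | δ * n ≤ |centeredQuad F θ₀ μ Y n (covMatrix F μ n g)⁻¹ ω|}) ∪
    ({ω | δ * n ≤ |centeredQuad F θ₀ μ Y n (covMatrix F μ n θ₀)⁻¹ ω|} ∪
      {ω | (C + 1) * n ≤ sample μ Y n ω ⬝ᵥ sample μ Y n ω}) with hbad
  have hbad0 : Tendsto (fun n => ∑ g ∈ hG.toFinset,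
      P {ω | δ * n ≤ |centeredQuad F θ₀ μ Y n (covMatrix F μ n g)⁻¹ ω|} +
      (P {ω | δ * n ≤ |centeredQuad F θ₀ μ Y n (covMatrix F μ n θ₀)⁻¹ ω|} +
       P {ω | (C + 1) * n ≤ sample μ Y n ω ⬝ᵥ sample μ Y n ω})) atTop (𝓝 0) := by
    have e : (0 : ℝ≥0∞) = ∑ g ∈ hG.toFinset, 0 + (0 + 0) := by simp
    rw [e]
    refine (tendsto_finsetSum _ fun g hg => ?_).add
      ((M.tendsto_centeredQuad (fun n hn => M.norm_inv_le hn M.mem) hδ0).add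
        M.tendsto_sample_norm)
    exact M.tendsto_centeredQuad (fun n hn => M.norm_inv_le hn
      (hGΘ (hG.mem_toFinset.1 hg))) hδ0
  refine tendsto_of_tendsto_of_tendsto_of_le_of_le' tendsto_const_nhds hbad0
    (Eventually.of_forall fun _ => zero_le) ?_
  filter_upwards [hid, eventually_ge_atTop 1] with n hidn hn
  have hn0 : (0 : ℝ) < n := by exact_mod_cast hn
  have hsub : P {ω | α ≤ ‖θhat n ω - θ₀‖} ≤ P (bad n) := by
    refine measure_mono_ae ?_
    filter_upwards [hθ.2 n hn] with ω hω hαω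
    obtain ⟨hmem, hmin⟩ := hω
    by_contra hnb
    change ω ∉ bad n at hnb
    simp only [hbad, Set.mem_union, Set.mem_iUnion, not_or, not_exists, Set.mem_ofPred_eq,
      not_le] at hnb
    obtain ⟨hb1, hb2, hb3⟩ := hnb
    have h1 := M.frobSq_le_of_likelihood_le hn hmem (hmin θ₀ M.mem)
    have h2 : η < 1 / n * frobSq (covMatrix F μ n (θhat n ω) - covMatrix F μ n θ₀) := by
      have := lt_of_lt_of_le hidn (iInf₂_le (θhat n ω) ⟨hmem, hαω⟩)
      exact_mod_cast this
    obtain ⟨g, hg, hseg, hgd⟩ := hnet _ hmem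
    have h3 := M.abs_centeredQuad_le (M.norm_inv_sub_inv_le hn (hGΘ hg) hmem
      ((M.lipschitz n _ hmem _ (hGΘ hg) hseg).trans
        (mul_le_mul_of_nonneg_left hgd hC.le))) ω
    rw [centeredQuad_sub] at h3
    have h4 : c⁻¹ * (C * (δ / ℓ)) * c⁻¹ * (sample μ Y n ω ⬝ᵥ sample μ Y n ω + n * C) ≤ δ * n := by
      calc _ ≤ c⁻¹ * (C * (δ / ℓ)) * c⁻¹ * ((C + 1) * n + n * C) := by gcongr
        _ = (ℓ / ℓ) * δ * n := by rw [hℓ]; ring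
        _ = δ * n := by rw [div_self hℓ0.ne', one_mul]
    have h5 := hb1 g (hG.mem_toFinset.2 hg)
    have h6 : centeredQuad F θ₀ μ Y n (covMatrix F μ n θ₀)⁻¹ ω
        - centeredQuad F θ₀ μ Y n (covMatrix F μ n (θhat n ω))⁻¹ ω ≤ 3 * (δ * n) := by
      have a1 := (abs_lt.1 h5)
      have a2 := (abs_lt.1 hb2)
      have a3 := (abs_le.1 (h3.trans h4))
      linarith [a1.1, a1.2, a2.1, a2.2, a3.1, a3.2]
    have h7 := mul_le_mul_of_nonneg_left h6 hκ0.le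
    have h8 : η * n < κ * (3 * (δ * n)) := by
      rw [one_div, inv_mul_eq_div, lt_div_iff₀ hn0] at h2
      linarith
    have h9 : κ * (3 * (δ * n)) = 3 / 4 * (η * n) := by
      rw [hδ]; field_simp
    have : 0 < η * n := by positivity
    linarith
  refine hsub.trans ((measure_union_le _ _).trans (add_le_add ?_ (measure_union_le _ _)))
  exact measure_biUnion_finset_le _ _

end Consistency

/-! ### Likelihood equations and their expansion -/

section Score

open scoped Matrix.Norms.L2Operator
open Matrix

set_option linter.unusedSectionVars false

/-- First order expansion of `G D` and `G D G`, where `G` is the inverse of a matrix with first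
order expansion `X` and `D` has first order expansion `X'`. -/
lemma expansion_inv_mul {ι : Type*} [Fintype ι] [DecidableEq ι]
    {G G₀ Δ X D D₀ X' : Matrix ι ι ℝ} {g C d : ℝ} (hG : ‖G‖ ≤ g) (hG₀ : ‖G₀‖ ≤ g)
    (hinv : G - G₀ = -(G * Δ * G₀)) (hΔ : ‖Δ‖ ≤ C * d)
    (hX : ‖Δ - X‖ ≤ C * d ^ 2) (hD : ‖D‖ ≤ C) (hD₀ : ‖D₀‖ ≤ C) (hDD : ‖D - D₀‖ ≤ C * d)
    (hX' : ‖D - D₀ - X'‖ ≤ C * d ^ 2) :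
    ‖G * D - G₀ * D₀ - (G₀ * X' - G₀ * X * G₀ * D₀)‖
      ≤ (g * C * g * C + g * C + (g * C * g * C * g + g * C * g) * C) * d ^ 2 ∧
    ‖G * D * G - G₀ * D₀ * G₀ - ((G₀ * X' - G₀ * X * G₀ * D₀) * G₀ - G₀ * D₀ * (G₀ * X * G₀))‖
      ≤ ((g * C * g * C + g * C) * (g * C * g)
          + (g * C * g * C + g * C + (g * C * g * C * g + g * C * g) * C) * g
          + g * C * (g * C * g * C * g + g * C * g)) * d ^ 2 := by
  have hg : 0 ≤ g := (norm_nonneg _).trans hG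
  have mulb : ∀ {A B : Matrix ι ι ℝ} {a b : ℝ}, ‖A‖ ≤ a → ‖B‖ ≤ b → ‖A * B‖ ≤ a * b :=
    fun {A B a b} hA hB => (norm_mul_le _ _).trans
      (mul_le_mul hA hB (norm_nonneg _) ((norm_nonneg _).trans hA))
  have addb : ∀ {A B : Matrix ι ι ℝ} {a b : ℝ}, ‖A‖ ≤ a → ‖B‖ ≤ b → ‖A + B‖ ≤ a + b :=
    fun hA hB => (norm_add_le _ _).trans (add_le_add hA hB)
  have b1 : ‖G - G₀‖ ≤ g * C * g * d := by
    rw [hinv, norm_neg]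
    exact (norm_mul_mul_le hG hΔ hG₀).trans (le_of_eq (by ring))
  have b2 : ‖G - G₀ + G₀ * X * G₀‖ ≤ (g * C * g * C * g + g * C * g) * d ^ 2 := by
    -- In `-G Δ G₀`, replacing `G` by `G₀` and then `Δ` by `X` costs two terms of order `d²`.
    have e : G - G₀ + G₀ * X * G₀ = -((G - G₀) * Δ * G₀) + -(G₀ * (Δ - X) * G₀) := by
      have : G - G₀ + G₀ * X * G₀ = -(G * Δ * G₀) + G₀ * X * G₀ := by rw [hinv]
      rw [this]
      noncomm_ring
    rw [e]
    refine (addb (norm_neg ((G - G₀) * Δ * G₀) ▸ norm_mul_mul_le b1 hΔ hG₀)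
      (norm_neg (G₀ * (Δ - X) * G₀) ▸ norm_mul_mul_le hG₀ hX hG₀)).trans (le_of_eq (by ring))
  have b3 : ‖G * D - G₀ * D₀ - (G₀ * X' - G₀ * X * G₀ * D₀)‖
      ≤ (g * C * g * C + g * C + (g * C * g * C * g + g * C * g) * C) * d ^ 2 := by
    have e : G * D - G₀ * D₀ - (G₀ * X' - G₀ * X * G₀ * D₀)
        = (G - G₀) * (D - D₀) + G₀ * (D - D₀ - X') + (G - G₀ + G₀ * X * G₀) * D₀ := by
      noncomm_ring
    rw [e]
    exact (addb (addb (mulb b1 hDD) (mulb hG₀ hX')) (mulb b2 hD₀)).trans (le_of_eq (by ring))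
  have b4 : ‖G * D - G₀ * D₀‖ ≤ (g * C * g * C + g * C) * d := by
    have e : G * D - G₀ * D₀ = (G - G₀) * D + G₀ * (D - D₀) := by noncomm_ring
    rw [e]
    exact (addb (mulb b1 hD) (mulb hG₀ hDD)).trans (le_of_eq (by ring))
  refine ⟨b3, ?_⟩
  have e : G * D * G - G₀ * D₀ * G₀
      - ((G₀ * X' - G₀ * X * G₀ * D₀) * G₀ - G₀ * D₀ * (G₀ * X * G₀))
      = (G * D - G₀ * D₀) * (G - G₀) + (G * D - G₀ * D₀ - (G₀ * X' - G₀ * X * G₀ * D₀)) * G₀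
        + G₀ * D₀ * (G - G₀ + G₀ * X * G₀) := by noncomm_ring
  rw [e]
  exact (addb (addb (mulb b4 b1) (mulb b3 hG₀)) (mulb (mulb hG₀ hD₀) b2)).trans
    (le_of_eq (by ring))

variable {p : ℕ} {Ω : Type*} [MeasurableSpace Ω] {P : Measure Ω} [IsProbabilityMeasure P]
  {Θ : Set (Param p)} {F : Param p → ℝ → ℝ} {θ₀ : Param p} {μ : PointArray}
  {Y : WSpace → Ω → ℝ} {c C r : ℝ}

lemma hasDerivAt_inv_matrix {ι : Type*} [Fintype ι] [DecidableEq ι] {f : ℝ → Matrix ι ι ℝ}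
    {f' : Matrix ι ι ℝ} {s : ℝ} (h : HasDerivAt f f' s) (hu : IsUnit (f s)) :
    HasDerivAt (fun x => (f x)⁻¹) (-((f s)⁻¹ * f' * (f s)⁻¹)) s := by
  obtain ⟨u, hu⟩ := hu
  have h1 := hasFDerivAt_ringInverse (𝕜 := ℝ) u
  rw [hu] at h1
  have h2 := h1.comp_hasDerivAt s h
  have e : ((u⁻¹ : (Matrix ι ι ℝ)ˣ) : Matrix ι ι ℝ) = (f s)⁻¹ := by
    rw [← hu, ← coe_units_inv]
  simp only [e] at h2
  refine (h2.congr_of_eventuallyEq (Eventually.of_forall fun x => ?_)).congr_deriv ?_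
  · exact nonsing_inv_eq_ringInverse (f x)
  · simp

/-- The likelihood equations at an interior minimizer. -/
lemma RegularModel.score_eq_zero (M : RegularModel P Θ F θ₀ μ Y c C r) {n : ℕ} (hn : 1 ≤ n)
    {θ : Param p} (hθ : θ ∈ Metric.ball θ₀ r) {y : Fin n → ℝ}
    (hmin : ∀ θ' ∈ Θ, likelihood F μ n y θ ≤ likelihood F μ n y θ') (k : Fin p) :
    ((covMatrix F μ n θ)⁻¹ * covMatrixD Θ F μ n k θ).trace
      - y ⬝ᵥ ((covMatrix F μ n θ)⁻¹ * covMatrixD Θ F μ n k θ * (covMatrix F μ n θ)⁻¹) *ᵥ y = 0 := by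
  have hn0 : (0 : ℝ) < n := by exact_mod_cast hn
  have hθΘ := M.ball_subset hθ
  set A := covMatrix F μ n θ with hA
  set f : ℝ → Matrix (Fin n) (Fin n) ℝ :=
    fun s => covMatrix F μ n (θ + s • EuclideanSpace.single k 1) with hf
  have hf0 : f 0 = A := by simp [hf, hA]
  have hAu := (M.coercive n hn θ hθΘ).isUnit_det M.c_pos
  have hd : HasDerivAt f (covMatrixD Θ F μ n k θ) 0 := M.hasDerivAt n k θ hθ
  have hdi := hasDerivAt_inv_matrix hd (by rw [hf0]; exact (isUnit_iff_isUnit_det _).2 hAu)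
  rw [hf0] at hdi
  let ℓ₁ : Matrix (Fin n) (Fin n) ℝ →ₗ[ℝ] ℝ :=
    { toFun := fun B => (A⁻¹ * B).trace
      map_add' := fun B B' => by rw [mul_add, trace_add]
      map_smul' := fun a B => by rw [mul_smul_comm, trace_smul]; rfl }
  let ℓ₂ : Matrix (Fin n) (Fin n) ℝ →ₗ[ℝ] ℝ :=
    { toFun := fun B => y ⬝ᵥ B *ᵥ y
      map_add' := fun B B' => by rw [add_mulVec, dotProduct_add]
      map_smul' := fun a B => by rw [smul_mulVec, dotProduct_smul]; rfl }
  have h1 : HasDerivAt (fun s => ℓ₁ (f s)) (ℓ₁ (covMatrixD Θ F μ n k θ)) 0 :=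
    ℓ₁.toContinuousLinearMap.hasFDerivAt.comp_hasDerivAt 0 hd
  have h2 : HasDerivAt (fun s => ℓ₂ (f s)⁻¹) (ℓ₂ (-(A⁻¹ * covMatrixD Θ F μ n k θ * A⁻¹))) 0 :=
    ℓ₂.toContinuousLinearMap.hasFDerivAt.comp_hasDerivAt 0 hdi
  have h3 := h1.add h2
  have hcont : Continuous fun s : ℝ => θ + s • (EuclideanSpace.single k 1 : Param p) := by fun_prop
  have hev : ∀ᶠ s in 𝓝 (0 : ℝ), θ + s • (EuclideanSpace.single k 1 : Param p) ∈
      Metric.ball θ₀ r := by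
    refine hcont.continuousAt.eventually_mem (Metric.isOpen_ball.mem_nhds ?_)
    simpa using hθ
  -- This avoids differentiating `log det`. Nonnegativity of the divergence gives `log det (f s) ≤
  -- log det A + tr(A⁻¹ f s) - n`, with equality at `s = 0`, so a minimizer of the likelihood also
  -- minimizes locally the majorant where `log det` is replaced by its tangent.
  have hloc : IsLocalMin ((fun s => ℓ₁ (f s)) + fun s => ℓ₂ (f s)⁻¹) 0 := by
    filter_upwards [hev] with s hs
    have hsΘ := M.ball_subset hs
    have hkl := frobSq_le_logDet ((M.coercive n hn θ hθΘ).posDef M.c_pos)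
      -- The bound `‖A‖ + 1` makes the prefactor strictly positive, so that it can be divided out.
      ((M.coercive n hn _ hsΘ).posDef M.c_pos) (a := ‖A‖ + 1) (by linarith)
      le_rfl le_rfl
    have hkl0 := (frobSq_nonneg _).trans hkl
    have hpos : 0 ≤ Real.log A.det - Real.log (f s).det + (A⁻¹ * f s).trace - n := by
      have := (mul_nonneg_iff_of_pos_left (by positivity)).1 hkl0
      simpa using this
    have hl := hmin _ hsΘ
    unfold likelihood at hl
    rw [← mul_add, ← mul_add] at hl
    have hl' := le_of_mul_le_mul_left hl (by positivity)
    change (A⁻¹ * f 0).trace + y ⬝ᵥ (f 0)⁻¹ *ᵥ y ≤ (A⁻¹ * f s).trace + y ⬝ᵥ (f s)⁻¹ *ᵥ y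
    rw [hf0, nonsing_inv_mul _ hAu, trace_one, Fintype.card_fin]
    linarith
  have h4 := hloc.hasDerivAt_eq_zero h3
  rw [map_neg, ← sub_eq_add_neg] at h4
  exact h4

/-- The matrix `R⁻¹ ∂_kR R⁻¹` of the `k`-th score at `θ₀`. -/
noncomputable def scoreMatrix (Θ : Set (Param p)) (F : Param p → ℝ → ℝ) (θ₀ : Param p)
    (μ : PointArray) (n : ℕ) (k : Fin p) : Matrix (Fin n) (Fin n) ℝ :=
  (covMatrix F μ n θ₀)⁻¹ * covMatrixD Θ F μ n k θ₀ * (covMatrix F μ n θ₀)⁻¹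

/-- The matrix of the quadratic form in the second derivative of the likelihood at `θ₀`. -/
noncomputable def hessMatrix (Θ : Set (Param p)) (F : Param p → ℝ → ℝ) (θ₀ : Param p)
    (μ : PointArray) (n : ℕ) (j k : Fin p) : Matrix (Fin n) (Fin n) ℝ :=
  ((covMatrix F μ n θ₀)⁻¹ * covMatrixDD Θ F μ n j k θ₀
    - (covMatrix F μ n θ₀)⁻¹ * covMatrixD Θ F μ n j θ₀ * (covMatrix F μ n θ₀)⁻¹
      * covMatrixD Θ F μ n k θ₀) * (covMatrix F μ n θ₀)⁻¹
  - (covMatrix F μ n θ₀)⁻¹ * covMatrixD Θ F μ n k θ₀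
    * ((covMatrix F μ n θ₀)⁻¹ * covMatrixD Θ F μ n j θ₀ * (covMatrix F μ n θ₀)⁻¹)

lemma RegularModel.norm_scoreMatrix_le (M : RegularModel P Θ F θ₀ μ Y c C r) {n : ℕ}
    (hn : 1 ≤ n) (k : Fin p) : ‖scoreMatrix Θ F θ₀ μ n k‖ ≤ c⁻¹ * C * c⁻¹ :=
  norm_mul_mul_le (M.norm_inv_le hn M.mem) (M.normD_le n k _ M.mem) (M.norm_inv_le hn M.mem)

lemma RegularModel.norm_hessMatrix_le (M : RegularModel P Θ F θ₀ μ Y c C r) {n : ℕ}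
    (hn : 1 ≤ n) (j k : Fin p) : ‖hessMatrix Θ F θ₀ μ n j k‖ ≤
      (c⁻¹ * C + c⁻¹ * C * c⁻¹ * C) * c⁻¹ + c⁻¹ * C * (c⁻¹ * C * c⁻¹) := by
  have hc := M.c_pos
  have hC := M.C_pos
  have mulb : ∀ {A B : Matrix (Fin n) (Fin n) ℝ} {a b : ℝ}, ‖A‖ ≤ a → ‖B‖ ≤ b →
      ‖A * B‖ ≤ a * b := fun {A B a b} hA hB => (norm_mul_le _ _).trans
        (mul_le_mul hA hB (norm_nonneg _) ((norm_nonneg _).trans hA))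
  have subb : ∀ {A B : Matrix (Fin n) (Fin n) ℝ} {a b : ℝ}, ‖A‖ ≤ a → ‖B‖ ≤ b →
      ‖A - B‖ ≤ a + b := fun hA hB => (norm_sub_le _ _).trans (add_le_add hA hB)
  have hG := M.norm_inv_le hn M.mem
  have hD := fun k => M.normD_le n k _ M.mem
  exact subb (mulb (subb (mulb hG (M.normDD_le n j k _ M.mem))
    (mulb (norm_mul_mul_le hG (hD j) hG) (hD k))) hG)
    (mulb (mulb hG (hD k)) (norm_mul_mul_le hG (hD j) hG))

lemma centeredQuad_sum_smul {ι : Type*} (s : Finset ι) (n : ℕ) (a : ι → ℝ)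
    (B : ι → Matrix (Fin n) (Fin n) ℝ) (ω : Ω) :
    centeredQuad F θ₀ μ Y n (∑ i ∈ s, a i • B i) ω
      = ∑ i ∈ s, a i * centeredQuad F θ₀ μ Y n (B i) ω := by
  simp only [centeredQuad, sum_mulVec, dotProduct_sum, smul_mulVec, dotProduct_smul, Finset.sum_mul,
    trace_sum, smul_mul_assoc, trace_smul, smul_eq_mul, Finset.sum_sub_distrib, mul_sub]

/-- Expansion of the likelihood equations around `θ₀`. -/
lemma RegularModel.exists_score_expansion (M : RegularModel P Θ F θ₀ μ Y c C r) :
    ∃ K > 0, ∀ n, 1 ≤ n → ∀ θ ∈ Metric.ball θ₀ r, ∀ ω,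
      (∀ θ' ∈ Θ, likelihood F μ n (sample μ Y n ω) θ ≤ likelihood F μ n (sample μ Y n ω) θ') →
      ∀ k, |2 * n * ∑ j, fisherMatrix Θ F μ n θ₀ k j * (θ - θ₀) j
          - centeredQuad F θ₀ μ Y n (scoreMatrix Θ F θ₀ μ n k) ω|
        ≤ ‖θ - θ₀‖ * ∑ j, |centeredQuad F θ₀ μ Y n (hessMatrix Θ F θ₀ μ n j k) ω|
          + K * ‖θ - θ₀‖ ^ 2 * (n + sample μ Y n ω ⬝ᵥ sample μ Y n ω) := by
  have hc := M.c_pos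
  have hC := M.C_pos
  set g := c⁻¹ with hg
  have hg0 : 0 < g := inv_pos.2 hc
  set K₁ := g * C * g * C + g * C + (g * C * g * C * g + g * C * g) * C with hK₁
  set K₂ := (g * C * g * C + g * C) * (g * C * g) + K₁ * g
    + g * C * (g * C * g * C * g + g * C * g) with hK₂
  have hK₁0 : 0 < K₁ := by positivity
  have hK₂0 : 0 < K₂ := by positivity
  refine ⟨K₁ + K₂, by positivity, fun n hn θ hθ ω hmin k => ?_⟩
  have hn0 : (0 : ℝ) < n := by exact_mod_cast hn
  have hθΘ := M.ball_subset hθ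
  have hs := M.score_eq_zero hn hθ hmin k
  set y := sample μ Y n ω with hy
  set δ := θ - θ₀ with hδ
  set R₀ := covMatrix F μ n θ₀ with hR₀
  set G := (covMatrix F μ n θ)⁻¹ with hG
  set G₀ := R₀⁻¹ with hG₀
  set D := covMatrixD Θ F μ n k θ with hD
  set D₀ := covMatrixD Θ F μ n k θ₀ with hD₀
  set X := ∑ j, δ j • covMatrixD Θ F μ n j θ₀ with hX
  set X' := ∑ j, δ j • covMatrixDD Θ F μ n j k θ₀ with hX'
  have hu₀ := (M.coercive n hn θ₀ M.mem).isUnit_det M.c_pos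
  have hΔ : ‖covMatrix F μ n θ - R₀‖ ≤ C * ‖δ‖ := by
    refine M.lipschitz n θ₀ M.mem θ hθΘ (((convex_ball θ₀ r).segment_subset
      (Metric.mem_ball_self M.r_pos) hθ).trans M.ball_subset)
  obtain ⟨e1, e2⟩ := expansion_inv_mul (M.norm_inv_le hn hθΘ) (M.norm_inv_le hn M.mem)
    (inv_sub_inv_eq ((M.coercive n hn θ hθΘ).isUnit_det M.c_pos) hu₀) hΔ
    (M.expansion n θ hθ) (M.normD_le n k θ hθΘ) (M.normD_le n k θ₀ M.mem) (M.lipD n k θ hθ)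
    (M.expansionD n k θ hθ)
  -- `T'` and `V'` are the first order variations of `R⁻¹ ∂_kR` and `R⁻¹ ∂_kR R⁻¹`.
  set T' := G₀ * X' - G₀ * X * G₀ * D₀ with hT'
  set V' := T' * G₀ - G₀ * D₀ * (G₀ * X * G₀) with hV'
  have hV'sum : V' = ∑ j, δ j • hessMatrix Θ F θ₀ μ n j k := by
    simp only [hV', hT', hX, hX', hessMatrix, Finset.mul_sum, Finset.sum_mul, mul_smul_comm,
      smul_mul_assoc, smul_sub, Finset.sum_sub_distrib, sub_mul]
    rfl
  have hqV' : centeredQuad F θ₀ μ Y n V' ω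
      = ∑ j, δ j * centeredQuad F θ₀ μ Y n (hessMatrix Θ F θ₀ μ n j k) ω := by
    rw [hV'sum, centeredQuad_sum_smul]
  have htr1 : (V' * R₀).trace = T'.trace - (G₀ * D₀ * G₀ * X).trace := by
    rw [hV', sub_mul, mul_assoc T', mul_assoc (G₀ * D₀), mul_assoc (G₀ * X),
      nonsing_inv_mul _ hu₀, mul_one, mul_one, trace_sub]
    simp only [mul_assoc]
  have htr2 : (G₀ * D₀ * G₀ * X).trace = 2 * n * ∑ j, fisherMatrix Θ F μ n θ₀ k j * δ j := by
    simp only [hX, Finset.mul_sum, trace_sum, mul_smul_comm, trace_smul, fisherMatrix, of_apply,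
      smul_eq_mul]
    refine Finset.sum_congr rfl fun j _ => ?_
    field_simp
    rfl
  have htr3 : (scoreMatrix Θ F θ₀ μ n k * R₀).trace = (G₀ * D₀).trace := by
    rw [scoreMatrix, mul_assoc, nonsing_inv_mul _ hu₀, mul_one]
  have b1 : |(G * D - G₀ * D₀ - T').trace| ≤ n * (K₁ * ‖δ‖ ^ 2) := by
    refine (abs_trace_le _).trans ?_
    rw [Fintype.card_fin]
    gcongr
  have b2 : |y ⬝ᵥ (G * D * G - G₀ * D₀ * G₀ - V') *ᵥ y| ≤ K₂ * ‖δ‖ ^ 2 * (y ⬝ᵥ y) :=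
    (abs_quadForm_le _ _).trans (mul_le_mul_of_nonneg_right e2 (dotProduct_self_nonneg' y))
  have b3 : |∑ j, δ j * centeredQuad F θ₀ μ Y n (hessMatrix Θ F θ₀ μ n j k) ω|
      ≤ ‖δ‖ * ∑ j, |centeredQuad F θ₀ μ Y n (hessMatrix Θ F θ₀ μ n j k) ω| := by
    refine (Finset.abs_sum_le_sum_abs _ _).trans ?_
    rw [Finset.mul_sum]
    refine Finset.sum_le_sum fun j _ => ?_
    rw [abs_mul]
    exact mul_le_mul_of_nonneg_right (PiLp.norm_apply_le δ j) (abs_nonneg _)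
  -- The mean `tr(V' R₀)` of the varied quadratic form is `tr T'` minus the Fisher term. `tr T'`
  -- cancels against the variation of the trace in the score, leaving the Fisher term, a centered
  -- form linear in `δ`, and remainders.
  have key : 2 * n * ∑ j, fisherMatrix Θ F μ n θ₀ k j * δ j
      - centeredQuad F θ₀ μ Y n (scoreMatrix Θ F θ₀ μ n k) ω
      = ∑ j, δ j * centeredQuad F θ₀ μ Y n (hessMatrix Θ F θ₀ μ n j k) ω
        + (-(G * D - G₀ * D₀ - T').trace + y ⬝ᵥ (G * D * G - G₀ * D₀ * G₀ - V') *ᵥ y) := by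
    rw [← hqV', ← htr2]
    have htr1' := htr1
    simp only [centeredQuad, ← hy, ← hR₀, htr1, htr3, trace_sub, sub_mulVec, dotProduct_sub]
    simp only [scoreMatrix]
    linarith
  rw [key]
  refine (abs_add_le _ _).trans (add_le_add b3 ((abs_add_le _ _).trans ?_))
  rw [abs_neg]
  have hyy := dotProduct_self_nonneg' y
  have : 0 ≤ K₂ * ‖δ‖ ^ 2 * n := by positivity
  have : 0 ≤ K₁ * ‖δ‖ ^ 2 * (y ⬝ᵥ y) := by positivity
  linarith

end Score

/-! ### Eigenvalue bounds for the Fisher information -/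

section Fisher

open scoped Matrix.Norms.L2Operator
open Matrix

set_option linter.unusedSectionVars false

variable {p : ℕ} {Ω : Type*} [MeasurableSpace Ω] {P : Measure Ω} [IsProbabilityMeasure P]
  {Θ : Set (Param p)} {F : Param p → ℝ → ℝ} {θ₀ : Param p} {μ : PointArray}
  {Y : WSpace → Ω → ℝ} {c C r : ℝ}

/-- The derivative of the covariance matrix at `θ₀` in the direction `l`. -/
noncomputable def dirD (Θ : Set (Param p)) (F : Param p → ℝ → ℝ) (θ₀ : Param p)
    (μ : PointArray) (n : ℕ) (l : Fin p → ℝ) : Matrix (Fin n) (Fin n) ℝ :=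
  ∑ k, l k • covMatrixD Θ F μ n k θ₀

lemma dirD_add (n : ℕ) (l l' : Fin p → ℝ) :
    dirD Θ F θ₀ μ n (l + l') = dirD Θ F θ₀ μ n l + dirD Θ F θ₀ μ n l' := by
  simp [dirD, add_smul, Finset.sum_add_distrib]

lemma dirD_smul (n : ℕ) (a : ℝ) (l : Fin p → ℝ) :
    dirD Θ F θ₀ μ n (a • l) = a • dirD Θ F θ₀ μ n l := by
  simp [dirD, mul_smul, Finset.smul_sum]

lemma RegularModel.norm_dirD_le (M : RegularModel P Θ F θ₀ μ Y c C r) (n : ℕ) (l : Param p) :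
    ‖dirD Θ F θ₀ μ n l.ofLp‖ ≤ p * C * ‖l‖ := by
  refine (norm_sum_le _ _).trans ?_
  calc _ ≤ ∑ _k : Fin p, ‖l‖ * C := Finset.sum_le_sum fun k _ => by
        rw [norm_smul]
        exact mul_le_mul (PiLp.norm_apply_le l k) (M.normD_le n k _ M.mem) (norm_nonneg _)
          (norm_nonneg _)
    _ = p * C * ‖l‖ := by simp; ring

lemma RegularModel.transpose_dirD (M : RegularModel P Θ F θ₀ μ Y c C r) (n : ℕ)
    (l : Fin p → ℝ) : (dirD Θ F θ₀ μ n l)ᵀ = dirD Θ F θ₀ μ n l := by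
  simp [dirD, transpose_sum, M.symmD n _ _ M.mem]

lemma frobSq_dirD (n : ℕ) (l : Fin p → ℝ) : frobSq (dirD Θ F θ₀ μ n l) =
    ∑ i, ∑ j, (∑ k, l k * partialD Θ k (fun η => kernel F η (μ n i) (μ n j)) θ₀) ^ 2 := by
  simp [frobSq, dirD, covMatrixD, Matrix.sum_apply]

lemma frobSq_add_le {ι : Type*} [Fintype ι] [DecidableEq ι] (A B : Matrix ι ι ℝ) :
    frobSq (A + B) ≤ 2 * frobSq A + 2 * frobSq B := by
  simp only [frobSq, Finset.mul_sum, ← Finset.sum_add_distrib]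
  refine Finset.sum_le_sum fun i _ => Finset.sum_le_sum fun j _ => ?_
  rw [Matrix.add_apply]
  nlinarith [sq_nonneg (A i j - B i j)]

/-- Asymptotic linear independence, uniformly over directions. -/
lemma RegularModel.exists_frobSq_dirD_ge (M : RegularModel P Θ F θ₀ μ Y c C r)
    (h8 : Condition8 Θ F μ θ₀) : ∃ m > 0, ∀ᶠ n : ℕ in atTop, ∀ l : Param p,
      m * ‖l‖ ^ 2 ≤ 1 / n * frobSq (dirD Θ F θ₀ μ n l.ofLp) := by
  have hC := M.C_pos
  -- The liminf in one direction persists on a neighbourhood of it, with the same range of `n`;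
  -- compactness leaves finitely many neighbourhoods.
  have hloc : ∀ l₀ ∈ Metric.sphere (0 : Param p) 1, ∃ t ∈ 𝓝[Metric.sphere (0 : Param p) 1] l₀,
      ∃ m > 0, ∀ᶠ n : ℕ in atTop, ∀ l ∈ t, m ≤ 1 / n * frobSq (dirD Θ F θ₀ μ n l.ofLp) := by
    intro l₀ hl₀
    have hl0 : l₀.ofLp ≠ 0 := fun h => by
      have : l₀ = 0 := by ext i; simp [h]
      simp [this] at hl₀
    obtain ⟨η, hη0, hη⟩ := EReal.lt_iff_exists_real_btwn.1 (h8 l₀.ofLp hl0)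
    have hη0' : 0 < η := by exact_mod_cast hη0
    have hev := eventually_lt_of_lt_liminf hη
    -- Directions within `ρ` of `l₀` change the derivative matrix by a squared Frobenius norm of at
    -- most `n η / 4`, so `n η < 2 frobSq + n η / 2` leaves `n η / 4`.
    set ρ := Real.sqrt (η / 4) / (p * C + 1) with hρ
    have hρ0 : 0 < ρ := by positivity
    refine ⟨Metric.ball l₀ ρ, mem_nhdsWithin_of_mem_nhds (Metric.ball_mem_nhds _ hρ0), η / 4,
      by positivity, ?_⟩
    filter_upwards [hev, eventually_ge_atTop 1] with n hn hn1 l hl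
    have hn0 : (0 : ℝ) < n := by exact_mod_cast hn1
    have h1 : η < 1 / n * frobSq (dirD Θ F θ₀ μ n l₀.ofLp) := by
      rw [frobSq_dirD]
      exact_mod_cast hn
    have h2 : dirD Θ F θ₀ μ n l₀.ofLp
        = dirD Θ F θ₀ μ n l.ofLp + dirD Θ F θ₀ μ n (l₀ - l).ofLp := by
      rw [← dirD_add]
      simp
    have h3 := frobSq_add_le (dirD Θ F θ₀ μ n l.ofLp) (dirD Θ F θ₀ μ n (l₀ - l).ofLp)
    rw [← h2] at h3
    have h4 := frobSq_le_card_mul (dirD Θ F θ₀ μ n (l₀ - l).ofLp)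
    rw [Fintype.card_fin] at h4
    have h5 : ‖dirD Θ F θ₀ μ n (l₀ - l).ofLp‖ ≤ Real.sqrt (η / 4) := by
      refine (M.norm_dirD_le n (l₀ - l)).trans ?_
      rw [Metric.mem_ball, dist_comm, dist_eq_norm] at hl
      calc p * C * ‖l₀ - l‖ ≤ (p * C + 1) * ρ := by gcongr; linarith
        _ = Real.sqrt (η / 4) := by rw [hρ]; field_simp
    have h6 : ‖dirD Θ F θ₀ μ n (l₀ - l).ofLp‖ ^ 2 ≤ η / 4 := by
      calc _ ≤ Real.sqrt (η / 4) ^ 2 := by gcongr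
        _ = η / 4 := Real.sq_sqrt (by positivity)
    have h7 : (n : ℝ) * ‖dirD Θ F θ₀ μ n (l₀ - l).ofLp‖ ^ 2 ≤ n * (η / 4) := by gcongr
    rw [one_div, inv_mul_eq_div, lt_div_iff₀ hn0] at h1
    rw [one_div, inv_mul_eq_div, le_div_iff₀ hn0]
    linarith
  obtain ⟨m, hm, h⟩ := (isCompact_sphere (0 : Param p) 1).induction_on
    (p := fun t => ∃ m > 0, ∀ᶠ n : ℕ in atTop, ∀ l ∈ t,
      m ≤ 1 / n * frobSq (dirD Θ F θ₀ μ n (l : Param p).ofLp))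
    ⟨1, one_pos, by simp⟩
    (fun s t hst ⟨m, hm, h⟩ => ⟨m, hm, h.mono fun n hn l hl => hn l (hst hl)⟩)
    (fun s t ⟨m, hm, h⟩ ⟨m', hm', h'⟩ => ⟨min m m', lt_min hm hm', by
      filter_upwards [h, h'] with n hn hn' l hl
      rcases hl with hl | hl
      · exact (min_le_left _ _).trans (hn l hl)
      · exact (min_le_right _ _).trans (hn' l hl)⟩) hloc
  refine ⟨m, hm, h.mono fun n hn l => ?_⟩
  rcases eq_or_ne l 0 with rfl | hl
  · have := frobSq_nonneg (dirD Θ F θ₀ μ n (0 : Param p).ofLp)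
    simp only [norm_zero]
    have h0 : (0 : ℝ) ≤ 1 / n := by positivity
    nlinarith [mul_nonneg h0 this]
  have hl' : 0 < ‖l‖ := norm_pos_iff.2 hl
  have h1 := hn (‖l‖⁻¹ • l) (by simp [norm_smul, hl])
  have h2 : l.ofLp = ‖l‖ • (‖l‖⁻¹ • l).ofLp := by
    rw [← WithLp.ofLp_smul, smul_smul, mul_inv_cancel₀ hl'.ne', one_smul]
  rw [h2, dirD_smul, frobSq_smul]
  calc m * ‖l‖ ^ 2 ≤ (1 / n * frobSq (dirD Θ F θ₀ μ n (‖l‖⁻¹ • l).ofLp)) * ‖l‖ ^ 2 := by gcongr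
    _ = _ := by ring

lemma fisher_quadForm (n : ℕ) (l : Fin p → ℝ) :
    l ⬝ᵥ fisherMatrix Θ F μ n θ₀ *ᵥ l = 1 / (2 * n) *
      ((covMatrix F μ n θ₀)⁻¹ * dirD Θ F θ₀ μ n l
        * ((covMatrix F μ n θ₀)⁻¹ * dirD Θ F θ₀ μ n l)).trace := by
  simp only [dirD, Finset.mul_sum, Finset.sum_mul, trace_sum, mul_smul_comm, smul_mul_assoc,
    trace_smul, smul_eq_mul, dotProduct, mulVec, fisherMatrix, of_apply]
  rw [Finset.sum_comm]
  refine Finset.sum_congr rfl fun i _ => Finset.sum_congr rfl fun j _ => ?_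
  simp only [mul_assoc]
  ring

lemma fisherMatrix_isHermitian (n : ℕ) : (fisherMatrix Θ F μ n θ₀).IsHermitian := by
  ext i j
  simp only [conjTranspose_apply, star_trivial, fisherMatrix, of_apply]
  rw [mul_assoc, trace_mul_comm, ← mul_assoc]

/-- The Fisher information matrices have bounded eigenvalues. -/
lemma RegularModel.fisher_quadForm_le (M : RegularModel P Θ F θ₀ μ Y c C r) :
    ∃ m₁ > 0, ∀ n, 1 ≤ n → ∀ l : Param p,
      l.ofLp ⬝ᵥ fisherMatrix Θ F μ n θ₀ *ᵥ l.ofLp ≤ m₁ * ‖l‖ ^ 2 := by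
  have hc := M.c_pos
  have hC := M.C_pos
  refine ⟨(c⁻¹ * (p * C)) ^ 2 + 1, by positivity, fun n hn l => ?_⟩
  have hn0 : (0 : ℝ) < n := by exact_mod_cast hn
  have h1 : ‖(covMatrix F μ n θ₀)⁻¹ * dirD Θ F θ₀ μ n l.ofLp‖ ≤ c⁻¹ * (p * C * ‖l‖) :=
    (norm_mul_le _ _).trans (mul_le_mul (M.norm_inv_le hn M.mem) (M.norm_dirD_le n l)
      (norm_nonneg _) (by positivity))
  have h2 := (le_abs_self _).trans (abs_trace_mul_le h1 h1)
  rw [fisher_quadForm]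
  calc _ ≤ 1 / (2 * (n : ℝ)) * (n * (c⁻¹ * (p * C * ‖l‖) * (c⁻¹ * (p * C * ‖l‖)))) := by gcongr
    _ = (c⁻¹ * (p * C)) ^ 2 * ‖l‖ ^ 2 / 2 := by field_simp
    _ ≤ _ := by
      have : 0 ≤ (c⁻¹ * (p * C)) ^ 2 * ‖l‖ ^ 2 := by positivity
      nlinarith [sq_nonneg ‖l‖]

/-- The Fisher information matrices are eventually uniformly positive definite. -/
lemma RegularModel.fisher_quadForm_ge (M : RegularModel P Θ F θ₀ μ Y c C r)
    (h8 : Condition8 Θ F μ θ₀) : ∃ m₀ > 0, ∀ᶠ n : ℕ in atTop, ∀ l : Param p,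
      m₀ * ‖l‖ ^ 2 ≤ l.ofLp ⬝ᵥ fisherMatrix Θ F μ n θ₀ *ᵥ l.ofLp := by
  have hC := M.C_pos
  obtain ⟨m, hm, h⟩ := M.exists_frobSq_dirD_ge h8
  refine ⟨m / (2 * C ^ 2), by positivity, ?_⟩
  filter_upwards [h, eventually_ge_atTop 1] with n hn hn1 l
  have hn0 : (0 : ℝ) < n := by exact_mod_cast hn1
  obtain ⟨S, hS, hSu⟩ := exists_factorization ((M.coercive n hn1 θ₀ M.mem).posDef M.c_pos)
  set D := dirD Θ F θ₀ μ n l.ofLp with hD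
  set T := S⁻¹ with hT
  have hTS : T * S = 1 := nonsing_inv_mul _ hSu
  have hTS' : Sᵀ * Tᵀ = 1 := by rw [← transpose_mul, hTS, transpose_one]
  have hinv : (covMatrix F μ n θ₀)⁻¹ = T * Tᵀ := by
    rw [hS, Matrix.mul_inv_rev, ← transpose_nonsing_inv]
  have hSn : ‖S‖ ^ 2 ≤ C := by
    rw [← norm_transpose_mul_self, ← hS]
    exact M.norm_le n θ₀ M.mem
  -- With `R⁻¹ = T Tᵀ`, cyclicity turns the trace into a Frobenius norm of the congruent matrix;
  -- returning to `D` costs `‖S‖⁴ ≤ C²`.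
  have e1 : ((covMatrix F μ n θ₀)⁻¹ * D * ((covMatrix F μ n θ₀)⁻¹ * D)).trace
      = frobSq (Tᵀ * D * T) := by
    rw [frobSq_eq_trace, hinv]
    simp only [transpose_mul, transpose_transpose, M.transpose_dirD, hD]
    calc _ = (T * (Tᵀ * dirD Θ F θ₀ μ n l.ofLp * T * (Tᵀ * dirD Θ F θ₀ μ n l.ofLp))).trace := by
          simp only [mul_assoc]
      _ = _ := by
          rw [trace_mul_comm]
          simp only [mul_assoc]
  have e2 : D = Sᵀ * (Tᵀ * D * T) * S := by
    calc D = (Sᵀ * Tᵀ) * D * (T * S) := by rw [hTS, hTS', one_mul, mul_one]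
      _ = _ := by simp only [mul_assoc]
  have h1 : frobSq D ≤ C ^ 2 * frobSq (Tᵀ * D * T) := by
    have h0 := frobSq_nonneg (Tᵀ * D * T)
    calc frobSq D = frobSq (Sᵀ * (Tᵀ * D * T) * S) := by rw [← e2]
      _ ≤ ‖S‖ ^ 2 * (‖Sᵀ‖ ^ 2 * frobSq (Tᵀ * D * T)) :=
          (frobSq_mul_le' _ _).trans (by gcongr; exact frobSq_mul_le _ _)
      _ = (‖S‖ ^ 2) ^ 2 * frobSq (Tᵀ * D * T) := by rw [norm_transpose]; ring
      _ ≤ _ := by gcongr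
  rw [fisher_quadForm, e1]
  have h2 := hn l
  calc m / (2 * C ^ 2) * ‖l‖ ^ 2 = (m * ‖l‖ ^ 2) / (2 * C ^ 2) := by ring
    _ ≤ (1 / n * (C ^ 2 * frobSq (Tᵀ * D * T))) / (2 * C ^ 2) := by
        refine div_le_div_of_nonneg_right (h2.trans ?_) (by positivity)
        exact mul_le_mul_of_nonneg_left h1 (by positivity)
    _ = _ := by field_simp

end Fisher

/-! ### Central limit theorem for the scores -/

section ScoreLimit

open scoped Matrix.Norms.L2Operator
open Matrix

set_option linter.unusedSectionVars false

variable {p : ℕ} {Ω : Type*} [MeasurableSpace Ω] {P : Measure Ω} [IsProbabilityMeasure P]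
  {Θ : Set (Param p)} {F : Param p → ℝ → ℝ} {θ₀ : Param p} {μ : PointArray}
  {Y : WSpace → Ω → ℝ} {c C r : ℝ}

/-- Asymptotic normality of linear combinations of the scores, in terms of characteristic
functions. -/
lemma RegularModel.tendsto_charFun_score (M : RegularModel P Θ F θ₀ μ Y c C r)
    {l : ℕ → Param p} {b σ : ℝ} (hb : ∀ᶠ n in atTop, ‖l n‖ ≤ b)
    (hσ : ∀ᶠ n in atTop, (l n).ofLp ⬝ᵥ fisherMatrix Θ F μ n θ₀ *ᵥ (l n).ofLp = σ) :
    Tendsto (fun n : ℕ => charFun (P.map fun ω =>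
        ∑ k, (l n k / (2 * Real.sqrt n)) *
          centeredQuad F θ₀ μ Y n (scoreMatrix Θ F θ₀ μ n k) ω) 1)
      atTop (𝓝 (Complex.exp (-(σ : ℂ) / 2))) := by
  have hc := M.c_pos
  have hC := M.C_pos
  rw [Metric.tendsto_atTop']
  intro ε hε
  obtain ⟨η, hη, h⟩ := charFun_quadForm (P := P) (ε := ε / (|σ| + 1)) (by positivity)
  -- The Lindeberg-type condition: the normalized matrix has operator norm `O(n^{-1/2})`, so every
  -- chi-square weight is eventually small.
  have hlim : Tendsto (fun n : ℕ => c⁻¹ * (p * C * b) * c⁻¹ * C / 2 * (Real.sqrt n)⁻¹) atTop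
      (𝓝 0) := by
    rw [← mul_zero (c⁻¹ * (p * C * b) * c⁻¹ * C / 2)]
    exact ((tendsto_inv_atTop_zero.comp
      (Real.tendsto_sqrt_atTop.comp tendsto_natCast_atTop_atTop))).const_mul _
  have hev : ∀ᶠ n : ℕ in atTop, dist (charFun (P.map fun ω =>
        ∑ k, (l n k / (2 * Real.sqrt n)) *
          centeredQuad F θ₀ μ Y n (scoreMatrix Θ F θ₀ μ n k) ω) 1)
      (Complex.exp (-(σ : ℂ) / 2)) < ε := by
    filter_upwards [hb, hσ, hlim.eventually_le_const hη, eventually_ge_atTop 1]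
      with n hbn hσn hηn hn
    have hn0 : (0 : ℝ) < n := by exact_mod_cast hn
    have hsn : 0 < Real.sqrt n := Real.sqrt_pos.2 hn0
    set a := 1 / (2 * Real.sqrt n) with ha
    have ha0 : 0 < a := by positivity
    set R := covMatrix F μ n θ₀ with hR
    set D := dirD Θ F θ₀ μ n (l n).ofLp with hD
    set B := a • (R⁻¹ * D * R⁻¹) with hB
    have hu := (M.coercive n hn θ₀ M.mem).isUnit_det M.c_pos
    have hBsum : B = ∑ k, (l n k / (2 * Real.sqrt n)) • scoreMatrix Θ F θ₀ μ n k := by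
      simp only [hB, hD, dirD, Finset.mul_sum, Finset.sum_mul, Finset.smul_sum, mul_smul_comm,
        smul_mul_assoc, smul_smul, scoreMatrix, ha]
      refine Finset.sum_congr rfl fun k _ => ?_
      congr 1
      ring
    have hRt : (R⁻¹)ᵀ = R⁻¹ := by
      have := (M.coercive n hn θ₀ M.mem).1.eq
      rw [conjTranspose_eq_transpose_of_trivial] at this
      rw [transpose_nonsing_inv, this]
    have hBt : Bᵀ = B := by
      rw [hB, transpose_smul, transpose_mul, transpose_mul, hRt, M.transpose_dirD, mul_assoc]
    have hBn : ‖B‖ * ‖R‖ ≤ η := by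
      refine le_trans ?_ hηn
      rw [hB, norm_smul, Real.norm_of_nonneg ha0.le]
      have h1 : ‖R⁻¹ * D * R⁻¹‖ ≤ c⁻¹ * (p * C * b) * c⁻¹ :=
        norm_mul_mul_le (M.norm_inv_le hn M.mem) ((M.norm_dirD_le n (l n)).trans (by gcongr))
          (M.norm_inv_le hn M.mem)
      have h2 : ‖R‖ ≤ C := M.norm_le n θ₀ M.mem
      have h3 : 0 ≤ c⁻¹ * (p * C * b) * c⁻¹ := (norm_nonneg _).trans h1
      calc a * ‖R⁻¹ * D * R⁻¹‖ * ‖R‖ ≤ a * (c⁻¹ * (p * C * b) * c⁻¹) * C := by gcongr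
        _ = _ := by rw [ha]; field_simp
    have htr : (B * R * (B * R)).trace = σ / 2 := by
      have e1 : B * R = a • (R⁻¹ * D) := by
        rw [hB, smul_mul_assoc, mul_assoc (R⁻¹ * D), nonsing_inv_mul _ hu, mul_one]
      rw [fisher_quadForm] at hσn
      rw [e1, smul_mul_assoc, mul_smul_comm, smul_smul, trace_smul, smul_eq_mul, ← hσn]
      have : a * a = 1 / (2 * (n : ℝ)) / 2 := by
        rw [ha, div_mul_div_comm, one_mul, mul_mul_mul_comm, Real.mul_self_sqrt hn0.le]
        field_simp
      rw [this]
      ring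
    have hkey := h (y := fun i => Y (μ n i)) (M.gaussian n) (M.mean n)
      ((M.coercive n hn θ₀ M.mem).posDef M.c_pos) (M.cov n) hBt hBn
    have hfun : (fun ω => (fun i => Y (μ n i) ω) ⬝ᵥ B *ᵥ (fun i => Y (μ n i) ω) - (B * R).trace)
        = fun ω => ∑ k, (l n k / (2 * Real.sqrt n)) *
          centeredQuad F θ₀ μ Y n (scoreMatrix Θ F θ₀ μ n k) ω := by
      ext ω
      rw [← centeredQuad_sum_smul, ← hBsum]
      rfl
    rw [hfun, htr] at hkey
    rw [dist_eq_norm]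
    have e2 : -(((σ / 2 : ℝ)) : ℂ) = -(σ : ℂ) / 2 := by push_cast; ring
    rw [e2] at hkey
    refine hkey.trans_lt ?_
    rw [div_mul_eq_mul_div, div_lt_iff₀ (by positivity)]
    have := le_abs_self σ
    nlinarith [abs_nonneg σ]
  obtain ⟨n₀, hn₀⟩ := eventually_atTop.1 hev
  exact ⟨n₀, fun n hn => hn₀ n hn.le⟩

end ScoreLimit

/-! ### Symmetric square roots acting on Euclidean space -/

section SymmetricRoot

open Matrix

variable {p : ℕ}

lemma norm_toEuclideanCLM_sq {N M : Matrix (Fin p) (Fin p) ℝ} (hN : Nᵀ = N) (hM : N * N = M)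
    (v : Param p) :
    ‖toEuclideanCLM (𝕜 := ℝ) N v‖ ^ 2 = v.ofLp ⬝ᵥ M *ᵥ v.ofLp := by
  have h : ‖toEuclideanCLM (𝕜 := ℝ) N v‖ ^ 2
      = (toEuclideanCLM (𝕜 := ℝ) N v).ofLp ⬝ᵥ (toEuclideanCLM (𝕜 := ℝ) N v).ofLp :=
    norm_toLp_sq _
  rw [h, ofLp_toEuclideanCLM, ← hM, ← mulVec_mulVec, dotProduct_mulVec v.ofLp N,
    ← mulVec_transpose, hN]

lemma toEuclideanCLM_mul_apply (A B : Matrix (Fin p) (Fin p) ℝ) (v : Param p) :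
    toEuclideanCLM (𝕜 := ℝ) (A * B) v
      = toEuclideanCLM (𝕜 := ℝ) A (toEuclideanCLM (𝕜 := ℝ) B v) := by
  rw [map_mul]
  rfl

lemma le_norm_toEuclideanCLM {N M : Matrix (Fin p) (Fin p) ℝ} (hN : Nᵀ = N) (hM : N * N = M)
    {m : ℝ} (hm : 0 < m) (h : ∀ v : Param p, m * ‖v‖ ^ 2 ≤ v.ofLp ⬝ᵥ M *ᵥ v.ofLp)
    (v : Param p) : Real.sqrt m * ‖v‖ ≤ ‖toEuclideanCLM (𝕜 := ℝ) N v‖ := by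
  refine le_of_sq_le_sq ?_ (norm_nonneg _)
  rw [mul_pow, Real.sq_sqrt hm.le, norm_toEuclideanCLM_sq hN hM]
  exact h v

lemma isUnit_det_of_sq {N M : Matrix (Fin p) (Fin p) ℝ} (hN : Nᵀ = N) (hM : N * N = M)
    {m : ℝ} (hm : 0 < m) (h : ∀ v : Param p, m * ‖v‖ ^ 2 ≤ v.ofLp ⬝ᵥ M *ᵥ v.ofLp) :
    IsUnit N.det := by
  have hMs : M.IsHermitian := by
    rw [IsHermitian, conjTranspose_eq_transpose_of_trivial, ← hM, transpose_mul, hN]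
  have hco : Coercive m M := ⟨hMs, fun v => by
    rw [← norm_toLp_sq]
    exact h (WithLp.toLp 2 v)⟩
  have := hco.isUnit_det hm
  rw [← hM, det_mul] at this
  exact isUnit_of_mul_isUnit_left this

lemma norm_le_sum_abs (v : Param p) : ‖v‖ ≤ ∑ k, |v k| := by
  conv_lhs => rw [← (EuclideanSpace.basisFun (Fin p) ℝ).sum_repr v]
  refine (norm_sum_le _ _).trans (le_of_eq ?_)
  simp [norm_smul]

end SymmetricRoot

/-! ### Asymptotic normality of the estimator -/

section Normality

open Matrix

set_option linter.unusedSectionVars false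

variable {p : ℕ} {Ω : Type*} [MeasurableSpace Ω] {P : Measure Ω} [IsProbabilityMeasure P]
  {Θ : Set (Param p)} {F : Param p → ℝ → ℝ} {θ₀ : Param p} {μ : PointArray}
  {Y : WSpace → Ω → ℝ} {c C r : ℝ}

lemma RegularModel.aemeasurable_centeredQuad (M : RegularModel P Θ F θ₀ μ Y c C r) (n : ℕ)
    (B : Matrix (Fin n) (Fin n) ℝ) : AEMeasurable (centeredQuad F θ₀ μ Y n B) P := by
  have h : ∀ i : Fin n, AEMeasurable (Y (μ n i)) P := fun i => ((M.gaussian n).eval i).aemeasurable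
  have : centeredQuad F θ₀ μ Y n B = fun ω =>
      (∑ i, Y (μ n i) ω * ∑ j, B i j * Y (μ n j) ω) - (B * covMatrix F μ n θ₀).trace := rfl
  rw [this]
  fun_prop

/-- The normalized score vector at `θ₀`. -/
noncomputable def scoreVec (Θ : Set (Param p)) (F : Param p → ℝ → ℝ) (θ₀ : Param p)
    (μ : PointArray) (Y : WSpace → Ω → ℝ) (n : ℕ) (ω : Ω) : Param p :=
  WithLp.toLp 2 fun k => centeredQuad F θ₀ μ Y n (scoreMatrix Θ F θ₀ μ n k) ω / (2 * n)

lemma RegularModel.aemeasurable_scoreVec (M : RegularModel P Θ F θ₀ μ Y c C r) (n : ℕ) :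
    AEMeasurable (scoreVec Θ F θ₀ μ Y n) P := by
  have h := fun k => M.aemeasurable_centeredQuad n (scoreMatrix Θ F θ₀ μ n k)
  have h2 : AEMeasurable (fun ω => fun k =>
      centeredQuad F θ₀ μ Y n (scoreMatrix Θ F θ₀ μ n k) ω / (2 * n)) P :=
    aemeasurable_pi_lambda _ fun k => (h k).div_const _
  exact (WithLp.measurable_toLp 2 _).comp_aemeasurable h2

/-- The linear approximation of the estimator is asymptotically standard normal. -/
lemma RegularModel.tendstoInDistribution_score (M : RegularModel P Θ F θ₀ μ Y c C r)
    {N : ℕ → Matrix (Fin p) (Fin p) ℝ} {m : ℝ} (hm : 0 < m)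
    (hN : ∀ᶠ n in atTop, (N n)ᵀ = N n ∧ N n * N n = fisherMatrix Θ F μ n θ₀)
    (hlow : ∀ᶠ n : ℕ in atTop, ∀ l : Param p,
      m * ‖l‖ ^ 2 ≤ l.ofLp ⬝ᵥ fisherMatrix Θ F μ n θ₀ *ᵥ l.ofLp) :
    TendstoInDistribution (fun (n : ℕ) (ω : Ω) => Real.sqrt n •
        toEuclideanCLM (𝕜 := ℝ) (N n)⁻¹ (scoreVec Θ F θ₀ μ Y n ω))
      atTop (fun x : Param p => x) (fun _ => P) (stdGaussian (Param p)) where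
  forall_aemeasurable n :=
    (Real.sqrt n • toEuclideanCLM (𝕜 := ℝ) (N n)⁻¹).measurable.comp_aemeasurable
      (M.aemeasurable_scoreVec n)
  tendsto := by
    refine ProbabilityMeasure.tendsto_iff_tendsto_charFun.2 fun t => ?_
    have hmeas : ∀ n : ℕ, AEMeasurable (fun ω => Real.sqrt n •
        toEuclideanCLM (𝕜 := ℝ) (N n)⁻¹ (scoreVec Θ F θ₀ μ Y n ω)) P := fun n =>
      (Real.sqrt n • toEuclideanCLM (𝕜 := ℝ) (N n)⁻¹).measurable.comp_aemeasurable
        (M.aemeasurable_scoreVec n)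
    -- Testing against `t` is testing the score in the moving direction `N⁻¹ t`, whose Fisher
    -- quadratic form is exactly `‖t‖²`. Boundedness of these directions replaces convergence of the
    -- Fisher matrices.
    set l : ℕ → Param p := fun n => toEuclideanCLM (𝕜 := ℝ) (N n)⁻¹ t with hl
    have hNl : ∀ᶠ n in atTop, toEuclideanCLM (𝕜 := ℝ) (N n) (l n) = t := by
      filter_upwards [hN, hlow] with n ⟨h1, h2⟩ h3
      rw [hl]
      simp only
      rw [← toEuclideanCLM_mul_apply, mul_nonsing_inv _ (isUnit_det_of_sq h1 h2 hm h3), map_one]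
      rfl
    have hb : ∀ᶠ n in atTop, ‖l n‖ ≤ ‖t‖ / Real.sqrt m := by
      filter_upwards [hN, hlow, hNl] with n ⟨h1, h2⟩ h3 h4
      have := le_norm_toEuclideanCLM h1 h2 hm h3 (l n)
      rw [h4] at this
      rwa [le_div_iff₀ (Real.sqrt_pos.2 hm), mul_comm]
    have hσ : ∀ᶠ n in atTop,
        (l n).ofLp ⬝ᵥ fisherMatrix Θ F μ n θ₀ *ᵥ (l n).ofLp = ‖t‖ ^ 2 := by
      filter_upwards [hN, hNl] with n ⟨h1, h2⟩ h3
      rw [← norm_toEuclideanCLM_sq h1 h2, h3]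
    have hlim := M.tendsto_charFun_score hb hσ
    have hid : (stdGaussian (Param p)).map (fun x => x) = stdGaussian (Param p) := Measure.map_id
    simp only [ProbabilityMeasure.coe_mk, hid, charFun_stdGaussian]
    push_cast at hlim
    refine hlim.congr' ?_
    filter_upwards [hN, eventually_ge_atTop 1] with n ⟨h1, _⟩ hn
    have hn0 : (0 : ℝ) < n := by exact_mod_cast hn
    have hX : AEMeasurable (fun ω => ∑ k, (l n k / (2 * Real.sqrt n)) *
          centeredQuad F θ₀ μ Y n (scoreMatrix Θ F θ₀ μ n k) ω) P :=
      Finset.aemeasurable_fun_sum _ fun k _ => (M.aemeasurable_centeredQuad n _).const_mul _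
    rw [charFun_apply_real, charFun_apply, integral_map hX (by fun_prop),
      integral_map (hmeas n) (by fun_prop)]
    refine integral_congr_ae (Eventually.of_forall fun ω => ?_)
    have h1' : ((N n)⁻¹)ᵀ = (N n)⁻¹ := by rw [transpose_nonsing_inv, h1]
    have hinner : inner ℝ (Real.sqrt n •
        toEuclideanCLM (𝕜 := ℝ) (N n)⁻¹ (scoreVec Θ F θ₀ μ Y n ω)) t
        = ∑ k, (l n k / (2 * Real.sqrt n)) *
          centeredQuad F θ₀ μ Y n (scoreMatrix Θ F θ₀ μ n k) ω := by
      rw [real_inner_smul_left, real_inner_comm, inner_toEuclideanCLM, dotProduct_mulVec,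
        ← mulVec_transpose, h1', ← ofLp_toEuclideanCLM, dotProduct, Finset.mul_sum]
      refine Finset.sum_congr rfl fun k _ => ?_
      have hs : Real.sqrt n / n = 1 / Real.sqrt n := by
        rw [div_eq_div_iff hn0.ne' (Real.sqrt_pos.2 hn0).ne', Real.mul_self_sqrt hn0.le, one_mul]
      simp only [scoreVec, hl]
      set q := centeredQuad F θ₀ μ Y n (scoreMatrix Θ F θ₀ μ n k) ω
      set u := ((toEuclideanCLM (𝕜 := ℝ) (N n)⁻¹) t).ofLp k
      calc Real.sqrt n * (u * (q / (2 * n))) = (Real.sqrt n / n) * (u * q / 2) := by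
            field_simp
        _ = u / (2 * Real.sqrt n) * q := by rw [hs]; field_simp
    simp only
    rw [hinner, Complex.ofReal_one, one_mul]

/-- The estimation error agrees with its linear approximation to leading order. -/
lemma RegularModel.tendstoInMeasure_error (M : RegularModel P Θ F θ₀ μ Y c C r)
    (hb : Bornology.IsBounded Θ) (hcone : ConeCondition Θ) (h5 : Condition5 Θ F μ θ₀)
    {θhat : ℕ → Ω → Param p} (hθ : IsMLE P Θ F μ Y θhat)
    {N : ℕ → Matrix (Fin p) (Fin p) ℝ} {m : ℝ} (hm : 0 < m)
    (hN : ∀ᶠ n in atTop, (N n)ᵀ = N n ∧ N n * N n = fisherMatrix Θ F μ n θ₀)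
    (hlow : ∀ᶠ n : ℕ in atTop, ∀ l : Param p,
      m * ‖l‖ ^ 2 ≤ l.ofLp ⬝ᵥ fisherMatrix Θ F μ n θ₀ *ᵥ l.ofLp) :
    TendstoInMeasure P
      ((fun (n : ℕ) (ω : Ω) => Real.sqrt n • toEuclideanCLM (𝕜 := ℝ) (N n) (θhat n ω - θ₀))
        - fun (n : ℕ) (ω : Ω) => Real.sqrt n •
          toEuclideanCLM (𝕜 := ℝ) (N n)⁻¹ (scoreVec Θ F θ₀ μ Y n ω)) atTop 0 := by
  have hc := M.c_pos
  have hC := M.C_pos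
  obtain ⟨K, hK, hexp⟩ := M.exists_score_expansion
  rw [tendstoInMeasure_iff_norm]
  intro γ hγ
  rw [ENNReal.tendsto_nhds_zero]
  intro ρ hρ
  set s₀ := Real.sqrt m with hs₀
  have hs₀0 : 0 < s₀ := Real.sqrt_pos.2 hm
  have hs₀s : s₀ * s₀ = m := Real.mul_self_sqrt hm.le
  set v := c⁻¹ * C * c⁻¹ * C with hv
  -- Tightness: Chebyshev at level `2 √n t` bounds the probability of a large score uniformly in
  -- `n`.
  obtain ⟨t, ht, htρ⟩ : ∃ t : ℝ, 0 < t ∧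
      ∑ _k : Fin p, ENNReal.ofReal (v ^ 2 / (2 * t ^ 2)) ≤ ρ / 2 := by
    have h1 : Tendsto (fun t : ℝ => ∑ _k : Fin p, ENNReal.ofReal (v ^ 2 / (2 * t ^ 2))) atTop
        (𝓝 (∑ _k : Fin p, 0)) := by
      refine tendsto_finsetSum _ fun k _ => ?_
      rw [← ENNReal.ofReal_zero]
      refine ENNReal.tendsto_ofReal (Tendsto.div_atTop tendsto_const_nhds ?_)
      exact (tendsto_pow_atTop two_ne_zero).const_mul_atTop two_pos
    rw [Finset.sum_const_zero] at h1
    obtain ⟨t, h2, h3⟩ := ((h1.eventually_le_const (ENNReal.half_pos hρ.ne')).and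
      (eventually_gt_atTop 0)).exists
    exact ⟨t, h3, h2⟩
  set κ := p * ((p + K * (C + 2)) / 2) / m with hκ
  have hκ0 : 0 ≤ κ := by positivity
  set τ := s₀⁻¹ * (p * t) with hτ
  have hτ0 : 0 ≤ τ := by positivity
  -- `κ ε` is the relative error in `‖X - Z‖ ≤ κ ε ‖X‖`, and `τ` bounds `‖Z‖`. The second constraint
  -- gives `‖X‖ ≤ 2τ` by absorption, and the third brings the error below `γ`.
  obtain ⟨ε, hε, hεr, hε1, hε2⟩ : ∃ ε > 0, ε ≤ r ∧ κ * ε ≤ 1 / 2 ∧ 2 * (κ * ε) * τ < γ := by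
    refine ⟨min r (min (1 / (2 * (κ + 1))) (γ / (2 * (κ + 1) * (τ + 1)))),
      lt_min M.r_pos (lt_min (by positivity) (by positivity)), min_le_left _ _, ?_, ?_⟩
    · calc _ ≤ κ * (1 / (2 * (κ + 1))) := by
            gcongr
            exact (min_le_right _ _).trans (min_le_left _ _)
        _ ≤ 1 / 2 := by
            rw [mul_one_div, div_le_div_iff₀ (by positivity) (by positivity)]
            linarith
    · calc _ ≤ 2 * (κ * (γ / (2 * (κ + 1) * (τ + 1)))) * τ := by
            gcongr
            exact (min_le_right _ _).trans (min_le_right _ _)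
        _ = γ * ((κ * τ) / ((κ + 1) * (τ + 1))) := by field_simp
        _ < γ * 1 := by
            gcongr
            rw [div_lt_one (by positivity)]
            nlinarith
        _ = γ := mul_one γ
  have hrest : Tendsto (fun n : ℕ => P {ω | ε ≤ ‖θhat n ω - θ₀‖}
      + ((∑ k, ∑ j, P {ω | ε * n ≤ |centeredQuad F θ₀ μ Y n (hessMatrix Θ F θ₀ μ n j k) ω|})
        + P {ω | (C + 1) * n ≤ sample μ Y n ω ⬝ᵥ sample μ Y n ω})) atTop (𝓝 0) := by
    have e : (0 : ℝ≥0∞) = 0 + ((∑ _k : Fin p, ∑ _j : Fin p, 0) + 0) := by simp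
    rw [e]
    refine (M.consistency hb hcone h5 hθ hε).add ((tendsto_finsetSum _ fun k _ =>
      tendsto_finsetSum _ fun j _ => ?_).add M.tendsto_sample_norm)
    exact M.tendsto_centeredQuad (fun n hn => M.norm_hessMatrix_le hn j k) hε
  filter_upwards [hN, hlow, hrest.eventually_le_const (ENNReal.half_pos hρ.ne'),
    eventually_ge_atTop 1] with n ⟨hNt, hNM⟩ hlown hrestn hn
  have hn0 : (0 : ℝ) < n := by exact_mod_cast hn
  have hsn : 0 < Real.sqrt n := Real.sqrt_pos.2 hn0
  have hsnn : Real.sqrt n * Real.sqrt n = n := Real.mul_self_sqrt hn0.le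
  set bad : Set Ω :=
    (⋃ k ∈ (Finset.univ : Finset (Fin p)),
      {ω | 2 * Real.sqrt n * t ≤ |centeredQuad F θ₀ μ Y n (scoreMatrix Θ F θ₀ μ n k) ω|}) ∪
    ({ω | ε ≤ ‖θhat n ω - θ₀‖} ∪
      ((⋃ k ∈ (Finset.univ : Finset (Fin p)), ⋃ j ∈ (Finset.univ : Finset (Fin p)),
        {ω | ε * n ≤ |centeredQuad F θ₀ μ Y n (hessMatrix Θ F θ₀ μ n j k) ω|})
        ∪ {ω | (C + 1) * n ≤ sample μ Y n ω ⬝ᵥ sample μ Y n ω})) with hbad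
  have hbadP : P bad ≤ ρ := by
    have h1 : P (⋃ k ∈ (Finset.univ : Finset (Fin p)),
        {ω | 2 * Real.sqrt n * t ≤ |centeredQuad F θ₀ μ Y n (scoreMatrix Θ F θ₀ μ n k) ω|})
        ≤ ρ / 2 := by
      refine (measure_biUnion_finset_le _ _).trans (le_trans (Finset.sum_le_sum fun k _ => ?_) htρ)
      refine (M.chebyshev hn (M.norm_scoreMatrix_le hn k) (by positivity)).trans
        (ENNReal.ofReal_le_ofReal (le_of_eq ?_))
      have : (2 * Real.sqrt n * t) ^ 2 = 4 * n * t ^ 2 := by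
        rw [mul_pow, mul_pow, Real.sq_sqrt hn0.le]; ring
      rw [this, hv]
      field_simp
      norm_num
    calc P bad ≤ ρ / 2 + ρ / 2 := (measure_union_le _ _).trans (add_le_add h1
          (le_trans ((measure_union_le _ _).trans (add_le_add le_rfl ((measure_union_le _ _).trans
            (add_le_add ?_ le_rfl)))) hrestn))
      _ = ρ := ENNReal.add_halves ρ
    exact (measure_biUnion_finset_le _ _).trans
      (Finset.sum_le_sum fun k _ => measure_biUnion_finset_le _ _)
  refine le_trans (measure_mono_ae ?_) hbadP
  filter_upwards [hθ.2 n hn] with ω hω hγω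
  obtain ⟨-, hmin⟩ := hω
  by_contra hnb
  change ω ∉ bad at hnb
  simp only [hbad, Set.mem_union, Set.mem_iUnion, not_or, not_exists, Set.mem_ofPred_eq,
    not_le, Finset.mem_univ, true_implies] at hnb
  obtain ⟨hb1, hb2, hb3, hb4⟩ := hnb
  set δ := θhat n ω - θ₀ with hδ
  set ξ := scoreVec Θ F θ₀ μ Y n ω with hξ
  set T := fun A : Matrix (Fin p) (Fin p) ℝ => toEuclideanCLM (𝕜 := ℝ) A with hT
  have hδball : θhat n ω ∈ Metric.ball θ₀ r := by
    rw [Metric.mem_ball, dist_eq_norm]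
    exact hb2.trans_le hεr
  have hcoord : ∀ k, |(T (fisherMatrix Θ F μ n θ₀) δ - ξ) k|
      ≤ ‖δ‖ * ε * ((p + K * (C + 2)) / 2) := by
    intro k
    have h1 := hexp n hn _ hδball ω hmin k
    have h2 : ∑ j, |centeredQuad F θ₀ μ Y n (hessMatrix Θ F θ₀ μ n j k) ω| ≤ p * (ε * n) := by
      refine (Finset.sum_le_sum fun j _ => (hb3 k j).le).trans (le_of_eq ?_)
      simp
    have h3 : (T (fisherMatrix Θ F μ n θ₀) δ - ξ) k = (2 * n * ∑ j,
        fisherMatrix Θ F μ n θ₀ k j * δ j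
          - centeredQuad F θ₀ μ Y n (scoreMatrix Θ F θ₀ μ n k) ω) / (2 * n) := by
      change (∑ j, fisherMatrix Θ F μ n θ₀ k j * δ j)
        - centeredQuad F θ₀ μ Y n (scoreMatrix Θ F θ₀ μ n k) ω / (2 * n) = _
      field_simp
    rw [h3, abs_div, abs_of_pos (by positivity : (0 : ℝ) < 2 * n), div_le_iff₀ (by positivity)]
    refine h1.trans ?_
    have h4 : K * ‖δ‖ ^ 2 * (n + sample μ Y n ω ⬝ᵥ sample μ Y n ω)
        ≤ K * (‖δ‖ * ε) * (n + (C + 1) * n) := by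
      have hy : 0 ≤ sample μ Y n ω ⬝ᵥ sample μ Y n ω := dotProduct_self_nonneg' _
      have : 0 ≤ n + sample μ Y n ω ⬝ᵥ sample μ Y n ω := by positivity
      rw [sq]
      gcongr
    have h5 := mul_le_mul_of_nonneg_left h2 (norm_nonneg δ)
    calc _ ≤ ‖δ‖ * (p * (ε * n)) + K * (‖δ‖ * ε) * (n + (C + 1) * n) := add_le_add h5 h4
      _ = _ := by ring
  have hNu := isUnit_det_of_sq hNt hNM hm hlown
  have hnorm : ‖T (fisherMatrix Θ F μ n θ₀) δ - ξ‖
      ≤ p * (‖δ‖ * ε * ((p + K * (C + 2)) / 2)) := by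
    refine (norm_le_sum_abs _).trans ((Finset.sum_le_sum fun k _ => hcoord k).trans (le_of_eq ?_))
    simp
  have hNinv : ∀ w : Param p, s₀ * ‖T (N n)⁻¹ w‖ ≤ ‖w‖ := fun w => by
    have := le_norm_toEuclideanCLM hNt hNM hm hlown (T (N n)⁻¹ w)
    rwa [hT, ← toEuclideanCLM_mul_apply, mul_nonsing_inv _ hNu, map_one] at this
  set X := Real.sqrt n • T (N n) δ with hX
  set Z := Real.sqrt n • T (N n)⁻¹ ξ with hZ
  -- Because `N⁻¹ M = N`, the difference is the residual of the linearized likelihood equations.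
  have hXZ : X - Z = Real.sqrt n • T (N n)⁻¹ (T (fisherMatrix Θ F μ n θ₀) δ - ξ) := by
    have : T (N n)⁻¹ (T (fisherMatrix Θ F μ n θ₀) δ) = T (N n) δ := by
      rw [hT]
      simp only
      rw [← toEuclideanCLM_mul_apply, ← hNM, ← mul_assoc, nonsing_inv_mul _ hNu, one_mul]
    rw [map_sub, this, smul_sub]
  have hXlow : Real.sqrt n * (s₀ * ‖δ‖) ≤ ‖X‖ := by
    rw [hX, norm_smul, Real.norm_of_nonneg hsn.le]
    exact mul_le_mul_of_nonneg_left (le_norm_toEuclideanCLM hNt hNM hm hlown δ) hsn.le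
  have hXZle : ‖X - Z‖ ≤ κ * ε * ‖X‖ := by
    have h1 := hNinv (T (fisherMatrix Θ F μ n θ₀) δ - ξ)
    have h2 : m * ‖X - Z‖ ≤ p * ((p + K * (C + 2)) / 2) * ε * (Real.sqrt n * (s₀ * ‖δ‖)) := by
      rw [hXZ, norm_smul, Real.norm_of_nonneg hsn.le, ← hs₀s]
      calc _ = Real.sqrt n * s₀ * (s₀ * ‖T (N n)⁻¹ (T (fisherMatrix Θ F μ n θ₀) δ - ξ)‖) := by ring
        _ ≤ Real.sqrt n * s₀ * (p * (‖δ‖ * ε * ((p + K * (C + 2)) / 2))) := by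
            exact mul_le_mul_of_nonneg_left (h1.trans hnorm) (by positivity)
        _ = _ := by ring
    calc ‖X - Z‖ = (m * ‖X - Z‖) / m := by field_simp
      _ ≤ (p * ((p + K * (C + 2)) / 2) * ε * ‖X‖) / m := by
          refine div_le_div_of_nonneg_right (h2.trans ?_) hm.le
          exact mul_le_mul_of_nonneg_left hXlow (by positivity)
      _ = κ * ε * ‖X‖ := by rw [hκ]; ring
  have hZle : ‖Z‖ ≤ τ := by
    have h1 : Real.sqrt n * ‖ξ‖ ≤ p * t := by
      have h2 : ∀ k, |ξ k| ≤ t / Real.sqrt n := fun k => by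
        change |centeredQuad F θ₀ μ Y n (scoreMatrix Θ F θ₀ μ n k) ω / (2 * n)| ≤ _
        rw [abs_div, abs_of_pos (by positivity : (0 : ℝ) < 2 * n), div_le_div_iff₀ (by positivity) hsn]
        calc _ ≤ 2 * Real.sqrt n * t * Real.sqrt n := by
              gcongr
              exact (hb1 k).le
          _ = t * (2 * (Real.sqrt n * Real.sqrt n)) := by ring
          _ = t * (2 * n) := by rw [hsnn]
      calc Real.sqrt n * ‖ξ‖ ≤ Real.sqrt n * ∑ _k : Fin p, t / Real.sqrt n := by
            gcongr
            exact (norm_le_sum_abs _).trans (Finset.sum_le_sum fun k _ => h2 k)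
        _ = p * t := by
            rw [Finset.sum_const, Finset.card_univ, Fintype.card_fin, nsmul_eq_mul]
            field_simp
    rw [hZ, norm_smul, Real.norm_of_nonneg hsn.le, hτ, inv_mul_eq_div, le_div_iff₀ hs₀0]
    calc _ = Real.sqrt n * (s₀ * ‖T (N n)⁻¹ ξ‖) := by ring
      _ ≤ Real.sqrt n * ‖ξ‖ := by gcongr; exact hNinv ξ
      _ ≤ p * t := h1
  have hX2 : ‖X‖ ≤ 2 * τ := by
    have h1 : ‖X‖ ≤ ‖X - Z‖ + ‖Z‖ := by
      calc ‖X‖ = ‖(X - Z) + Z‖ := by rw [sub_add_cancel]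
        _ ≤ _ := norm_add_le _ _
    have h2 : κ * ε * ‖X‖ ≤ 1 / 2 * ‖X‖ := by gcongr
    linarith
  have hfinal : ‖X - Z‖ < γ := by
    calc ‖X - Z‖ ≤ κ * ε * (2 * τ) := hXZle.trans (by gcongr)
      _ = 2 * (κ * ε) * τ := by ring
      _ < γ := hε2
  change γ ≤ ‖X - Z - (0 : Param p)‖ at hγω
  rw [sub_zero] at hγω
  linarith

end Normality

/-! ### Extreme eigenvalues and the matrix square root -/

section Eigenvalues

open Matrix

lemma le_lambdaMin_of_quadForm_le {p : ℕ} {A : Matrix (Fin p) (Fin p) ℝ} (hA : A.IsHermitian)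
    {m : ℝ} (h : ∀ l : Param p, m * ‖l‖ ^ 2 ≤ l.ofLp ⬝ᵥ A *ᵥ l.ofLp) :
    (m : EReal) ≤ lambdaMin A := by
  refine le_iInf₂ fun x hx => ?_
  obtain ⟨v, hv, rfl⟩ := dotProduct_eq_of_mulVec_eigen hA hx
  have := h (WithLp.toLp 2 v)
  rw [norm_toLp_sq, hv, mul_one] at this
  exact_mod_cast this

lemma lambdaMax_le_of_quadForm_le {p : ℕ} {A : Matrix (Fin p) (Fin p) ℝ} (hA : A.IsHermitian)
    {m : ℝ} (h : ∀ l : Param p, l.ofLp ⬝ᵥ A *ᵥ l.ofLp ≤ m * ‖l‖ ^ 2) :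
    lambdaMax A ≤ (m : EReal) := by
  refine iSup₂_le fun x hx => ?_
  obtain ⟨v, hv, rfl⟩ := dotProduct_eq_of_mulVec_eigen hA hx
  have := h (WithLp.toLp 2 v)
  rw [norm_toLp_sq, hv, mul_one] at this
  exact_mod_cast this

/-- For `p = 0` the spectrum is empty, and the infimum `⊤` exceeds the supremum `⊥`. -/
lemma lambdaMin_le_lambdaMax {p : ℕ} (hp : 0 < p) {A : Matrix (Fin p) (Fin p) ℝ}
    (hA : A.IsHermitian) : lambdaMin A ≤ lambdaMax A := by
  have hx : hA.eigenvalues ⟨0, hp⟩ ∈ spectrum ℝ A := by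
    rw [hA.spectrum_real_eq_range_eigenvalues]
    exact Set.mem_range_self _
  exact (iInf₂_le _ hx).trans (le_iSup₂ (f := fun (x : ℝ) (_ : x ∈ spectrum ℝ A) => (x : EReal)) _ hx)

/-- The root squares back to `A` because the lower bound makes `A` positive semidefinite. For the
Fisher matrices that bound is available for large `n`, which suffices for the limit. -/
lemma transpose_sqrt_and_sqrt_mul_sqrt {p : ℕ} {A : Matrix (Fin p) (Fin p) ℝ}
    (hA : A.IsHermitian) {m : ℝ} (hm : 0 < m)
    (h : ∀ l : Param p, m * ‖l‖ ^ 2 ≤ l.ofLp ⬝ᵥ A *ᵥ l.ofLp) :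
    (CFC.sqrt A)ᵀ = CFC.sqrt A ∧ CFC.sqrt A * CFC.sqrt A = A := by
  have hS : A.PosSemidef := by
    refine .of_dotProduct_mulVec_nonneg hA fun x => ?_
    rw [star_trivial]
    exact (by positivity : (0 : ℝ) ≤ m * ‖WithLp.toLp 2 x‖ ^ 2).trans (h (WithLp.toLp 2 x))
  refine ⟨?_, CFC.sqrt_mul_sqrt_self _ hS.nonneg⟩
  have := (CFC.sqrt_nonneg A).posSemidef.1
  rwa [IsHermitian, conjTranspose_eq_transpose_of_trivial] at this

end Eigenvalues

end WassersteinGP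

/-! ### The limit theorem -/

theorem mainTheorem5 {p : ℕ} (hp : 0 < p) {Ω : Type*} [MeasurableSpace Ω]
    (P : Measure Ω) [IsProbabilityMeasure P]
    (Θ : Set (WassersteinGP.Param p)) (F : WassersteinGP.Param p → ℝ → ℝ)
    (θ₀ : WassersteinGP.Param p) (μ : WassersteinGP.PointArray)
    (Y : WassersteinGP.WSpace → Ω → ℝ) (θhat : ℕ → Ω → WassersteinGP.Param p)
    (L A τ c : ℝ) (hτ : 1 < τ) (hc : 0 < c)
    (hΘ_bounded : Bornology.IsBounded Θ) (hΘ_cone : WassersteinGP.ConeCondition Θ)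
    (hθ₀ : θ₀ ∈ interior Θ)
    (h1 : WassersteinGP.Condition1 μ L)
    (h2 : WassersteinGP.Condition2 Θ F A τ)
    (h3 : WassersteinGP.Condition3 P Θ F θ₀ Y)
    (h4 : WassersteinGP.Condition4 Θ F μ c)
    (h5 : WassersteinGP.Condition5 Θ F μ θ₀)
    (h6 : WassersteinGP.Condition6 Θ F A τ)
    (h7 : WassersteinGP.Condition7 Θ F A τ)
    (h8 : WassersteinGP.Condition8 Θ F μ θ₀)
    (hθhat : WassersteinGP.IsMLE P Θ F μ Y θhat) :
    TendstoInDistribution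
      (fun (n : ℕ) (ω : Ω) => Real.sqrt n •
        Matrix.toEuclideanCLM (𝕜 := ℝ) (CFC.sqrt (WassersteinGP.fisherMatrix Θ F μ n θ₀))
          (θhat n ω - θ₀))
      atTop (fun x : WassersteinGP.Param p => x) (fun _ => P)
      (stdGaussian (WassersteinGP.Param p)) ∧
    0 < liminf (fun n : ℕ =>
      WassersteinGP.lambdaMin (WassersteinGP.fisherMatrix Θ F μ n θ₀)) atTop ∧
    liminf (fun n : ℕ =>
        WassersteinGP.lambdaMin (WassersteinGP.fisherMatrix Θ F μ n θ₀)) atTop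
      ≤ limsup (fun n : ℕ =>
        WassersteinGP.lambdaMax (WassersteinGP.fisherMatrix Θ F μ n θ₀)) atTop ∧
    limsup (fun n : ℕ =>
      WassersteinGP.lambdaMax (WassersteinGP.fisherMatrix Θ F μ n θ₀)) atTop < ⊤ := by

  obtain ⟨C, r, M⟩ := WassersteinGP.exists_regularModel hτ hc hθ₀ h1 h2 h3 h4 h6 h7
  obtain ⟨m₀, hm₀, hlow⟩ := M.fisher_quadForm_ge h8
  obtain ⟨m₁, -, hup⟩ := M.fisher_quadForm_le
  have hH := fun n => WassersteinGP.fisherMatrix_isHermitian (Θ := Θ) (F := F) (μ := μ) (θ₀ := θ₀) n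
  refine ⟨?_, ?_, ?_, ?_⟩
  · have hN := hlow.mono fun n hn =>
      WassersteinGP.transpose_sqrt_and_sqrt_mul_sqrt (hH n) hm₀ hn
    -- Slutsky's lemma: the linear approximation converges in law, and the remainder vanishes in
    -- probability.
    refine tendstoInDistribution_of_tendstoInMeasure_sub _ _
      (M.tendstoInDistribution_score hm₀ hN hlow)
      (M.tendstoInMeasure_error hΘ_bounded hΘ_cone h5 hθhat hm₀ hN hlow) fun n => ?_
    exact (Real.sqrt n • Matrix.toEuclideanCLM (𝕜 := ℝ)
      (CFC.sqrt (WassersteinGP.fisherMatrix Θ F μ n θ₀))).measurable.comp_aemeasurable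
      ((hθhat.1 n).sub_const θ₀)
  · exact (EReal.coe_pos.2 hm₀).trans_le (le_liminf_of_le (by isBoundedDefault)
      (hlow.mono fun n hn => WassersteinGP.le_lambdaMin_of_quadForm_le (hH n) hn))
  · exact (liminf_le_liminf (Eventually.of_forall fun n =>
      WassersteinGP.lambdaMin_le_lambdaMax hp (hH n))).trans (liminf_le_limsup)
  · exact (limsup_le_of_le (by isBoundedDefault) ((eventually_ge_atTop 1).mono fun n hn =>
      WassersteinGP.lambdaMax_le_of_quadForm_le (hH n) (hup n hn))).trans_lt (EReal.coe_lt_top m₁)
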